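/- **Conventions.** Let $A$ be a closed oriented annulus and $I=[0,1]$. An oriented annular link $(L,o)\subset A\times I$ is given by an oriented link diagram $\mathcal P$ in $A$, viewed in $S^2\setminus\{\mathbb X,\mathbb O\}$, where $\mathbb X$ and $\mathbb O$ are base points in the discs bounded by the inner and the outer boundary circle of $A$. The empty link is allowed. *Lee complex.* Let $\mathcal C$ be the complex vector space whose distinguished basis consists of the complete resolutions of $\mathcal P$ with every circle labelled $v_+$ or $v_-$. The differential $\partial^{Lee}$ is the signed sum, over all changes of one $0$-smoothing into a $1$-smoothing, of the merge and split maps $$m:\ v_+v_+\mapsto v_+,\quad v_+v_-,\,v_-v_+\mapsto v_-,\quad v_-v_-\mapsto v_+,$$ $$\Delta:\ v_+\mapsto v_+\otimes v_-+v_-\otimes v_+,\quad v_-\mapsto v_-\otimes v_-+v_+\otimes v_+ ,$$ where the sign is $-1$ to the number of $1$-smoothings at earlier crossings. *Gradings.* For a basis element $\mathbf x$ let $$j(\mathbf x)=\#\{v_+\}-\#\{v_-\}+\#\{1\text{-smoothings}\}+n_+-2n_-,$$ where $n_\pm$ is the number of positive/negative crossings. Let $k(\mathbf x)$ be the sum,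 over the circles that meet an arc from $\mathbb X$ to $\mathbb O$ in an odd number of points, of $+1$ for a label $v_+$ and $-1$ for a label $v_-$. For $t\in[0,2]$ put $j_t=j-t\,k$ and $\mathcal F^t_s=\mathrm{Span}\{\mathbf x : j_t(\mathbf x)\ge s\}$. For a chain $x\ne0$ let $\mathrm{gr}_{j_t}(x)=\max\{s : x\in\mathcal F^t_s\}$, and for a homology class $\eta\neq 0$ let $\mathrm{gr}_{j_t}(\eta)=\max\{\mathrm{gr}_{j_t}(x) : [x]=\eta\}$. *Canonical class.* The canonical Lee cycle $\mathfrak s_o$ is the oriented resolution of $\mathcal P$ with each circle $C$ labelled by $\mathbf a=v_-+v_+$ or $\mathbf b=v_--v_+$, according as the number of circles separating $C$ from $\mathbb O$, plus $1$ if $C$ is oriented counterclockwise, is even or odd. The annular Rasmussen invariant is $$d_t(L,o)=\mathrm{gr}_{j_t}([\mathfrak s_o])\in\mathbb R\qquad(t\in[0,2]),$$ computed from any diagram of $(L,o)$, and its slope is $$m_t(L,o)=\lim_{\epsilon\to0^+}\frac{d_{t+\epsilon}(L,o)-d_t(L,o)}{\epsilon}\qquad(t\in[0,2)).$$ *Annular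 composition.* A diagram of $(L,o)\amalg(L',o')$ is obtained from diagrams of $(L,o)$ and $(L',o')$ by identifying the inner boundary of the annulus containing the diagram of $L$ with the outer boundary of the annulus containing the diagram of $L'$, keeping the orientations. **Proposition.** Let $(L,o),(L',o')\subset A\times I$ be oriented annular links, given by arbitrary diagrams, and let $(L,o)\amalg(L',o')$ be their annular composition, with the diagram just described. Then for all $t\in[0,2]$ the maxima defining $d_t$ of $(L,o)$, $(L',o')$ and $(L,o)\amalg(L',o')$ exist, and $$d_t\big((L,o)\amalg(L',o')\big)=d_t(L,o)+d_t(L',o').$$ Moreover, for all $t\in[0,2)$ the slopes exist and $$m_t\big((L,o)\amalg(L',o')\big)=m_t(L,o)+m_t(L',o').$$ -/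

import Mathlib

open Set Filter Topology

/-!
Oriented annular link diagrams, in general position with respect to the angular coordinate.

The annulus is swept counterclockwise by a radial arc running from the inner basepoint `X` to the
outer basepoint `O`.  Between finitely many angles the arc meets the diagram in finitely many
strands; these are listed from left to right, i.e. from the innermost to the outermost one, and each
is recorded by its direction: `true` if it runs counterclockwise around `X` (upwards, when the angle
is drawn vertically), `false` if it runs clockwise (downwards).  At finitely many angles one of the
following elementary events occurs.  Up to planar isotopy in the annulus every diagram of an
oriented annular link has this form.
-/

/-- An elementary event between two consecutive positions of the sweeping arc.
* `birth i b` : a local minimum of the angle, creating two adjacent strands in positions `i`,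
  `i + 1`, with directions `b` and `!b`;
* `death i` : a local maximum of the angle, joining the strands in positions `i`, `i + 1`;
* `cross i s` : a crossing of the strands in positions `i`, `i + 1`.  If `s = true`, the strand going
  from the lower left (inner) to the upper right (outer) is the overcrossing one; if `s = false`,
  the strand going from the lower right to the upper left is. -/
inductive AnnularEvent where
  | birth (i : ℕ) (b : Bool)
  | death (i : ℕ)
  | cross (i : ℕ) (s : Bool)

namespace AnnularEvent

/-- The position of the left strand that takes part in the event. -/
def pos : AnnularEvent → ℕ
  | birth i _ => i
  | death i => i
  | cross i _ => i

/-- For a crossing: is the strand from lower left to upper right the overcrossing strand? -/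
def risingOver : AnnularEvent → Bool
  | cross _ s => s
  | _ => false

/-- Is the event a crossing? -/
def IsCross : AnnularEvent → Prop
  | cross _ _ => True
  | _ => False

/-- The event can happen to the given list of oriented strands (for a death, the two strands must
have opposite directions, so that orientations match). -/
def Valid : AnnularEvent → List Bool → Prop
  | birth i _, l => i ≤ l.length
  | death i, l => ∃ b, l[i]? = some b ∧ l[i + 1]? = some (!b)
  | cross i _, l => i + 1 < l.length

/-- The oriented strands after the event. -/
def apply : AnnularEvent → List Bool → List Bool
  | birth i b, l => l.take i ++ b :: (!b) :: l.drop i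
  | death i, l => l.take i ++ l.drop (i + 2)
  | cross i _, l => l.take i ++ (((l.drop i).take 2).reverse ++ l.drop (i + 2))

/-- The same event, happening `n` positions further out. -/
def shift (n : ℕ) : AnnularEvent → AnnularEvent
  | birth i b => birth (n + i) b
  | death i => death (n + i)
  | cross i s => cross (n + i) s

theorem Valid.append_right {e : AnnularEvent} {l : List Bool} (h : e.Valid l) (r : List Bool) :
    e.Valid (l ++ r) := by
  cases e with
  | birth i b => simp only [Valid, List.length_append] at *; omega
  | death i =>
    obtain ⟨b, h1, h2⟩ := h
    refine ⟨b, ?_, ?_⟩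
    · rw [List.getElem?_append_left (List.getElem?_eq_some_iff.1 h1).1, h1]
    · rw [List.getElem?_append_left (List.getElem?_eq_some_iff.1 h2).1, h2]
  | cross i s => simp only [Valid, List.length_append] at *; omega

theorem apply_append_right {e : AnnularEvent} {l : List Bool} (h : e.Valid l) (r : List Bool) :
    e.apply (l ++ r) = e.apply l ++ r := by
  cases e with
  | birth i b =>
    simp only [Valid] at h
    simp [apply, List.take_append_of_le_length h, List.drop_append_of_le_length h]
  | death i =>
    obtain ⟨b, h1, h2⟩ := h
    have h3 := (List.getElem?_eq_some_iff.1 h2).1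
    simp [apply, List.take_append_of_le_length (show i ≤ l.length by omega),
      List.drop_append_of_le_length (show i + 2 ≤ l.length by omega)]
  | cross i s =>
    simp only [Valid] at h
    simp [apply, List.take_append_of_le_length (show i ≤ l.length by omega),
      List.drop_append_of_le_length (show i ≤ l.length by omega),
      List.drop_append_of_le_length (show i + 2 ≤ l.length by omega),
      List.take_append_of_le_length (show 2 ≤ (l.drop i).length by rw [List.length_drop]; omega)]

theorem Valid.shift {e : AnnularEvent} {r : List Bool} (h : e.Valid r) (l : List Bool) :
    (e.shift l.length).Valid (l ++ r) := by
  cases e with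
  | birth i b => simp only [AnnularEvent.shift, Valid, List.length_append] at *; omega
  | death i =>
    obtain ⟨b, h1, h2⟩ := h
    refine ⟨b, ?_, ?_⟩
    · rw [List.getElem?_append_right (by omega), ← h1]; congr 1; omega
    · rw [List.getElem?_append_right (by omega), ← h2]; congr 1; omega
  | cross i s => simp only [AnnularEvent.shift, Valid, List.length_append] at *; omega

theorem apply_shift (e : AnnularEvent) (l r : List Bool) :
    (e.shift l.length).apply (l ++ r) = l ++ e.apply r := by
  cases e with
  | birth i b => simp [AnnularEvent.shift, apply, List.take_length_add_append,
      List.drop_length_add_append]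
  | death i => simp [AnnularEvent.shift, apply, List.take_length_add_append, add_assoc,
      List.drop_length_add_append]
  | cross i s => simp [AnnularEvent.shift, apply, List.take_length_add_append, add_assoc,
      List.drop_length_add_append]

/-- The oriented strands after the first `h` events of the word `w`, starting from `l`. -/
def levelAt (l : List Bool) (w : List AnnularEvent) (h : ℕ) : List Bool :=
  (w.take h).foldl (fun l e => e.apply l) l

theorem levelAt_zero (l : List Bool) (w : List AnnularEvent) : levelAt l w 0 = l := by
  simp [levelAt]

theorem levelAt_succ (l : List Bool) (w : List AnnularEvent) (h : ℕ) (hh : h < w.length) :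
    levelAt l w (h + 1) = (w[h]).apply (levelAt l w h) := by
  rw [levelAt, levelAt, List.take_succ_eq_append_getElem hh, List.foldl_append]
  rfl

end AnnularEvent

/-- An oriented annular link diagram: the oriented strands met by the arc from `X` to `O` at angle
`0`, and the events met during one full counterclockwise turn of the arc. -/
structure OrientedAnnularDiagram where
  start : List Bool
  word : List AnnularEvent
  valid : ∀ (h : ℕ) (hh : h < word.length), (word[h]).Valid (AnnularEvent.levelAt start word h)
  closed : AnnularEvent.levelAt start word word.length = start

namespace OrientedAnnularDiagram

open AnnularEvent

/-- The oriented strands met by the arc after the first `h` events. -/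
def level (D : OrientedAnnularDiagram) (h : ℕ) : List Bool :=
  levelAt D.start D.word h

theorem level_zero (D : OrientedAnnularDiagram) : D.level 0 = D.start := levelAt_zero _ _

theorem level_length (D : OrientedAnnularDiagram) : D.level D.word.length = D.start := D.closed

theorem level_succ (D : OrientedAnnularDiagram) (h : ℕ) (hh : h < D.word.length) :
    D.level (h + 1) = (D.word[h]).apply (D.level h) := levelAt_succ _ _ _ hh

/-- The word of the annular composition: first the events of the inner diagram `D'`, then those of
the outer diagram `D`, pushed outwards past the strands of `D'`. -/
def compWord (D D' : OrientedAnnularDiagram) : List AnnularEvent :=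
  D'.word ++ D.word.map (AnnularEvent.shift D'.start.length)

theorem levelAt_comp_left (D D' : OrientedAnnularDiagram) (h : ℕ) (hh : h ≤ D'.word.length) :
    levelAt (D'.start ++ D.start) (compWord D D') h = D'.level h ++ D.start := by
  induction h with
  | zero => rw [levelAt_zero, level_zero]
  | succ h ih =>
    have hlt : h < D'.word.length := hh
    have hlt' : h < (compWord D D').length := by
      simp only [compWord, List.length_append]; omega
    have he : (compWord D D')[h] = D'.word[h] := by
      simp only [compWord]; exact List.getElem_append_left hlt
    have ha : (D'.word[h]).apply (D'.level h ++ D.start) = (D'.word[h]).apply (D'.level h) ++ D.start :=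
      apply_append_right (D'.valid h hlt) D.start
    rw [levelAt_succ _ _ _ hlt', ih hlt.le, he, ha, level_succ _ _ hlt]

theorem levelAt_comp_right (D D' : OrientedAnnularDiagram) (h : ℕ) (hh : h ≤ D.word.length) :
    levelAt (D'.start ++ D.start) (compWord D D') (D'.word.length + h) =
      D'.start ++ D.level h := by
  induction h with
  | zero => rw [Nat.add_zero, levelAt_comp_left _ _ _ le_rfl, level_zero, level_length]
  | succ h ih =>
    have hlt : h < D.word.length := hh
    have hlt' : D'.word.length + h < (compWord D D').length := by
      simp only [compWord, List.length_append, List.length_map]; omega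
    have he : (compWord D D')[D'.word.length + h] = (D.word[h]).shift D'.start.length := by
      simp [compWord, List.getElem_append_right]
    rw [← add_assoc, levelAt_succ _ _ _ hlt', ih hlt.le, he, apply_shift, level_succ _ _ hlt]

/-- The annular composition `D ⨿ D'`: the inner boundary of the annulus containing `D` is
identified with the outer boundary of the annulus containing `D'`, and the orientations are kept.
(The angles of the events are chosen such that those of `D'` come first.) -/
def annularComp (D D' : OrientedAnnularDiagram) : OrientedAnnularDiagram where
  start := D'.start ++ D.start
  word := compWord D D'
  valid := by
    intro h hh
    by_cases hl : h < D'.word.length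
    · have he : (compWord D D')[h] = D'.word[h] := by
        simp only [compWord]; exact List.getElem_append_left hl
      rw [he, levelAt_comp_left _ _ _ hl.le]
      exact (D'.valid h hl).append_right _
    · obtain ⟨k, rfl⟩ := Nat.exists_eq_add_of_le (not_lt.1 hl)
      have hk : k < D.word.length := by
        simp only [compWord, List.length_append, List.length_map] at hh; omega
      have he : (compWord D D')[D'.word.length + k] = (D.word[k]).shift D'.start.length := by
        simp [compWord, List.getElem_append_right]
      rw [he, levelAt_comp_right _ _ _ hk.le]
      exact (D.valid k hk).shift _
  closed := by
    have h : (compWord D D').length = D'.word.length + D.word.length := by simp [compWord]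
    rw [h, levelAt_comp_right _ _ _ le_rfl, level_length]

/-! ### Crossings, complete resolutions and their circles -/

/-- The crossings of the diagram, ordered by their angle. -/
abbrev Crossing (D : OrientedAnnularDiagram) : Type :=
  {h : Fin D.word.length // (D.word[(h : ℕ)]).IsCross}

/-- The index of the event in which the crossing takes place. -/
def Crossing.time {D : OrientedAnnularDiagram} (c : D.Crossing) : ℕ := (c.1 : ℕ)

theorem Crossing.time_lt {D : OrientedAnnularDiagram} (c : D.Crossing) :
    c.time < D.word.length := c.1.2

/-- The position of the left strand at the crossing. -/
def Crossing.pos {D : OrientedAnnularDiagram} (c : D.Crossing) : ℕ := (D.word[c.time]'c.time_lt).pos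

/-- Is the strand from lower left to upper right the overcrossing one? -/
def Crossing.risingOver {D : OrientedAnnularDiagram} (c : D.Crossing) : Bool :=
  (D.word[c.time]'c.time_lt).risingOver

/-- The points in which the diagram meets the arc between events.  Level `0` and the last level are
two copies of the arc at angle `0`, whose points are identified in `Arc.close` below. -/
abbrev Point (D : OrientedAnnularDiagram) : Type :=
  (h : Fin (D.word.length + 1)) × Fin (D.level h).length

/-- Level and position of a point. -/
def Point.coord {D : OrientedAnnularDiagram} (x : D.Point) : ℕ × ℕ := (x.1, x.2)

/-- The direction of the diagram at a point (`true` is counterclockwise around `X`). -/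
def Point.dir {D : OrientedAnnularDiagram} (x : D.Point) : Bool := (D.level x.1).get x.2

/-- A vertex of the cube of resolutions: `false` is the `0`-smoothing, `true` the `1`-smoothing. -/
abbrev Resolution (D : OrientedAnnularDiagram) : Type := D.Crossing → Bool

/-- The arcs between consecutive points in the complete resolution `v`.  The `0`-smoothing of a
crossing joins the two regions swept out when the overcrossing strand is turned counterclockwise
towards the undercrossing one.  So it is the vertical smoothing `)(` if the strand from lower left
to upper right is over, and the horizontal one otherwise; the `1`-smoothing is the other one. -/
inductive Arc (D : OrientedAnnularDiagram) (v : D.Resolution) : ℕ × ℕ → ℕ × ℕ → Prop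
  | close (p : ℕ) : Arc D v (D.word.length, p) (0, p)
  | birth (h i : ℕ) (b : Bool) (e : D.word[h]? = some (AnnularEvent.birth i b)) :
      Arc D v (h + 1, i) (h + 1, i + 1)
  | birth_left (h i p : ℕ) (b : Bool) (e : D.word[h]? = some (AnnularEvent.birth i b))
      (hp : p < i) : Arc D v (h, p) (h + 1, p)
  | birth_right (h i p : ℕ) (b : Bool) (e : D.word[h]? = some (AnnularEvent.birth i b))
      (hp : i ≤ p) : Arc D v (h, p) (h + 1, p + 2)
  | death (h i : ℕ) (e : D.word[h]? = some (AnnularEvent.death i)) : Arc D v (h, i) (h, i + 1)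
  | death_left (h i p : ℕ) (e : D.word[h]? = some (AnnularEvent.death i)) (hp : p < i) :
      Arc D v (h, p) (h + 1, p)
  | death_right (h i p : ℕ) (e : D.word[h]? = some (AnnularEvent.death i)) (hp : i ≤ p) :
      Arc D v (h, p + 2) (h + 1, p)
  | cross_other (c : D.Crossing) (p : ℕ) (hp : p ≠ c.pos) (hp' : p ≠ c.pos + 1) :
      Arc D v (c.time, p) (c.time + 1, p)
  | vertical_left (c : D.Crossing) (hc : v c ≠ c.risingOver) :
      Arc D v (c.time, c.pos) (c.time + 1, c.pos)
  | vertical_right (c : D.Crossing) (hc : v c ≠ c.risingOver) :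
      Arc D v (c.time, c.pos + 1) (c.time + 1, c.pos + 1)
  | horizontal_bottom (c : D.Crossing) (hc : v c = c.risingOver) :
      Arc D v (c.time, c.pos) (c.time, c.pos + 1)
  | horizontal_top (c : D.Crossing) (hc : v c = c.risingOver) :
      Arc D v (c.time + 1, c.pos) (c.time + 1, c.pos + 1)

/-- Two points are equivalent if they lie on the same circle of the complete resolution `v`. -/
def circleSetoid (D : OrientedAnnularDiagram) (v : D.Resolution) : Setoid D.Point :=
  Relation.EqvGen.setoid fun x y => Arc D v x.coord y.coord

/-- The circles of the complete resolution `v`. -/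
abbrev Circle (D : OrientedAnnularDiagram) (v : D.Resolution) : Type :=
  Quotient (D.circleSetoid v)

/-- The circle of the complete resolution `v` that contains the point `x`. -/
def circleOf (D : OrientedAnnularDiagram) (v : D.Resolution) (x : D.Point) : D.Circle v :=
  Quotient.mk (D.circleSetoid v) x

theorem Crossing.pos_lt {D : OrientedAnnularDiagram} (c : D.Crossing) :
    c.pos + 1 < (D.level c.time).length := by
  have hv := D.valid c.time c.time_lt
  have hc : (D.word[c.time]'c.time_lt).IsCross := c.2
  unfold Crossing.pos
  generalize D.word[c.time]'c.time_lt = e at hv hc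
  cases e with
  | birth i b => exact hc.elim
  | death i => exact hc.elim
  | cross i s => exact hv

theorem Crossing.pos_lt_succ {D : OrientedAnnularDiagram} (c : D.Crossing) :
    c.pos + 1 < (D.level (c.time + 1)).length := by
  have hp := c.pos_lt
  have hc : (D.word[c.time]'c.time_lt).IsCross := c.2
  rw [D.level_succ _ c.time_lt]
  unfold Crossing.pos at hp ⊢
  generalize D.word[c.time]'c.time_lt = e at hp hc
  cases e with
  | birth i b => exact hc.elim
  | death i => exact hc.elim
  | cross i s =>
    simp only [AnnularEvent.pos, apply, List.length_append, List.length_take, List.length_reverse,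
      List.length_drop] at hp ⊢
    omega

/-- The lower left end of a crossing. -/
def Crossing.lowerLeft {D : OrientedAnnularDiagram} (c : D.Crossing) : D.Point :=
  ⟨⟨c.time, Nat.lt_succ_of_lt c.time_lt⟩, ⟨c.pos, Nat.lt_of_succ_lt c.pos_lt⟩⟩

/-- The lower right end of a crossing. -/
def Crossing.lowerRight {D : OrientedAnnularDiagram} (c : D.Crossing) : D.Point :=
  ⟨⟨c.time, Nat.lt_succ_of_lt c.time_lt⟩, ⟨c.pos + 1, c.pos_lt⟩⟩

/-- The upper right end of a crossing.  In both smoothings of the crossing, the lower left and the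
upper right end belong to different ones of the two arcs. -/
def Crossing.upperRight {D : OrientedAnnularDiagram} (c : D.Crossing) : D.Point :=
  ⟨⟨c.time + 1, Nat.succ_lt_succ c.time_lt⟩, ⟨c.pos + 1, c.pos_lt_succ⟩⟩

/-- The crossing is positive.  If both strands point upwards or both downwards, this means that the
strand from lower left to upper right is over; reversing one of them changes the sign. -/
def Crossing.Positive {D : OrientedAnnularDiagram} (c : D.Crossing) : Prop :=
  c.lowerLeft.dir = c.lowerRight.dir ↔ c.risingOver = true

/-! ### The Lee complex and its gradings -/

/-- The distinguished basis: complete resolutions whose circles are labelled by `v₊` (`true`) or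
`v₋` (`false`). -/
abbrev EnhancedState (D : OrientedAnnularDiagram) : Type :=
  (v : D.Resolution) × (D.Circle v → Bool)

noncomputable instance (D : OrientedAnnularDiagram) (v : D.Resolution) : Fintype (D.Circle v) :=
  Fintype.ofFinite _

noncomputable instance (D : OrientedAnnularDiagram) : Fintype D.Crossing :=
  Fintype.ofFinite _

noncomputable instance (D : OrientedAnnularDiagram) : Fintype D.EnhancedState :=
  Fintype.ofFinite _

/-- The vector space underlying the Lee complex, in coordinates with respect to the distinguished
basis. -/
abbrev LeeChain (D : OrientedAnnularDiagram) : Type := D.EnhancedState → ℂ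

/-- The coefficient of `v_z` in Lee's product `m (v_x ⊗ v_y)`:
`v₊v₊ ↦ v₊`, `v₊v₋, v₋v₊ ↦ v₋`, `v₋v₋ ↦ v₊`. -/
def leeMul : Bool → Bool → Bool → ℂ
  | true, true, true => 1
  | true, false, false => 1
  | false, true, false => 1
  | false, false, true => 1
  | _, _, _ => 0

/-- The coefficient of `v_x ⊗ v_y` in Lee's coproduct `Δ (v_z)`:
`v₊ ↦ v₊ ⊗ v₋ + v₋ ⊗ v₊`, `v₋ ↦ v₋ ⊗ v₋ + v₊ ⊗ v₊`. -/
def leeComul : Bool → Bool → Bool → ℂ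
  | true, true, false => 1
  | true, false, true => 1
  | false, false, false => 1
  | false, true, true => 1
  | _, _, _ => 0

/-- `S'` lies over the end of the edge of the cube that starts at the resolution of `S` and changes
the smoothing of `c` from `0` to `1`, and the circles that do not meet `c` carry the same labels. -/
def IsEdge (D : OrientedAnnularDiagram) (c : D.Crossing) (S S' : D.EnhancedState) : Prop :=
  S.1 c = false ∧ S'.1 c = true ∧ (∀ c', c' ≠ c → S'.1 c' = S.1 c') ∧
    ∀ x : D.Point, D.circleOf S.1 x ≠ D.circleOf S.1 c.lowerLeft →
      D.circleOf S.1 x ≠ D.circleOf S.1 c.upperRight →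
        S'.2 (D.circleOf S'.1 x) = S.2 (D.circleOf S.1 x)

open Classical in
/-- The coefficient of Lee's merge or split map at the crossing `c`: if the two arcs at `c` lie on
different circles of the resolution of `S`, these are merged, otherwise their circle is split. -/
noncomputable def saddleCoeff (D : OrientedAnnularDiagram) (c : D.Crossing)
    (S S' : D.EnhancedState) : ℂ :=
  if D.circleOf S.1 c.lowerLeft ≠ D.circleOf S.1 c.upperRight then
    leeMul (S.2 (D.circleOf S.1 c.lowerLeft)) (S.2 (D.circleOf S.1 c.upperRight))
      (S'.2 (D.circleOf S'.1 c.lowerLeft))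
  else
    leeComul (S.2 (D.circleOf S.1 c.lowerLeft)) (S'.2 (D.circleOf S'.1 c.lowerLeft))
      (S'.2 (D.circleOf S'.1 c.upperRight))

open Classical in
/-- The sign of an edge: `-1` to the number of `1`-smoothings at crossings preceding `c`. -/
noncomputable def edgeSign (D : OrientedAnnularDiagram) (v : D.Resolution) (c : D.Crossing) : ℂ :=
  (-1) ^ (Finset.univ.filter fun c' : D.Crossing => c'.time < c.time ∧ v c' = true).card

open Classical in
/-- The coefficient of `S'` in the Lee differential of `S`. -/
noncomputable def leeCoeff (D : OrientedAnnularDiagram) (S S' : D.EnhancedState) : ℂ :=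
  ∑ c : D.Crossing, if D.IsEdge c S S' then D.edgeSign S.1 c * D.saddleCoeff c S S' else 0

/-- The Lee differential. -/
noncomputable def leeDifferential (D : OrientedAnnularDiagram) : D.LeeChain →ₗ[ℂ] D.LeeChain :=
  (Matrix.of fun S' S : D.EnhancedState => D.leeCoeff S S').mulVecLin

/-- The number of positive crossings. -/
noncomputable def nPlus (D : OrientedAnnularDiagram) : ℕ :=
  Nat.card {c : D.Crossing // c.Positive}

/-- The number of negative crossings. -/
noncomputable def nMinus (D : OrientedAnnularDiagram) : ℕ :=
  Nat.card {c : D.Crossing // ¬ c.Positive}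

/-- The degree `±1` of a label `v±`. -/
def labelDegree (b : Bool) : ℤ := if b then 1 else -1

/-- The quantum grading `j` of a distinguished basis element. -/
noncomputable def jGrading (D : OrientedAnnularDiagram) (S : D.EnhancedState) : ℤ :=
  ∑ C : D.Circle S.1, labelDegree (S.2 C) + (Nat.card {c : D.Crossing // S.1 c = true} : ℤ)
    + (D.nPlus : ℤ) - 2 * (D.nMinus : ℤ)

/-- A circle is nontrivial if it meets the arc from `X` to `O` at angle `0` in an odd number of
points. -/
def Nontrivial (D : OrientedAnnularDiagram) (v : D.Resolution) (C : D.Circle v) : Prop :=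
  Odd (Nat.card {x : D.Point // x.1 = 0 ∧ D.circleOf v x = C})

open Classical in
/-- The annular grading `k` of a distinguished basis element: the algebraic intersection number of
the arc with the circles, those labelled `v₊` being oriented counterclockwise and those labelled
`v₋` clockwise.  A nontrivial circle contributes `1` or `-1` according to its label, a trivial one
contributes `0`. -/
noncomputable def kGrading (D : OrientedAnnularDiagram) (S : D.EnhancedState) : ℤ :=
  ∑ C : D.Circle S.1, if D.Nontrivial S.1 C then labelDegree (S.2 C) else 0

/-- The grading `j_t = j - t k` of a distinguished basis element. -/
noncomputable def jtGrading (D : OrientedAnnularDiagram) (t : ℝ) (S : D.EnhancedState) : ℝ :=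
  (D.jGrading S : ℝ) - t * (D.kGrading S : ℝ)

open Classical in
/-- The descending filtration of the Lee complex induced by the `j_t` grading. -/
noncomputable def filtration (D : OrientedAnnularDiagram) (t s : ℝ) : Submodule ℂ D.LeeChain :=
  Submodule.span ℂ {x | ∃ S : D.EnhancedState, s ≤ D.jtGrading t S ∧ x = Pi.single S 1}

/-- The filtration grading of a (nonzero) chain: the largest `s` such that the chain lies in the
`s`-th step of the filtration. -/
noncomputable def gr (D : OrientedAnnularDiagram) (t : ℝ) (x : D.LeeChain) : ℝ :=
  sSup {s | x ∈ D.filtration t s}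

/-! ### The canonical Lee class and the annular Rasmussen invariants -/

open Classical in
/-- The oriented resolution: the `0`-smoothing of the positive crossings and the `1`-smoothing of
the negative ones. -/
noncomputable def orientedResolution (D : OrientedAnnularDiagram) : D.Resolution :=
  fun c => if c.Positive then false else true

/-- The mod 2 invariant of a circle of the oriented resolution, read off at a point `x` on it by
following the ray from `x` outwards to `O`: the number of circles separating the circle from `O`,
plus one if the circle runs counterclockwise in the plane (the complement of `O`).  Mod 2, the
former is the number of points of other circles on the ray, and the circle runs counterclockwise
iff it runs counterclockwise around `X` at `x` and meets the rest of the ray evenly often, or runs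
clockwise at `x` and meets the rest of the ray oddly often. -/
def Point.leeIndex {D : OrientedAnnularDiagram} (x : D.Point) : ℕ :=
  ((D.level x.1).length - 1 - x.2) + (if x.dir then 1 else 0)

/-- A circle of the oriented resolution is labelled by `𝐛 = v₋ - v₊` if its mod 2 invariant is `1`,
and by `𝐚 = v₋ + v₊` if it is `0`. -/
def IsB (D : OrientedAnnularDiagram) (v : D.Resolution) (C : D.Circle v) : Prop :=
  ∃ x : D.Point, D.circleOf v x = C ∧ Odd x.leeIndex

open Classical in
/-- The canonical Lee cycle `𝔰_o`: the tensor product of the labels `𝐚`, `𝐛` over the circles of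
the oriented resolution. -/
noncomputable def canonicalCycle (D : OrientedAnnularDiagram) : D.LeeChain :=
  fun S =>
    if S.1 = D.orientedResolution then
      ∏ C : D.Circle S.1, if D.IsB S.1 C ∧ S.2 C = true then -1 else 1
    else 0

/-- The filtration gradings of the cycles that represent the homology class `[𝔰_o]`. -/
def classGradings (D : OrientedAnnularDiagram) (t : ℝ) : Set ℝ :=
  {r | ∃ x : D.LeeChain, D.leeDifferential x = 0 ∧
    x - D.canonicalCycle ∈ LinearMap.range D.leeDifferential ∧ r = D.gr t x}

/-- The annular Rasmussen invariant `d_t`: the `j_t` grading of the homology class `[𝔰_o]`, i.e. the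
largest filtration grading of a cycle representing it. -/
noncomputable def annularRasmussen (D : OrientedAnnularDiagram) (t : ℝ) : ℝ :=
  sSup (D.classGradings t)

/-- The right-limit slope `m_t` of `d_t` at `t` exists and equals `m`. -/
def HasSlope (D : OrientedAnnularDiagram) (t m : ℝ) : Prop :=
  Tendsto (fun ε : ℝ => (D.annularRasmussen (t + ε) - D.annularRasmussen t) / ε) (𝓝[>] 0) (𝓝 m)

end OrientedAnnularDiagram

/-! The Lee complex of an annular composition is the tensor product of the Lee complexes of the two
diagrams. The strands of one diagram pass straight through the events of the other, so no circle
meets both diagrams. Hence crossings, circles and enhanced states split (`crossingEquiv`,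
`circleEquiv`, `stateEquiv`), the grading `j_t` is additive (`jtGrading_annularComp`), and the
differential obeys a signed Leibniz rule (`leeDifferential_tensorChain`).

The canonical cycle is a tensor product as well, with one twist. The parity that decides between `𝐚`
and `𝐛` counts the strands out to `O`, so inner circles see the outer strands in addition: when
their number is odd, all labels of the inner factor are exchanged. The exchange is harmless. Lee's
differential preserves `j` modulo 4, so multiplying each basis element by `I ^ j`, up to a constant,
commutes with it, preserves every filtration step and swaps `𝐚` with `𝐛` up to scalars
(`attainsLevel_colourChain_not`).

Additivity of a maximum needs an upper bound on all representatives of the class, and duality over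
the field `ℂ` supplies one. `AttainsLevel` pairs a representative in level `a` with a functional
that kills boundaries, is nonzero on the class and is supported where the grading is at most `a`.
Both halves can be tensored (`attainsLevel_tensorChain`). Such a pair exists as soon as the
differential squares to zero and the class is nonzero (`exists_of_notMem_range`).

These two facts come from evaluating chains. Lee's algebra is `ℂ[X] / (X ^ 2 - 1)`, and choosing `X
= 1` or `X = -1` on each circle turns chains into functions of colourings, on which merges and
splits act by scalars (`sum_isEdge_stateValue`). In the canonical colouring the two arcs at each
crossing have different colours, so its colour chain is a cycle and evaluation at this colouring
kills boundaries. That every saddle is a merge or a split, with no one-to-one case, uses the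
planarity of the annulus: orienting strands alternately by position makes the circles the cycles of
a permutation, and changing a smoothing composes it with a transposition.

For the slopes, only finitely many supports of representatives occur, so `d_t` is a finite maximum
of finite minima of functions affine in `t`. Its germ to the right of each point is affine, and
slopes add because the invariants do. -/

/-! ### Merging two classes of an equivalence relation -/

/-- The equivalence relation `E'` is obtained from `E` by merging the different classes of `p` and
`s`. -/
def Setoid.Merges {P : Type*} (E E' : Setoid P) (p s : P) : Prop :=
  ¬ E p s ∧ ∀ x y, E' x y ↔ E x y ∨ (E x p ∧ E s y) ∨ (E x s ∧ E p y)

/-! ### Cycles of a permutation composed with a transposition -/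

namespace Equiv.Perm

variable {P : Type*} {σ τ : Equiv.Perm P} {p s : P}

/-- From `p`, the permutation `τ` jumps to `σ s` and then follows the `σ`-cycle of `s`, which avoids
`p`, until it reaches `s`. -/
theorem sameCycle_of_not_sameCycle [Finite P] (h : ∀ x, x ≠ p → x ≠ s → τ x = σ x)
    (hp : τ p = σ s) (hn : ¬ σ.SameCycle p s) : τ.SameCycle p s := by
  have key : ∀ n : ℕ, τ.SameCycle p ((σ ^ (n + 1)) s) := by
    intro n
    induction n with
    | zero => exact ⟨1, by simpa using hp⟩
    | succ n ih =>
      have e : (σ ^ (n + 1 + 1)) s = σ ((σ ^ (n + 1)) s) := by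
        rw [pow_succ' σ (n + 1)]; rfl
      rw [e]
      by_cases h1 : (σ ^ (n + 1)) s = s
      · rw [h1, ← hp]; exact ⟨1, by simp⟩
      · have h2 : (σ ^ (n + 1)) s ≠ p := fun h2 => hn (SameCycle.symm
          ⟨((n + 1 : ℕ) : ℤ), by rw [zpow_natCast]; exact h2⟩)
        rw [← h _ h2 h1]
        exact sameCycle_apply_right.2 ih
  obtain ⟨n, hn, -, hs⟩ := (SameCycle.refl σ s).exists_pow_eq''
  obtain ⟨m, rfl⟩ : ∃ m, n = m + 1 := ⟨n - 1, by omega⟩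
  simpa [hs] using key m

/-- Let `n` be least with `(σ ^ n) p = s`. The points `(σ ^ i) p` with `1 ≤ i ≤ n` are stable under
`τ`, which sends `s` back to `σ p`; they include `s`, and by minimality of `n` they do not include
`p`. -/
theorem not_sameCycle_of_sameCycle [Finite P] (h : ∀ x, x ≠ p → x ≠ s → τ x = σ x)
    (hs : τ s = σ p) (hps : p ≠ s) (hc : σ.SameCycle p s) : ¬ τ.SameCycle p s := by
  classical
  have hex : ∃ n : ℕ, (σ ^ n) p = s := by
    obtain ⟨n, -, hn⟩ := hc.exists_pow_eq'
    exact ⟨n, hn⟩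
  set n := Nat.find hex with hn
  have hns : (σ ^ n) p = s := Nat.find_spec hex
  have hmin : ∀ m, m < n → (σ ^ m) p ≠ s := fun m hm => Nat.find_min hex hm
  have hn0 : n ≠ 0 := by
    intro h0
    rw [h0] at hns
    exact hps (by simpa using hns)
  have hcl : ∀ k : ℕ, ∃ i, 1 ≤ i ∧ i ≤ n ∧ (τ ^ k) s = (σ ^ i) p := by
    intro k
    induction k with
    | zero => exact ⟨n, by omega, le_rfl, by simp [hns]⟩
    | succ k ih =>
      obtain ⟨i, h1, h2, h3⟩ := ih
      have e : (τ ^ (k + 1)) s = τ ((τ ^ k) s) := by rw [pow_succ']; rfl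
      rw [e, h3]
      rcases eq_or_lt_of_le h2 with rfl | h2
      · exact ⟨1, le_rfl, by omega, by rw [hns, hs, pow_one]⟩
      · refine ⟨i + 1, by omega, h2, ?_⟩
        rw [h _ _ (hmin i h2)]
        · rw [pow_succ']; rfl
        · intro hip
          refine hmin (n - i) (by omega) ?_
          rw [← hns]
          conv_rhs => rw [show n = (n - i) + i by omega, pow_add, mul_apply, hip]
  intro hcon
  obtain ⟨k, -, hk⟩ := hcon.symm.exists_pow_eq'
  obtain ⟨i, h1, h2, h3⟩ := hcl k
  rw [hk] at h3
  rcases eq_or_lt_of_le h2 with rfl | h2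
  · exact hps (h3.trans hns)
  · refine hmin (n - i) (by omega) ?_
    rw [← hns]
    conv_rhs => rw [show n = (n - i) + i by omega, pow_add, mul_apply, ← h3]

/-- Here `τ` is `σ` precomposed with the transposition of `p` and `s`, which joins two different
cycles into one and leaves all others alone. -/
theorem merges_of_not_sameCycle [Finite P] (h : ∀ x, x ≠ p → x ≠ s → τ x = σ x)
    (hp : τ p = σ s) (hs : τ s = σ p) (hn : ¬ σ.SameCycle p s) :
    (SameCycle.setoid σ).Merges (SameCycle.setoid τ) p s := by
  have hps : τ.SameCycle p s := sameCycle_of_not_sameCycle h hp hn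
  have hstep : ∀ x, τ.SameCycle x (σ x) := by
    intro x
    by_cases h1 : x = p
    · subst h1; rw [← hs]; exact sameCycle_apply_right.2 hps
    by_cases h2 : x = s
    · subst h2; rw [← hp]; exact sameCycle_apply_right.2 hps.symm
    rw [← h x h1 h2]; exact ⟨1, by simp⟩
  have hle : ∀ x y, σ.SameCycle x y → τ.SameCycle x y := by
    intro x y hxy
    obtain ⟨k, -, rfl⟩ := hxy.exists_pow_eq'
    induction k with
    | zero => exact ⟨0, by simp⟩
    | succ k ih =>
      rw [pow_succ']
      exact (ih ⟨k, by simp⟩).trans (hstep _)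
  refine ⟨hn, fun x y => ⟨?_, ?_⟩⟩
  · intro hxy
    obtain ⟨k, -, rfl⟩ := SameCycle.exists_pow_eq' hxy
    change σ.SameCycle _ _ ∨ (σ.SameCycle _ _ ∧ σ.SameCycle _ _) ∨ (σ.SameCycle _ _ ∧ σ.SameCycle _ _)
    clear hxy
    induction k with
    | zero => left; exact ⟨0, by simp⟩
    | succ k ih =>
      rw [pow_succ', mul_apply]
      generalize (τ ^ k) x = y at ih
      by_cases h1 : y = p
      · subst h1
        rw [hp]
        rcases ih with ih | ih | ih
        · exact Or.inr (Or.inl ⟨ih, ⟨1, by simp⟩⟩)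
        · exact absurd ih.2.symm hn
        · exact Or.inl (sameCycle_apply_right.2 ih.1)
      by_cases h2 : y = s
      · subst h2
        rw [hs]
        rcases ih with ih | ih | ih
        · exact Or.inr (Or.inr ⟨ih, ⟨1, by simp⟩⟩)
        · exact Or.inl (sameCycle_apply_right.2 ih.1)
        · exact absurd ih.2 hn
      rw [h y h1 h2]
      simpa only [sameCycle_apply_right] using ih
  · rintro (hxy | ⟨h1, h2⟩ | ⟨h1, h2⟩)
    · exact hle _ _ hxy
    · exact (hle _ _ h1).trans (hps.trans (hle _ _ h2))
    · exact (hle _ _ h1).trans (hps.symm.trans (hle _ _ h2))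

theorem merges_of_sameCycle [Finite P] (h : ∀ x, x ≠ p → x ≠ s → τ x = σ x)
    (hp : τ p = σ s) (hs : τ s = σ p) (hps : p ≠ s) (hc : σ.SameCycle p s) :
    (SameCycle.setoid τ).Merges (SameCycle.setoid σ) p s :=
  merges_of_not_sameCycle (fun x h1 h2 => (h x h1 h2).symm) hs.symm hp.symm
    (not_sameCycle_of_sameCycle h hs hps hc)

end Equiv.Perm

/-! ### Classes before and after a merge -/

namespace Setoid.Merges

variable {P : Type*} {E E' : Setoid P} {p s : P}

theorem not_rel (h : E.Merges E' p s) : ¬ E p s := h.1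

theorem le (h : E.Merges E' p s) {x y : P} (hxy : E x y) : E' x y := (h.2 x y).2 (Or.inl hxy)

theorem rel (h : E.Merges E' p s) : E' p s :=
  (h.2 p s).2 (Or.inr (Or.inl ⟨E.refl p, E.refl s⟩))

theorem rel_left_iff (h : E.Merges E' p s) (x : P) : E' x p ↔ E x p ∨ E x s := by
  rw [h.2]
  constructor
  · rintro (h1 | ⟨h1, -⟩ | ⟨h1, -⟩)
    exacts [Or.inl h1, Or.inl h1, Or.inr h1]
  · rintro (h1 | h1)
    exacts [Or.inl h1, Or.inr (Or.inr ⟨h1, E.refl p⟩)]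

theorem rel_of_not (h : E.Merges E' p s) {x y : P} (hxy : E' x y) (h1 : ¬ E x p)
    (h2 : ¬ E x s) : E x y := by
  rcases (h.2 x y).1 hxy with h3 | h3 | h3
  exacts [h3, absurd h3.1 h1, absurd h3.1 h2]

/-- Products over the classes before and after a merge. -/
theorem prod_mul_eq {M : Type*} [CommMonoid M] [Fintype (Quotient E)] [Fintype (Quotient E')]
    (h : E.Merges E' p s) (G : Quotient E → M) (G' : Quotient E' → M)
    (hG : ∀ x, ¬ E x p → ¬ E x s → G' (Quotient.mk E' x) = G (Quotient.mk E x)) :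
    (∏ C, G C) * G' (Quotient.mk E' p) =
      G (Quotient.mk E p) * G (Quotient.mk E s) * ∏ C, G' C := by
  classical
  have hne : Quotient.mk E s ∉ ({Quotient.mk E p} : Finset (Quotient E)) := by
    rw [Finset.mem_singleton]
    exact fun h1 => h.1 (E.symm (Quotient.exact h1))
  have h1 : ∏ C, G C = (∏ C ∈ ({Quotient.mk E s, Quotient.mk E p} : Finset _)ᶜ, G C) *
      (G (Quotient.mk E s) * G (Quotient.mk E p)) := by
    rw [← Finset.prod_compl_mul_prod ({Quotient.mk E s, Quotient.mk E p} : Finset _),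
      Finset.prod_insert hne, Finset.prod_singleton]
  have h2 : ∏ C, G' C = (∏ C ∈ ({Quotient.mk E' p} : Finset _)ᶜ, G' C) * G' (Quotient.mk E' p) := by
    rw [← Finset.prod_compl_mul_prod ({Quotient.mk E' p} : Finset _), Finset.prod_singleton]
  -- Away from the merged classes the quotient map is a bijection. The identity is cross-multiplied
  -- because `M` has no division.
  have h3 : ∏ C ∈ ({Quotient.mk E s, Quotient.mk E p} : Finset _)ᶜ, G C =
      ∏ C ∈ ({Quotient.mk E' p} : Finset _)ᶜ, G' C := by
    refine Finset.prod_bij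
      (fun C _ => Quotient.map (sa := E) (sb := E') id (fun _ _ hxy => h.le hxy) C) ?_ ?_ ?_ ?_
    · intro C
      induction C using Quotient.inductionOn with | h x => ?_
      simp only [Finset.mem_compl, Finset.mem_insert, Finset.mem_singleton, Quotient.map_mk, id,
        not_or]
      rintro ⟨h4, h5⟩ h6
      rcases (h.rel_left_iff x).1 (Quotient.exact h6) with h7 | h7
      exacts [h5 (Quotient.sound h7), h4 (Quotient.sound h7)]
    · intro C hC C' hC'
      induction C using Quotient.inductionOn with | h x => ?_
      induction C' using Quotient.inductionOn with | h y => ?_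
      simp only [Finset.mem_compl, Finset.mem_insert, Finset.mem_singleton, not_or] at hC hC'
      simp only [Quotient.map_mk, id]
      intro h4
      exact Quotient.sound (h.rel_of_not (Quotient.exact h4) (fun h5 => hC.2 (Quotient.sound h5))
        (fun h5 => hC.1 (Quotient.sound h5)))
    · intro C'
      induction C' using Quotient.inductionOn with | h y => ?_
      intro hC'
      simp only [Finset.mem_compl, Finset.mem_singleton] at hC'
      refine ⟨Quotient.mk E y, ?_, rfl⟩
      simp only [Finset.mem_compl, Finset.mem_insert, Finset.mem_singleton, not_or]
      exact ⟨fun h5 => hC' (Quotient.sound ((h.rel_left_iff y).2 (Or.inr (Quotient.exact h5)))),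
        fun h5 => hC' (Quotient.sound ((h.rel_left_iff y).2 (Or.inl (Quotient.exact h5))))⟩
    · intro C hC
      induction C using Quotient.inductionOn with | h x => ?_
      simp only [Finset.mem_compl, Finset.mem_insert, Finset.mem_singleton, not_or] at hC
      exact (hG x (fun h5 => hC.2 (Quotient.sound h5)) (fun h5 => hC.1 (Quotient.sound h5))).symm
  rw [h1, h2, h3]
  ac_rfl

end Setoid.Merges

/-! ### Half-edges at a single event -/

namespace AnnularEvent

/-- The pairing of the ends of the strands that pass through an event; `(false, p)` and `(true, p)`
are the ends in position `p` before and after the event.  Crossings are smoothed, horizontally iff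
`hz` is true. -/
def mate : AnnularEvent → Bool → Bool × ℕ → Bool × ℕ
  | birth i _, _, (false, p) => if p < i then (true, p) else (true, p + 2)
  | birth i _, _, (true, p) => if p < i then (false, p) else if p = i then (true, i + 1)
      else if p = i + 1 then (true, i) else (false, p - 2)
  | death i, _, (true, p) => if p < i then (false, p) else (false, p + 2)
  | death i, _, (false, p) => if p < i then (true, p) else if p = i then (false, i + 1)
      else if p = i + 1 then (false, i) else (true, p - 2)
  | cross i _, hz, (u, p) => if hz = true ∧ p = i then (u, i + 1)
      else if hz = true ∧ p = i + 1 then (u, i) else (!u, p)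

theorem mate_mate (e : AnnularEvent) (hz : Bool) (x : Bool × ℕ) :
    e.mate hz (e.mate hz x) = x := by
  obtain ⟨u, p⟩ := x
  cases e <;> cases u <;> simp only [mate] <;> grind [mate]

/-- A strand either passes to the other side with its position changed by an even number, or turns
back and joins two adjacent positions. In both cases the sum of side and position changes parity.
This is what makes the alternating orientation of strands consistent. -/
theorem mate_parity (e : AnnularEvent) (hz : Bool) (u : Bool) (p : ℕ) :
    ((e.mate hz (u, p)).1 ^^ (e.mate hz (u, p)).2.bodd) = !(u ^^ p.bodd) := by
  have h1 : ∀ n : ℕ, (n + 1).bodd = !n.bodd := Nat.bodd_succ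
  have h2 : ∀ n : ℕ, (n + 2).bodd = n.bodd := fun n => by rw [h1, h1, Bool.not_not]
  have h3 : ∀ n : ℕ, 2 ≤ n → (n - 2).bodd = n.bodd := fun n hn => by
    rw [← h2 (n - 2), Nat.sub_add_cancel hn]
  cases e <;> cases u <;> simp only [mate] <;> split_ifs <;>
    first
    | (rw [h3 _ (by omega)]; simp)
    | (simp_all)

/-- The length of the list of strands before (`false`) or after (`true`) an event. -/
def sideLength (e : AnnularEvent) (l : List Bool) (u : Bool) : ℕ :=
  if u then (e.apply l).length else l.length

theorem length_apply {e : AnnularEvent} {l : List Bool} (h : e.Valid l) :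
    (∀ i b, e = birth i b → (e.apply l).length = l.length + 2 ∧ i ≤ l.length) ∧
    (∀ i, e = death i → (e.apply l).length + 2 = l.length ∧ i + 1 < l.length) ∧
    (∀ i s, e = cross i s → (e.apply l).length = l.length ∧ i + 1 < l.length) := by
  refine ⟨?_, ?_, ?_⟩
  · rintro i b rfl
    simp only [Valid] at h
    simp only [apply, List.length_append, List.length_take, List.length_cons, List.length_drop]
    omega
  · rintro i rfl
    obtain ⟨b, -, h2⟩ := h
    have h3 := (List.getElem?_eq_some_iff.1 h2).1
    simp only [apply, List.length_append, List.length_take, List.length_drop]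
    omega
  · rintro i s rfl
    simp only [Valid] at h
    simp only [apply, List.length_append, List.length_take, List.length_drop, List.length_reverse]
    omega

theorem mate_lt {e : AnnularEvent} {l : List Bool} (h : e.Valid l) (hz : Bool) (u : Bool) (p : ℕ)
    (hp : p < e.sideLength l u) :
    (e.mate hz (u, p)).2 < e.sideLength l (e.mate hz (u, p)).1 := by
  obtain ⟨h1, h2, h3⟩ := length_apply h
  cases e with
  | birth i b =>
    have := h1 i b rfl
    cases u <;> simp only [mate, sideLength] at * <;> grind
  | death i =>
    have := h2 i rfl
    cases u <;> simp only [mate, sideLength] at * <;> grind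
  | cross i s =>
    have := h3 i s rfl
    cases u <;> simp only [mate, sideLength] at * <;> grind

end AnnularEvent

/-! ### The alternating orientation of a resolution as a permutation of its points -/

namespace OrientedAnnularDiagram

open AnnularEvent

variable (D : OrientedAnnularDiagram)

theorem Point.coord_injective : Function.Injective (Point.coord (D := D)) := by
  rintro ⟨⟨h, hh⟩, ⟨p, hp⟩⟩ ⟨⟨h', hh'⟩, ⟨p', hp'⟩⟩ e
  simp only [Point.coord, Prod.mk.injEq] at e
  obtain ⟨rfl, rfl⟩ := e
  rfl

/-- The coordinates that belong to points of the diagram. -/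
def InRange (x : ℕ × ℕ) : Prop := x.1 ≤ D.word.length ∧ x.2 < (D.level x.1).length

variable {D} in
theorem Point.inRange (x : D.Point) : D.InRange x.coord :=
  ⟨Nat.lt_succ_iff.1 x.1.2, x.2.2⟩

variable {D} in
/-- The point with given coordinates. -/
def pointOf {x : ℕ × ℕ} (hx : D.InRange x) : D.Point :=
  ⟨⟨x.1, Nat.lt_succ_of_le hx.1⟩, ⟨x.2, hx.2⟩⟩

variable {D} in
@[simp] theorem coord_pointOf {x : ℕ × ℕ} (hx : D.InRange x) : (pointOf hx).coord = x := rfl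

open Classical in
/-- Is the smoothing of the crossing in the event `h` horizontal? -/
noncomputable def horizontal (v : D.Resolution) (h : ℕ) : Bool :=
  decide (∃ c : D.Crossing, c.time = h ∧ v c = c.risingOver)

/-- The pairing of half-edges of a complete resolution.  The half-edge `(x, true)` leaves `x` in the
direction of increasing angle, and `(x, false)` in the direction of decreasing angle. -/
noncomputable def halfMate (v : D.Resolution) : (ℕ × ℕ) × Bool → (ℕ × ℕ) × Bool
  | ((h, p), true) =>
    if hh : h < D.word.length then
      let y := (D.word[h]).mate (D.horizontal v h) (false, p)
      if y.1 then ((h + 1, y.2), false) else ((h, y.2), true)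
    else ((0, p), false)
  | ((0, p), false) => ((D.word.length, p), true)
  | ((h + 1, p), false) =>
    if hh : h < D.word.length then
      let y := (D.word[h]).mate (D.horizontal v h) (true, p)
      if y.1 then ((h + 1, y.2), false) else ((h, y.2), true)
    -- A default value for levels beyond the end of the word; points of the diagram never reach it.
    else ((0, p), false)

variable {D}

theorem sideLength_level (h : ℕ) (hh : h < D.word.length) (u : Bool) :
    (D.word[h]).sideLength (D.level h) u = (D.level (if u then h + 1 else h)).length := by
  cases u
  · rfl
  · simp only [sideLength, if_true, D.level_succ h hh]

theorem halfMate_halfMate (v : D.Resolution) (x : (ℕ × ℕ) × Bool) (hx : x.1.1 ≤ D.word.length) :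
    D.halfMate v (D.halfMate v x) = x := by
  obtain ⟨⟨h, p⟩, u⟩ := x
  have key : ∀ h (hh : h < D.word.length) (u : Bool) p,
      D.halfMate v (if u then ((h + 1, p), false) else ((h, p), true)) =
        if ((D.word[h]).mate (D.horizontal v h) (u, p)).1 then
          ((h + 1, ((D.word[h]).mate (D.horizontal v h) (u, p)).2), false)
        else ((h, ((D.word[h]).mate (D.horizontal v h) (u, p)).2), true) := by
    intro h hh u p
    cases u <;> simp [halfMate, hh]
  have key2 : ∀ h (hh : h < D.word.length) (u : Bool) p,
      D.halfMate v (D.halfMate v (if u then ((h + 1, p), false) else ((h, p), true))) =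
        if u then ((h + 1, p), false) else ((h, p), true) := by
    intro h hh u p
    rw [key h hh u p, key h hh, Prod.mk.eta, mate_mate]
  cases u with
  | true =>
    by_cases hh : h < D.word.length
    · simpa using key2 h hh false p
    · have : h = D.word.length := by simp only at hx; omega
      subst this
      simp [halfMate]
  | false =>
    cases h with
    | zero => simp [halfMate]
    | succ h => simpa using key2 h hx true p

theorem halfMate_inRange (v : D.Resolution) (x : ℕ × ℕ) (u : Bool) (hx : D.InRange x) :
    D.InRange (D.halfMate v (x, u)).1 := by
  obtain ⟨h, p⟩ := x
  have key : ∀ h (hh : h < D.word.length) (u : Bool) p, p < (D.level (if u then h + 1 else h)).length →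
      D.InRange (if ((D.word[h]).mate (D.horizontal v h) (u, p)).1 then
          ((h + 1, ((D.word[h]).mate (D.horizontal v h) (u, p)).2), false)
        else ((h, ((D.word[h]).mate (D.horizontal v h) (u, p)).2), true) :
          (ℕ × ℕ) × Bool).1 := by
    intro h hh u p hp
    rw [← sideLength_level h hh] at hp
    have := mate_lt (D.valid h hh) (D.horizontal v h) u p hp
    change _ < (D.word[h]).sideLength (D.level h) _ at this
    rw [sideLength_level h hh] at this
    split_ifs with h1
    · exact ⟨hh, by simpa [h1] using this⟩
    · exact ⟨hh.le, by simpa [h1] using this⟩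
  cases u with
  | true =>
    by_cases hh : h < D.word.length
    · simpa [halfMate, hh] using key h hh false p hx.2
    · have : h = D.word.length := le_antisymm hx.1 (not_lt.1 hh)
      subst this
      have h2 := hx.2
      rw [D.level_length] at h2
      simp [halfMate, InRange, D.level_zero, h2]
  | false =>
    cases h with
    | zero =>
      have h2 := hx.2
      rw [D.level_zero] at h2
      simp [halfMate, InRange, D.level_length, h2]
    | succ h =>
      have hh : h < D.word.length := hx.1
      simpa [halfMate, hh] using key h hh true p hx.2

/-- The direction flag of a half-edge is the complement of the side flag in `mate`, and the parity
rule is invariant under complementing both sides. At the closing arc the position stays and the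
direction flips. -/
theorem halfMate_parity (v : D.Resolution) (x : ℕ × ℕ) (u : Bool) (hx : x.1 ≤ D.word.length) :
    ((D.halfMate v (x, u)).2 ^^ (D.halfMate v (x, u)).1.2.bodd) =
      !(u ^^ x.2.bodd) := by
  obtain ⟨h, p⟩ := x
  have key : ∀ h (hh : h < D.word.length) (u : Bool) p,
      ((if ((D.word[h]).mate (D.horizontal v h) (u, p)).1 then
          ((h + 1, ((D.word[h]).mate (D.horizontal v h) (u, p)).2), false)
        else ((h, ((D.word[h]).mate (D.horizontal v h) (u, p)).2), true) :
          (ℕ × ℕ) × Bool).2 ^^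
        Nat.bodd ((if ((D.word[h]).mate (D.horizontal v h) (u, p)).1 then
          ((h + 1, ((D.word[h]).mate (D.horizontal v h) (u, p)).2), false)
        else ((h, ((D.word[h]).mate (D.horizontal v h) (u, p)).2), true) :
          (ℕ × ℕ) × Bool).1.2)) = (u ^^ p.bodd) := by
    intro h hh u p
    have := mate_parity (D.word[h]) (D.horizontal v h) u p
    generalize (D.word[h]).mate (D.horizontal v h) (u, p) = y at *
    obtain ⟨a, q⟩ := y
    cases a <;> simp_all
  cases u with
  | true =>
    by_cases hh : h < D.word.length
    · simpa [halfMate, hh] using key h hh false p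
    · simp [halfMate, hh]
  | false =>
    cases h with
    | zero => simp [halfMate]
    | succ h =>
      have hh : h < D.word.length := hx
      simpa [halfMate, hh] using key h hh true p

/-- The successor of a point on its circle, when all strands in even positions are directed upwards
(for `b = true`) or downwards (for `b = false`), and those in odd positions in the other way. -/
noncomputable def next (v : D.Resolution) (b : Bool) (x : D.Point) : D.Point :=
  pointOf (halfMate_inRange v x.coord (b ^^ x.coord.2.bodd) x.inRange)

theorem coord_next (v : D.Resolution) (b : Bool) (x : D.Point) :
    (next v b x).coord = (D.halfMate v (x.coord, b ^^ x.coord.2.bodd)).1 := rfl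

/-- By parity, the half-edge through which the arc arrives is the one by which the opposite
orientation leaves, and the pairing of half-edges is an involution. -/
theorem next_next (v : D.Resolution) (b : Bool) (x : D.Point) : next v (!b) (next v b x) = x := by
  apply Point.coord_injective
  rw [coord_next, coord_next]
  have h1 := halfMate_parity v x.coord (b ^^ x.coord.2.bodd) x.inRange.1
  have h2 := halfMate_halfMate v (x.coord, b ^^ x.coord.2.bodd) x.inRange.1
  generalize D.halfMate v (x.coord, b ^^ x.coord.2.bodd) = y at *
  obtain ⟨y, u⟩ := y
  have h3 : (!b ^^ y.2.bodd) = u := by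
    revert h1
    simp only
    generalize y.2.bodd = d
    generalize x.coord.2.bodd = d'
    cases b <;> cases d <;> cases d' <;> cases u <;> simp
  rw [h3, h2]

/-- The permutation of the points whose cycles are the circles of a complete resolution. -/
noncomputable def nextPerm (v : D.Resolution) (b : Bool) : Equiv.Perm D.Point where
  toFun := next v b
  invFun := next v (!b)
  left_inv := next_next v b
  right_inv x := by simpa using next_next v (!b) x

theorem nextPerm_not (v : D.Resolution) (b : Bool) : nextPerm v (!b) = (nextPerm v b)⁻¹ := by
  ext1 x; rfl

theorem sameCycle_nextPerm (v : D.Resolution) (b b' : Bool) {x y : D.Point}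
    (h : (nextPerm v b).SameCycle x y) : (nextPerm v b').SameCycle x y := by
  by_cases hb : b = b'
  · rwa [← hb]
  · have : b' = !b := by cases b <;> cases b' <;> simp_all
    rw [this, nextPerm_not]
    exact Equiv.Perm.sameCycle_inv.2 h

theorem sameCycle_of_halfMate (v : D.Resolution) (b : Bool) {x y : D.Point} (u : Bool)
    (h : (D.halfMate v (x.coord, u)).1 = y.coord) : (nextPerm v b).SameCycle x y := by
  apply sameCycle_nextPerm v (u ^^ x.coord.2.bodd)
  refine ⟨1, ?_⟩
  apply Point.coord_injective
  rw [zpow_one]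
  change (next v _ x).coord = _
  rw [coord_next, ← h]
  have : (u ^^ x.coord.2.bodd ^^ x.coord.2.bodd) = u := by
    rw [Bool.xor_assoc, Bool.xor_self, Bool.xor_false]
  rw [this]

end OrientedAnnularDiagram

/-! ### Circles as cycles; every saddle merges or splits -/

namespace OrientedAnnularDiagram

open AnnularEvent

variable {D : OrientedAnnularDiagram}

theorem Crossing.ext_time {c c' : D.Crossing} (h : c.time = c'.time) : c = c' :=
  Subtype.ext (Fin.ext h)

theorem Crossing.word_time (c : D.Crossing) :
    D.word[c.time]'c.time_lt = AnnularEvent.cross c.pos c.risingOver := by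
  have hc : (D.word[c.time]'c.time_lt).IsCross := c.2
  unfold Crossing.pos Crossing.risingOver
  generalize D.word[c.time]'c.time_lt = e at hc
  cases e with
  | birth i b => exact hc.elim
  | death i => exact hc.elim
  | cross i s => rfl

theorem exists_crossing {h i : ℕ} {s : Bool} (hh : h < D.word.length)
    (e : D.word[h] = AnnularEvent.cross i s) :
    ∃ c : D.Crossing, c.time = h ∧ c.pos = i ∧ c.risingOver = s := by
  refine ⟨⟨⟨h, hh⟩, ?_⟩, rfl, ?_, ?_⟩
  · change (D.word[h]).IsCross
    rw [e]; trivial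
  · change (D.word[h]).pos = i
    rw [e]; rfl
  · change (D.word[h]).risingOver = s
    rw [e]; rfl

theorem horizontal_time (v : D.Resolution) (c : D.Crossing) :
    D.horizontal v c.time = decide (v c = c.risingOver) := by
  unfold horizontal
  congr 1
  refine propext ⟨?_, fun h => ⟨c, rfl, h⟩⟩
  rintro ⟨c', h1, h2⟩
  rwa [← Crossing.ext_time h1]

theorem halfMate_up (v : D.Resolution) {h : ℕ} {e : AnnularEvent} (he : D.word[h]? = some e)
    (p : ℕ) : D.halfMate v ((h, p), true) =
      (if (e.mate (D.horizontal v h) (false, p)).1 then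
        ((h + 1, (e.mate (D.horizontal v h) (false, p)).2), false)
      else ((h, (e.mate (D.horizontal v h) (false, p)).2), true)) := by
  obtain ⟨hh, rfl⟩ := List.getElem?_eq_some_iff.1 he
  simp [halfMate, hh]

theorem halfMate_down (v : D.Resolution) {h : ℕ} {e : AnnularEvent} (he : D.word[h]? = some e)
    (p : ℕ) : D.halfMate v ((h + 1, p), false) =
      (if (e.mate (D.horizontal v h) (true, p)).1 then
        ((h + 1, (e.mate (D.horizontal v h) (true, p)).2), false)
      else ((h, (e.mate (D.horizontal v h) (true, p)).2), true)) := by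
  obtain ⟨hh, rfl⟩ := List.getElem?_eq_some_iff.1 he
  simp [halfMate, hh]

theorem Crossing.word_time? (c : D.Crossing) :
    D.word[c.time]? = some (AnnularEvent.cross c.pos c.risingOver) :=
  List.getElem?_eq_some_iff.2 ⟨c.time_lt, c.word_time⟩

theorem Arc.exists_halfMate {v : D.Resolution} {x y : ℕ × ℕ} (h : D.Arc v x y) :
    ∃ u, (D.halfMate v (x, u)).1 = y := by
  cases h with
  | close p => exact ⟨true, by simp [halfMate]⟩
  | birth h i b e => exact ⟨false, by rw [halfMate_down v e]; simp [mate]⟩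
  | birth_left h i p b e hp => exact ⟨true, by rw [halfMate_up v e]; simp [mate, hp]⟩
  | birth_right h i p b e hp =>
    exact ⟨true, by rw [halfMate_up v e]; simp [mate, not_lt.2 hp]⟩
  | death h i e => exact ⟨true, by rw [halfMate_up v e]; simp [mate]⟩
  | death_left h i p e hp => exact ⟨true, by rw [halfMate_up v e]; simp [mate, hp]⟩
  | death_right h i p e hp =>
    refine ⟨true, ?_⟩
    rw [halfMate_up v e]
    have h1 : ¬ p + 2 < i := by omega
    have h2 : ¬ p + 2 = i := by omega
    have h3 : ¬ p + 2 = i + 1 := by omega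
    simp [mate, h1, h2, h3]
  | cross_other c p hp hp' => exact ⟨true, by rw [halfMate_up v c.word_time?]; simp [mate, hp, hp']⟩
  | vertical_left c hc =>
    exact ⟨true, by rw [halfMate_up v c.word_time?]; simp [mate, horizontal_time, hc]⟩
  | vertical_right c hc =>
    exact ⟨true, by rw [halfMate_up v c.word_time?]; simp [mate, horizontal_time, hc]⟩
  | horizontal_bottom c hc =>
    exact ⟨true, by rw [halfMate_up v c.word_time?]; simp [mate, horizontal_time, hc]⟩
  | horizontal_top c hc =>
    exact ⟨false, by rw [halfMate_down v c.word_time?]; simp [mate, horizontal_time, hc]⟩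

theorem arc_of_mate (v : D.Resolution) {h : ℕ} {e : AnnularEvent} (he : D.word[h]? = some e)
    (u : Bool) (p : ℕ) :
    ∀ x y : ℕ × ℕ, x = (if u then h + 1 else h, p) →
      y = (if (e.mate (D.horizontal v h) (u, p)).1 then h + 1 else h,
        (e.mate (D.horizontal v h) (u, p)).2) → D.Arc v x y ∨ D.Arc v y x := by
  rintro x y rfl rfl
  cases e with
  | birth i b =>
    cases u
    · by_cases h1 : p < i
      · simpa [mate, h1] using Or.inl (Arc.birth_left h i p b he h1)
      · simpa [mate, h1] using Or.inl (Arc.birth_right h i p b he (not_lt.1 h1))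
    · by_cases h1 : p < i
      · simpa [mate, h1] using Or.inr (Arc.birth_left h i p b he h1)
      · by_cases h2 : p = i
        · subst h2; simpa [mate] using Or.inl (Arc.birth h p b he)
        · by_cases h3 : p = i + 1
          · subst h3; simpa [mate] using Or.inr (Arc.birth h i b he)
          · obtain ⟨q, rfl⟩ : ∃ q, p = q + 2 := ⟨p - 2, by omega⟩
            simpa [mate, h1, h2, h3] using Or.inr (Arc.birth_right h i q b he (by omega))
  | death i =>
    cases u
    · by_cases h1 : p < i
      · simpa [mate, h1] using Or.inl (Arc.death_left h i p he h1)
      · by_cases h2 : p = i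
        · subst h2; simpa [mate] using Or.inl (Arc.death h p he)
        · by_cases h3 : p = i + 1
          · subst h3; simpa [mate] using Or.inr (Arc.death h i he)
          · obtain ⟨q, rfl⟩ : ∃ q, p = q + 2 := ⟨p - 2, by omega⟩
            simpa [mate, h1, h2, h3] using Or.inl (Arc.death_right h i q he (by omega))
    · by_cases h1 : p < i
      · simpa [mate, h1] using Or.inr (Arc.death_left h i p he h1)
      · simpa [mate, h1] using Or.inr (Arc.death_right h i p he (not_lt.1 h1))
  | cross i s =>
    obtain ⟨hh, he'⟩ := List.getElem?_eq_some_iff.1 he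
    obtain ⟨c, rfl, rfl, rfl⟩ := exists_crossing hh he'
    simp only [mate, horizontal_time, decide_eq_true_eq]
    by_cases hc : v c = c.risingOver
    · by_cases h1 : p = c.pos
      · subst h1
        cases u
        · simpa [hc] using Or.inl (Arc.horizontal_bottom c hc)
        · simpa [hc] using Or.inl (Arc.horizontal_top c hc)
      · by_cases h2 : p = c.pos + 1
        · subst h2
          cases u
          · simpa [hc] using Or.inr (Arc.horizontal_bottom c hc)
          · simpa [hc] using Or.inr (Arc.horizontal_top c hc)
        · cases u
          · simpa [h1, h2] using Or.inl (Arc.cross_other c p h1 h2)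
          · simpa [h1, h2] using Or.inr (Arc.cross_other c p h1 h2)
    · have hv : D.Arc v (c.time, p) (c.time + 1, p) := by
        by_cases h1 : p = c.pos
        · subst h1; exact Arc.vertical_left c hc
        · by_cases h2 : p = c.pos + 1
          · subst h2; exact Arc.vertical_right c hc
          · exact Arc.cross_other c p h1 h2
      cases u
      · simpa [hc] using Or.inl hv
      · simpa [hc] using Or.inr hv

theorem arc_halfMate (v : D.Resolution) (x : ℕ × ℕ) (u : Bool) (hx : x.1 ≤ D.word.length) :
    D.Arc v x (D.halfMate v (x, u)).1 ∨ D.Arc v (D.halfMate v (x, u)).1 x := by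
  obtain ⟨h, p⟩ := x
  cases u with
  | true =>
    by_cases hh : h < D.word.length
    · have he : D.word[h]? = some D.word[h] := List.getElem?_eq_getElem hh
      refine arc_of_mate v he false p _ _ rfl ?_
      rw [halfMate_up v he]
      split_ifs <;> rfl
    · have : h = D.word.length := le_antisymm hx (not_lt.1 hh)
      subst this
      left
      simpa [halfMate] using Arc.close p
  | false =>
    cases h with
    | zero =>
      right
      simpa [halfMate] using Arc.close p
    | succ h =>
      have he : D.word[h]? = some D.word[h] := List.getElem?_eq_getElem hx
      refine arc_of_mate v he true p _ _ rfl ?_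
      rw [halfMate_down v he]
      split_ifs <;> rfl

/-- The arcs are, up to reversal, the pairs of half-edges, and each point has one half-edge in each
direction. So walking along arcs is the same as iterating the successor or its inverse, for either
choice of `b`. -/
theorem circleSetoid_eq (v : D.Resolution) (b : Bool) :
    D.circleSetoid v = Equiv.Perm.SameCycle.setoid (nextPerm v b) := by
  ext x y
  constructor
  · intro h
    change Relation.EqvGen _ x y at h
    change (nextPerm v b).SameCycle x y
    induction h with
    | rel x y h =>
      obtain ⟨u, hu⟩ := h.exists_halfMate
      exact sameCycle_of_halfMate v b u hu
    | refl x => exact Equiv.Perm.SameCycle.refl _ _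
    | symm x y _ ih => exact ih.symm
    | trans x y z _ _ ih ih' => exact ih.trans ih'
  · intro h
    obtain ⟨k, -, rfl⟩ := Equiv.Perm.SameCycle.exists_pow_eq' h
    clear h
    induction k with
    | zero => exact (D.circleSetoid v).refl x
    | succ k ih =>
      refine (D.circleSetoid v).trans ih ?_
      rw [pow_succ']
      change D.circleSetoid v _ (next v b _)
      generalize ((nextPerm v b) ^ k) x = y
      have := arc_halfMate v y.coord (b ^^ y.coord.2.bodd) y.inRange.1
      rw [← coord_next] at this
      rcases this with h | h
      · exact Relation.EqvGen.rel _ _ h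
      · exact Relation.EqvGen.symm _ _ (Relation.EqvGen.rel _ _ h)

theorem Crossing.coord_lowerLeft (c : D.Crossing) : c.lowerLeft.coord = (c.time, c.pos) := rfl

theorem Crossing.coord_upperRight (c : D.Crossing) :
    c.upperRight.coord = (c.time + 1, c.pos + 1) := rfl

theorem horizontal_congr {v v' : D.Resolution} {c : D.Crossing} (h : ∀ c', c' ≠ c → v' c' = v c')
    {t : ℕ} (ht : t ≠ c.time) : D.horizontal v' t = D.horizontal v t := by
  unfold horizontal
  congr 1
  refine propext (exists_congr fun c' => and_congr_right fun h1 => ?_)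
  rw [h c' (by rintro rfl; exact ht h1.symm)]

/-- With `b = !c.pos.bodd` the lower left strand points up into the crossing and the upper right one
points down into it, while the other two ends point away. Only these two points have successors that
depend on the smoothing of `c`. -/
theorem next_congr {v v' : D.Resolution} {c : D.Crossing} (h : ∀ c', c' ≠ c → v' c' = v c')
    {x : D.Point} (h1 : x ≠ c.lowerLeft) (h2 : x ≠ c.upperRight) :
    next v' (!c.pos.bodd) x = next v (!c.pos.bodd) x := by
  apply Point.coord_injective
  rw [coord_next, coord_next]
  replace h1 : x.coord ≠ (c.time, c.pos) := fun h3 => h1 (Point.coord_injective D h3)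
  replace h2 : x.coord ≠ (c.time + 1, c.pos + 1) := fun h3 => h2 (Point.coord_injective D h3)
  have hx := x.inRange.1
  generalize x.coord = y at *
  obtain ⟨t, p⟩ := y
  simp only [ne_eq, Prod.mk.injEq, not_and] at h1 h2
  by_cases hu : (!c.pos.bodd ^^ p.bodd) = true
  · simp only [hu]
    by_cases ht : t = c.time
    · subst ht
      have hp1 := h1 rfl
      have hp2 : p ≠ c.pos + 1 := by
        rintro rfl
        revert hu
        rw [Nat.bodd_succ]
        cases c.pos.bodd <;> simp
      simp [halfMate_up _ c.word_time?, mate, hp1, hp2]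
    · by_cases hh : t < D.word.length
      · have he : D.word[t]? = some D.word[t] := List.getElem?_eq_getElem hh
        rw [halfMate_up _ he, halfMate_up _ he, horizontal_congr h ht]
      · simp [halfMate, hh]
  · rw [Bool.not_eq_true] at hu
    simp only [hu]
    cases t with
    | zero => simp [halfMate]
    | succ t =>
      by_cases ht : t = c.time
      · subst ht
        have hp2 := h2 rfl
        have hp1 : p ≠ c.pos := by
          rintro rfl
          revert hu
          cases c.pos.bodd <;> simp
        simp [halfMate_down _ c.word_time?, mate, hp1, hp2]
      · have he : D.word[t]? = some D.word[t] := List.getElem?_eq_getElem hx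
        rw [halfMate_down _ he, halfMate_down _ he, horizontal_congr h ht]

/-- The two strands entering the crossing leave at the upper left and the lower right end; changing
the smoothing swaps the two exits. -/
theorem next_lowerLeft {v v' : D.Resolution} {c : D.Crossing} (hc : v' c ≠ v c) :
    next v' (!c.pos.bodd) c.lowerLeft = next v (!c.pos.bodd) c.upperRight := by
  apply Point.coord_injective
  rw [coord_next, coord_next, Crossing.coord_lowerLeft, Crossing.coord_upperRight]
  have h1 : (!c.pos.bodd ^^ c.pos.bodd) = true := by cases c.pos.bodd <;> rfl
  have h2 : (!c.pos.bodd ^^ (c.pos + 1).bodd) = false := by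
    rw [Nat.bodd_succ]; cases c.pos.bodd <;> rfl
  simp only [h1, h2]
  rw [halfMate_up _ c.word_time?, halfMate_down _ c.word_time?, horizontal_time, horizontal_time]
  have h3 : decide (v' c = c.risingOver) = !decide (v c = c.risingOver) := by
    generalize c.risingOver = r at *
    generalize v c = a at *
    generalize v' c = a' at *
    revert a a' r
    decide
  rw [h3]
  cases decide (v c = c.risingOver) <;> simp [mate]

theorem Crossing.lowerLeft_ne_upperRight (c : D.Crossing) : c.lowerLeft ≠ c.upperRight := by
  intro h
  have := congrArg (fun x : D.Point => x.coord.1) h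
  simp [Crossing.coord_lowerLeft, Crossing.coord_upperRight] at this

/-- Changing the smoothing of a crossing whose arcs lie on different circles merges these. -/
theorem circleSetoid_merges_of_not {v v' : D.Resolution} {c : D.Crossing}
    (h : ∀ c', c' ≠ c → v' c' = v c') (hc : v' c ≠ v c)
    (hn : ¬ D.circleSetoid v c.lowerLeft c.upperRight) :
    (D.circleSetoid v).Merges (D.circleSetoid v') c.lowerLeft c.upperRight := by
  rw [circleSetoid_eq v (!c.pos.bodd)] at hn ⊢
  rw [circleSetoid_eq v' (!c.pos.bodd)]
  exact Equiv.Perm.merges_of_not_sameCycle (fun x h1 h2 => next_congr h h1 h2) (next_lowerLeft hc)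
    (next_lowerLeft hc.symm).symm hn

/-- Changing the smoothing of a crossing whose arcs lie on the same circle splits it. -/
theorem circleSetoid_merges_of_rel {v v' : D.Resolution} {c : D.Crossing}
    (h : ∀ c', c' ≠ c → v' c' = v c') (hc : v' c ≠ v c)
    (hn : D.circleSetoid v c.lowerLeft c.upperRight) :
    (D.circleSetoid v').Merges (D.circleSetoid v) c.lowerLeft c.upperRight := by
  rw [circleSetoid_eq v (!c.pos.bodd)] at hn ⊢
  rw [circleSetoid_eq v' (!c.pos.bodd)]
  exact Equiv.Perm.merges_of_sameCycle (fun x h1 h2 => next_congr h h1 h2) (next_lowerLeft hc)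
    (next_lowerLeft hc.symm).symm c.lowerLeft_ne_upperRight hn

end OrientedAnnularDiagram

/-! ### Evaluating enhanced states and saddle maps at colourings -/

namespace OrientedAnnularDiagram

variable {D : OrientedAnnularDiagram}

theorem circleOf_eq_iff {v : D.Resolution} {x y : D.Point} :
    D.circleOf v x = D.circleOf v y ↔ D.circleSetoid v x y :=
  ⟨fun h => Quotient.exact h, fun h => Quotient.sound h⟩

theorem circleSetoid_out (v : D.Resolution) (x : D.Point) :
    D.circleSetoid v (D.circleOf v x).out x := Quotient.mk_out x

theorem EnhancedState.ext_circleOf {S T : D.EnhancedState} (h1 : S.1 = T.1)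
    (h2 : ∀ x, S.2 (D.circleOf S.1 x) = T.2 (D.circleOf T.1 x)) : S = T := by
  obtain ⟨v, l⟩ := S
  obtain ⟨v', l'⟩ := T
  obtain rfl : v = v' := h1
  congr 1
  funext C
  induction C using Quotient.inductionOn with | h x => exact h2 x

/-- The value of `v₊ = 1` (`true`) or `v₋ = X` (`false`) in `ℂ[X] / (X ^ 2 - 1)` at `X = 1` (`true`)
or `X = -1` (`false`). -/
def labelValue (l e : Bool) : ℂ := if l || e then 1 else -1

theorem labelValue_mul_self (l e : Bool) : labelValue l e * labelValue l e = 1 := by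
  cases l <;> cases e <;> simp [labelValue]

/-- The colouring `ε` of the points is constant on the circles of `v`. -/
def Compatible (v : D.Resolution) (ε : D.Point → Bool) : Prop :=
  ∀ ⦃x y⦄, D.circleSetoid v x y → ε x = ε y

theorem Compatible.out {v : D.Resolution} {ε : D.Point → Bool} (h : Compatible v ε) (x : D.Point) :
    ε (D.circleOf v x).out = ε x := h (circleSetoid_out v x)

/-- The value of an enhanced state at a colouring of the circles. -/
noncomputable def stateValue (ε : D.Point → Bool) (S : D.EnhancedState) : ℂ :=
  ∏ C : D.Circle S.1, labelValue (S.2 C) (ε C.out)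

open Classical in
/-- The evaluation of chains over the resolution `v` at the colouring `ε`, as a function of the
distinguished basis elements. -/
noncomputable def evalFun (v : D.Resolution) (ε : D.Point → Bool) (S : D.EnhancedState) : ℂ :=
  if S.1 = v then stateValue ε S else 0

section Saddle

variable {v v' : D.Resolution} {c : D.Crossing}

theorem circleSetoid_of_not_of_not (h : ∀ c', c' ≠ c → v' c' = v c') (hc : v' c ≠ v c)
    {x y : D.Point} (hxy : D.circleSetoid v' x y) (h1 : ¬ D.circleSetoid v' x c.lowerLeft)
    (h2 : ¬ D.circleSetoid v' x c.upperRight) : D.circleSetoid v x y := by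
  by_cases hr : D.circleSetoid v c.lowerLeft c.upperRight
  · exact (circleSetoid_merges_of_rel h hc hr).le hxy
  · have hm := circleSetoid_merges_of_not h hc hr
    exact hm.rel_of_not hxy (fun h3 => h1 (hm.le h3)) (fun h3 => h2 (hm.le h3))

theorem circleSetoid_touch (h : ∀ c', c' ≠ c → v' c' = v c') (hc : v' c ≠ v c) {x : D.Point}
    (h1 : D.circleSetoid v x c.lowerLeft ∨ D.circleSetoid v x c.upperRight) :
    D.circleSetoid v' x c.lowerLeft ∨ D.circleSetoid v' x c.upperRight := by
  by_cases hr : D.circleSetoid v c.lowerLeft c.upperRight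
  · have hm := circleSetoid_merges_of_rel h hc hr
    refine (hm.rel_left_iff x).1 ?_
    rcases h1 with h1 | h1
    exacts [h1, (D.circleSetoid v).trans h1 ((D.circleSetoid v).symm hr)]
  · have hm := circleSetoid_merges_of_not h hc hr
    exact h1.imp (fun h => hm.le h) (fun h => hm.le h)

end Saddle

theorem update_true_of_ne (v : D.Resolution) (c c' : D.Crossing) (h : c' ≠ c) :
    Function.update v c true c' = v c' := Function.update_of_ne h _ _

theorem update_true_ne {v : D.Resolution} {c : D.Crossing} (h : v c = false) :
    Function.update v c true c ≠ v c := by simp [h]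

open Classical in
/-- The enhanced state at the end of an edge with labels `z` and `w` of the circles through the
lower left and the upper right end of the crossing. -/
noncomputable def edgeState (S : D.EnhancedState) {c : D.Crossing} (hc : S.1 c = false)
    (z w : Bool) : D.EnhancedState :=
  ⟨Function.update S.1 c true, Quotient.lift (fun x =>
    -- After a merge both ends lie on one circle; the first case then applies and `w` plays no role.
    if D.circleSetoid (Function.update S.1 c true) x c.lowerLeft then z
    else if D.circleSetoid (Function.update S.1 c true) x c.upperRight then w
    else S.2 (D.circleOf S.1 x)) (by
      intro x y hxy
      change D.circleSetoid _ x y at hxy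
      have h1 : ∀ q, D.circleSetoid (Function.update S.1 c true) x q ↔
          D.circleSetoid (Function.update S.1 c true) y q := fun q =>
        ⟨fun h => (D.circleSetoid _).trans ((D.circleSetoid _).symm hxy) h,
          fun h => (D.circleSetoid _).trans hxy h⟩
      simp only [← h1]
      split_ifs with h2 h3
      · rfl
      · rfl
      · exact congrArg S.2 (circleOf_eq_iff.2 (circleSetoid_of_not_of_not
          (update_true_of_ne S.1 c) (update_true_ne hc) hxy h2 h3)))⟩

variable {S : D.EnhancedState} {c : D.Crossing} (hc : S.1 c = false)

open Classical in
theorem edgeState_label (z w : Bool) (x : D.Point) :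
    (edgeState S hc z w).2 (D.circleOf (Function.update S.1 c true) x) =
      if D.circleSetoid (Function.update S.1 c true) x c.lowerLeft then z
      else if D.circleSetoid (Function.update S.1 c true) x c.upperRight then w
      else S.2 (D.circleOf S.1 x) := rfl

theorem edgeState_lowerLeft (z w : Bool) :
    (edgeState S hc z w).2 (D.circleOf (Function.update S.1 c true) c.lowerLeft) = z := by
  rw [edgeState_label, if_pos ((D.circleSetoid _).refl _)]

theorem edgeState_upperRight (z w : Bool)
    (h : ¬ D.circleSetoid (Function.update S.1 c true) c.lowerLeft c.upperRight) :
    (edgeState S hc z w).2 (D.circleOf (Function.update S.1 c true) c.upperRight) = w := by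
  rw [edgeState_label, if_neg (fun h1 => h ((D.circleSetoid _).symm h1)),
    if_pos ((D.circleSetoid _).refl _)]

theorem edgeState_of_not (z w : Bool) {x : D.Point} (h1 : ¬ D.circleSetoid S.1 x c.lowerLeft)
    (h2 : ¬ D.circleSetoid S.1 x c.upperRight) :
    (edgeState S hc z w).2 (D.circleOf (Function.update S.1 c true) x) =
      S.2 (D.circleOf S.1 x) := by
  have h := mt (circleSetoid_touch (v := Function.update S.1 c true) (v' := S.1) (x := x)
    (fun c' hc' => (update_true_of_ne S.1 c c' hc').symm) (update_true_ne hc).symm)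
    (not_or.2 ⟨h1, h2⟩)
  rw [not_or] at h
  rw [edgeState_label, if_neg h.1, if_neg h.2]

theorem isEdge_edgeState (z w : Bool) : D.IsEdge c S (edgeState S hc z w) := by
  refine ⟨hc, Function.update_self _ _ _, update_true_of_ne S.1 c, fun x h1 h2 => ?_⟩
  exact edgeState_of_not hc z w (fun h => h1 (circleOf_eq_iff.2 h))
    (fun h => h2 (circleOf_eq_iff.2 h))

theorem IsEdge.fst_eq {T : D.EnhancedState} (h : D.IsEdge c S T) :
    T.1 = Function.update S.1 c true := by
  funext c'
  by_cases h1 : c' = c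
  · subst h1; rw [h.2.1, Function.update_self]
  · rw [h.2.2.1 c' h1, Function.update_of_ne h1]

/-- An edge fixes the labels of all circles away from `c`, so only those of the circles through the
two arcs at `c` remain free. -/
theorem IsEdge.eq_edgeState {T : D.EnhancedState} (h : D.IsEdge c S T) :
    T = edgeState S hc (T.2 (D.circleOf T.1 c.lowerLeft)) (T.2 (D.circleOf T.1 c.upperRight)) := by
  have h0 := h.fst_eq
  refine EnhancedState.ext_circleOf h0 fun x => ?_
  change _ = (edgeState S hc _ _).2 (D.circleOf (Function.update S.1 c true) x)
  rw [edgeState_label, ← h0]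
  split_ifs with h1 h2
  · rw [circleOf_eq_iff.2 h1]
  · rw [circleOf_eq_iff.2 h2]
  · have h3 := mt (circleSetoid_touch (v := S.1) (v' := T.1) (x := x)
      (by rw [h0]; exact update_true_of_ne S.1 c)
      (by rw [h0]; exact update_true_ne hc)) (not_or.2 ⟨h1, h2⟩)
    rw [not_or] at h3
    exact h.2.2.2 x (fun h4 => h3.1 (circleOf_eq_iff.1 h4)) (fun h4 => h3.2 (circleOf_eq_iff.1 h4))

/-- This excludes one-to-one saddles: the arcs at `c` lie on one circle after the change exactly if
they lay on two before it. -/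
theorem rel_update_iff (hc : S.1 c = false) :
    D.circleSetoid (Function.update S.1 c true) c.lowerLeft c.upperRight ↔
      ¬ D.circleSetoid S.1 c.lowerLeft c.upperRight := by
  by_cases hr : D.circleSetoid S.1 c.lowerLeft c.upperRight
  · simp [hr, (circleSetoid_merges_of_rel (update_true_of_ne S.1 c) (update_true_ne hc) hr).not_rel]
  · simp [hr, (circleSetoid_merges_of_not (update_true_of_ne S.1 c) (update_true_ne hc) hr).rel]

open Classical in
theorem sum_isEdge_of_merge (hn : ¬ D.circleSetoid S.1 c.lowerLeft c.upperRight)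
    (F : D.EnhancedState → ℂ) :
    ∑ T, (if D.IsEdge c S T then F T else 0) = ∑ z : Bool, F (edgeState S hc z z) := by
  rw [← Finset.sum_filter]
  symm
  refine Finset.sum_bij' (fun z _ => edgeState S hc z z)
    (fun T _ => T.2 (D.circleOf T.1 c.lowerLeft)) ?_ ?_ ?_ ?_ ?_
  · intro z _
    simpa using isEdge_edgeState hc z z
  · intro T _; exact Finset.mem_univ _
  · intro z _
    exact edgeState_lowerLeft hc z z
  · intro T hT
    have hT' : D.IsEdge c S T := by simpa using hT
    have h1 := hT'.eq_edgeState hc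
    have h2 : D.circleOf T.1 c.upperRight = D.circleOf T.1 c.lowerLeft := by
      rw [hT'.fst_eq]
      exact (circleOf_eq_iff.2 ((rel_update_iff hc).2 hn)).symm
    rw [h2] at h1
    exact h1.symm
  · intro z _; rfl

open Classical in
theorem sum_isEdge_of_split (hr : D.circleSetoid S.1 c.lowerLeft c.upperRight)
    (F : D.EnhancedState → ℂ) :
    ∑ T, (if D.IsEdge c S T then F T else 0) =
      ∑ z : Bool × Bool, F (edgeState S hc z.1 z.2) := by
  have hn := fun h => (rel_update_iff hc).1 h hr
  rw [← Finset.sum_filter]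
  symm
  refine Finset.sum_bij' (fun z _ => edgeState S hc z.1 z.2)
    (fun T _ => (T.2 (D.circleOf T.1 c.lowerLeft), T.2 (D.circleOf T.1 c.upperRight))) ?_ ?_ ?_ ?_ ?_
  · intro z _
    simpa using isEdge_edgeState hc z.1 z.2
  · intro T _; exact Finset.mem_univ _
  · rintro ⟨z, w⟩ _
    exact Prod.ext (edgeState_lowerLeft hc z w) (edgeState_upperRight hc z w hn)
  · intro T hT
    have hT' : D.IsEdge c S T := by simpa using hT
    exact (hT'.eq_edgeState hc).symm
  · intro z _; rfl

open Classical in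
/-- The factor by which a merge or split map acts on evaluations at `ε`. -/
noncomputable def saddleFactor (v : D.Resolution) (c : D.Crossing) (ε : D.Point → Bool) : ℂ :=
  if D.circleSetoid v c.lowerLeft c.upperRight then (if ε c.lowerLeft then 2 else -2) else 1

theorem stateValue_merge {ε : D.Point → Bool} (hε : Compatible (Function.update S.1 c true) ε)
    (hn : ¬ D.circleSetoid S.1 c.lowerLeft c.upperRight) (z w : Bool) :
    stateValue ε S * labelValue z (ε c.lowerLeft) =
      labelValue (S.2 (D.circleOf S.1 c.lowerLeft)) (ε c.lowerLeft) *
      labelValue (S.2 (D.circleOf S.1 c.upperRight)) (ε c.upperRight) *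
      stateValue ε (edgeState S hc z w) := by
  have hm := circleSetoid_merges_of_not (update_true_of_ne S.1 c) (update_true_ne hc) hn
  have hε' : Compatible S.1 ε := fun x y h => hε (hm.le h)
  have := hm.prod_mul_eq (fun C => labelValue (S.2 C) (ε C.out))
    (fun C => labelValue ((edgeState S hc z w).2 C) (ε C.out)) (by
      intro x h1 h2
      have h3 := edgeState_of_not hc z w h1 h2
      have h4 := hε.out x
      have h5 := hε'.out x
      simp only [circleOf] at h3 h4 h5
      simp only [h3, h4, h5])
  have h1 := hε'.out c.lowerLeft
  have h2 := hε'.out c.upperRight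
  have h3 := hε.out c.lowerLeft
  have h4 := edgeState_lowerLeft hc z w
  simp only [circleOf] at h1 h2 h3 h4 ⊢
  simp only [h1, h2, h3, h4] at this
  exact this

/-- The constant `K` is the contribution of the circles that miss `c`. The colouring may differ on
the two new circles, and then it does not descend to the circle being split; so the value of `S` is
compared with `K` only when the colours agree. -/
theorem stateValue_split {ε : D.Point → Bool} (hε : Compatible (Function.update S.1 c true) ε)
    (hr : D.circleSetoid S.1 c.lowerLeft c.upperRight) :
    ∃ K : ℂ, (∀ z w, stateValue ε (edgeState S hc z w) =
      labelValue z (ε c.lowerLeft) * labelValue w (ε c.upperRight) * K) ∧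
      (ε c.lowerLeft = ε c.upperRight → stateValue ε S =
        labelValue (S.2 (D.circleOf S.1 c.lowerLeft)) (ε c.lowerLeft) * K) := by
  classical
  have hm := circleSetoid_merges_of_rel (update_true_of_ne S.1 c) (update_true_ne hc) hr
  have hn := fun h => (rel_update_iff hc).1 h hr
  have key : ∀ z w (G : D.Circle S.1 → ℂ), (∀ x, ¬ D.circleSetoid S.1 x c.lowerLeft →
      G (D.circleOf S.1 x) = labelValue (S.2 (D.circleOf S.1 x)) (ε x)) →
      stateValue ε (edgeState S hc z w) * G (D.circleOf S.1 c.lowerLeft) =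
        labelValue z (ε c.lowerLeft) * labelValue w (ε c.upperRight) * ∏ C, G C := by
    intro z w G hG
    have := hm.prod_mul_eq (fun C => labelValue ((edgeState S hc z w).2 C) (ε C.out)) G (by
      intro x h1 h2
      have h0 : ¬ D.circleSetoid S.1 x c.lowerLeft := fun h3 =>
        ((hm.rel_left_iff x).1 h3).elim h1 h2
      have h3 := edgeState_of_not hc z w (x := x) h0 (fun h4 => h0 ((D.circleSetoid S.1).trans h4
        ((D.circleSetoid S.1).symm hr)))
      have h4 := hε.out x
      have h5 := hG x h0
      simp only [circleOf] at h3 h4 h5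
      simp only [h3, h4, h5])
    have h1 := edgeState_upperRight hc z w hn
    have h2 := hε.out c.upperRight
    have h3 := hε.out c.lowerLeft
    have h4 := edgeState_lowerLeft hc z w
    simp only [circleOf] at h1 h2 h3 h4 ⊢
    simp only [h1, h2, h3, h4] at this
    exact this
  -- Replacing the value on the split circle by `1` gives a function on the circles of `S` even when
  -- `ε` is not constant there.
  let G : D.Circle S.1 → ℂ := Quotient.lift (fun x => if D.circleSetoid S.1 x c.lowerLeft then 1
    else labelValue (S.2 (D.circleOf S.1 x)) (ε x)) (by
      intro x y hxy
      change D.circleSetoid S.1 x y at hxy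
      have h1 : D.circleSetoid S.1 x c.lowerLeft ↔ D.circleSetoid S.1 y c.lowerLeft :=
        ⟨fun h => (D.circleSetoid _).trans ((D.circleSetoid _).symm hxy) h,
          fun h => (D.circleSetoid _).trans hxy h⟩
      simp only [← h1]
      split_ifs with h2
      · rfl
      · rw [circleOf_eq_iff.2 hxy, hε (hm.rel_of_not hxy
          (fun h => h2 ((hm.rel_left_iff x).2 (Or.inl h)))
          (fun h => h2 ((hm.rel_left_iff x).2 (Or.inr h))))])
  have hG1 : G (D.circleOf S.1 c.lowerLeft) = 1 := if_pos ((D.circleSetoid S.1).refl _)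
  have hG2 : ∀ x, ¬ D.circleSetoid S.1 x c.lowerLeft →
      G (D.circleOf S.1 x) = labelValue (S.2 (D.circleOf S.1 x)) (ε x) := fun x hx => if_neg hx
  have hK : ∀ z w, stateValue ε (edgeState S hc z w) =
      labelValue z (ε c.lowerLeft) * labelValue w (ε c.upperRight) * ∏ C, G C := by
    intro z w
    have := key z w G hG2
    rwa [hG1, mul_one] at this
  refine ⟨∏ C, G C, hK, fun he => ?_⟩
  have hε' : Compatible S.1 ε := by
    intro x y hxy
    rcases (hm.2 x y).1 hxy with h | ⟨h1, h2⟩ | ⟨h1, h2⟩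
    · exact hε h
    · rw [hε h1, he, hε h2]
    · rw [hε h1, ← he, hε h2]
  -- Labelling both new circles `v₊`, whose value is `1` at either colour, isolates `K`.
  have h1 := key true true (fun C => labelValue (S.2 C) (ε C.out)) (fun x _ => by
    simp only [hε'.out x])
  rw [hK true true] at h1
  simp only [hε'.out] at h1
  have h2 : ∀ e, labelValue true e = 1 := fun e => by simp [labelValue]
  rw [h2, h2] at h1
  simp only [one_mul] at h1
  rw [mul_comm]
  exact h1.symm

open Classical in
-- Evaluation at a colour is an algebra homomorphism, so merging has factor `1`. Writing `e = ±1`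
-- for the values of `X` at the colours, `Δ 1 = 1 ⊗ X + X ⊗ 1` takes the value `e₁ + e₂` and `Δ X =
-- X ⊗ X + 1 ⊗ 1` the value `e₁ e₂ + 1`. Both vanish for different colours and are `2 e` times the
-- old value for equal ones.
theorem sum_isEdge_stateValue (hc : S.1 c = false) {ε : D.Point → Bool}
    (hε : Compatible (Function.update S.1 c true) ε) :
    ∑ T, (if D.IsEdge c S T then stateValue ε T * D.saddleCoeff c S T else 0) =
      if ε c.lowerLeft = ε c.upperRight then saddleFactor S.1 c ε * stateValue ε S else 0 := by
  by_cases hr : D.circleSetoid S.1 c.lowerLeft c.upperRight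
  · have hn := fun h => (rel_update_iff hc).1 h hr
    rw [sum_isEdge_of_split hc hr]
    obtain ⟨K, hK1, hK2⟩ := stateValue_split hc hε hr
    have hs : ∀ z w, D.saddleCoeff c S (edgeState S hc z w) =
        leeComul (S.2 (D.circleOf S.1 c.lowerLeft)) z w := by
      intro z w
      rw [saddleCoeff, if_neg (not_not.2 (circleOf_eq_iff.2 hr))]
      change leeComul _ ((edgeState S hc z w).2 (D.circleOf (Function.update S.1 c true) _))
        ((edgeState S hc z w).2 (D.circleOf (Function.update S.1 c true) _)) = _
      rw [edgeState_lowerLeft, edgeState_upperRight hc z w hn]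
    simp only [hK1, hs, Fintype.sum_prod_type, Fintype.sum_bool, saddleFactor, if_pos hr]
    split_ifs with h1 h2
    · rw [hK2 h1, ← h1, h2]
      cases S.2 (D.circleOf S.1 c.lowerLeft) <;> simp [leeComul, labelValue] <;> ring
    · rw [hK2 h1, ← h1]
      rw [Bool.not_eq_true] at h2
      rw [h2]
      cases S.2 (D.circleOf S.1 c.lowerLeft) <;> simp [leeComul, labelValue] <;> ring
    · cases S.2 (D.circleOf S.1 c.lowerLeft) <;> cases ha : ε c.lowerLeft <;>
        cases hb : ε c.upperRight <;> simp_all [leeComul, labelValue]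
  · have hr' := (rel_update_iff hc).2 hr
    rw [sum_isEdge_of_merge hc hr]
    have hs : ∀ z, D.saddleCoeff c S (edgeState S hc z z) =
        leeMul (S.2 (D.circleOf S.1 c.lowerLeft)) (S.2 (D.circleOf S.1 c.upperRight)) z := by
      intro z
      rw [saddleCoeff, if_pos (fun h => hr (circleOf_eq_iff.1 h))]
      change leeMul _ _ ((edgeState S hc z z).2 (D.circleOf (Function.update S.1 c true) _)) = _
      rw [edgeState_lowerLeft]
    have he : ε c.lowerLeft = ε c.upperRight := hε hr'
    rw [if_pos he, saddleFactor, if_neg hr, one_mul]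
    -- The values of labels are `±1`, so each is its own inverse and `stateValue_merge` can be
    -- solved for the new state.
    have hK : ∀ z, stateValue ε (edgeState S hc z z) =
        stateValue ε S * labelValue z (ε c.lowerLeft) *
        labelValue (S.2 (D.circleOf S.1 c.lowerLeft)) (ε c.lowerLeft) *
        labelValue (S.2 (D.circleOf S.1 c.upperRight)) (ε c.lowerLeft) := by
      intro z
      have h := stateValue_merge hc hε hr z z
      rw [← he] at h
      have ha := labelValue_mul_self (S.2 (D.circleOf S.1 c.lowerLeft)) (ε c.lowerLeft)
      have hb := labelValue_mul_self (S.2 (D.circleOf S.1 c.upperRight)) (ε c.lowerLeft)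
      generalize labelValue (S.2 (D.circleOf S.1 c.lowerLeft)) (ε c.lowerLeft) = a at *
      generalize labelValue (S.2 (D.circleOf S.1 c.upperRight)) (ε c.lowerLeft) = b at *
      generalize stateValue ε (edgeState S hc z z) = W at *
      linear_combination (-(a * b)) * h - W * b * b * ha - W * hb
    simp only [hK, hs, Fintype.sum_bool]
    cases S.2 (D.circleOf S.1 c.lowerLeft) <;> cases S.2 (D.circleOf S.1 c.upperRight) <;>
        cases ε c.lowerLeft <;> simp [leeMul, labelValue]

open Classical in
/-- The Lee differential in terms of evaluations. -/
theorem sum_evalFun_mul_leeCoeff {v : D.Resolution} {ε : D.Point → Bool} (hε : Compatible v ε)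
    (S : D.EnhancedState) :
    ∑ T, evalFun v ε T * D.leeCoeff S T =
      ∑ c : D.Crossing, if v c = true ∧ ε c.lowerLeft = ε c.upperRight then
        D.edgeSign (Function.update v c false) c * saddleFactor (Function.update v c false) c ε *
          evalFun (Function.update v c false) ε S else 0 := by
  simp only [leeCoeff, Finset.mul_sum]
  rw [Finset.sum_comm]
  refine Finset.sum_congr rfl fun c _ => ?_
  -- Only the edge at `c` that ends at the resolution `v` contributes, and it must start at `v` with
  -- `c` reset.
  by_cases hv : v c = true ∧ S.1 = Function.update v c false
  · obtain ⟨h1, h2⟩ := hv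
    have hc : S.1 c = false := by rw [h2, Function.update_self]
    have hv : Function.update S.1 c true = v := by
      rw [h2, Function.update_idem, ← h1, Function.update_eq_self]
    have h3 := sum_isEdge_stateValue hc (ε := ε) (by rw [hv]; exact hε)
    rw [← h2]
    have h4 : ∀ T, evalFun v ε T * (if D.IsEdge c S T then D.edgeSign S.1 c * D.saddleCoeff c S T
        else 0) = D.edgeSign S.1 c *
          (if D.IsEdge c S T then stateValue ε T * D.saddleCoeff c S T else 0) := by
      intro T
      split_ifs with h5
      · rw [evalFun, if_pos (h5.fst_eq.trans hv)]; ring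
      · simp
    simp only [h4]
    rw [← Finset.mul_sum, h3]
    simp only [h1, true_and, evalFun, if_true]
    split_ifs <;> ring
  · have h1 : ∀ T, evalFun v ε T * (if D.IsEdge c S T then D.edgeSign S.1 c * D.saddleCoeff c S T
        else 0) = 0 := by
      intro T
      by_cases h2 : D.IsEdge c S T
      · rw [evalFun, if_neg, zero_mul]
        intro h3
        refine hv ⟨by rw [← h3]; exact h2.2.1, ?_⟩
        rw [← h3, h2.fst_eq, Function.update_idem]
        conv_lhs => rw [← Function.update_eq_self c S.1, h2.1]
      · rw [if_neg h2, mul_zero]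
    rw [Finset.sum_eq_zero (fun T _ => h1 T)]
    split_ifs with h2
    · rw [evalFun, if_neg (fun h3 => hv ⟨h2.1, h3⟩), mul_zero]
    · rfl

end OrientedAnnularDiagram

/-! ### The Lee differential in evaluations, and why it squares to zero -/

namespace OrientedAnnularDiagram

variable {D : OrientedAnnularDiagram}

theorem leeDifferential_apply (x : D.LeeChain) (T : D.EnhancedState) :
    D.leeDifferential x T = ∑ S, D.leeCoeff S T * x S := rfl

/-- The evaluation of a chain over the resolution `v` at the colouring `ε`. -/
noncomputable def evalAt (v : D.Resolution) (ε : D.Point → Bool) (x : D.LeeChain) : ℂ :=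
  ∑ S, evalFun v ε S * x S

open Classical in
theorem evalAt_leeDifferential {v : D.Resolution} {ε : D.Point → Bool} (hε : Compatible v ε)
    (x : D.LeeChain) :
    evalAt v ε (D.leeDifferential x) =
      ∑ c : D.Crossing, if v c = true ∧ ε c.lowerLeft = ε c.upperRight then
        D.edgeSign (Function.update v c false) c * saddleFactor (Function.update v c false) c ε *
          evalAt (Function.update v c false) ε x else 0 := by
  have h1 : evalAt v ε (D.leeDifferential x) =
      ∑ S, (∑ T, evalFun v ε T * D.leeCoeff S T) * x S := by
    simp only [evalAt, leeDifferential_apply, Finset.mul_sum, Finset.sum_mul, mul_assoc]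
    exact Finset.sum_comm
  rw [h1]
  simp only [sum_evalFun_mul_leeCoeff hε, Finset.sum_mul]
  rw [Finset.sum_comm]
  refine Finset.sum_congr rfl fun c _ => ?_
  split_ifs with h
  · rw [evalAt, Finset.mul_sum]
    exact Finset.sum_congr rfl fun S _ => by ring
  · simp

theorem Compatible.of_eq_of_ne {v v' : D.Resolution} {c : D.Crossing} {ε : D.Point → Bool}
    (hε : Compatible v ε) (h : ∀ c', c' ≠ c → v' c' = v c') (hc : v' c ≠ v c)
    (he : ε c.lowerLeft = ε c.upperRight) : Compatible v' ε := by
  intro x y hxy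
  by_cases hr : D.circleSetoid v c.lowerLeft c.upperRight
  · exact hε ((circleSetoid_merges_of_rel h hc hr).le hxy)
  · rcases ((circleSetoid_merges_of_not h hc hr).2 x y).1 hxy with h1 | ⟨h1, h2⟩ | ⟨h1, h2⟩
    · exact hε h1
    · rw [hε h1, he, hε h2]
    · rw [hε h1, ← he, hε h2]

theorem Compatible.update_false {v : D.Resolution} {c : D.Crossing} {ε : D.Point → Bool}
    (hε : Compatible v ε) (hc : v c = true)
    (he : ε c.lowerLeft = ε c.upperRight) : Compatible (Function.update v c false) ε :=
  hε.of_eq_of_ne (fun _ h => Function.update_of_ne h _ _) (by simp [hc]) he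

/-- A square root of the factor by which a split at a circle of the given colour acts. -/
noncomputable def colourRoot (e : Bool) : ℂ :=
  if e then (Real.sqrt 2 : ℂ) else Complex.I * (Real.sqrt 2 : ℂ)

theorem colourRoot_mul_self (e : Bool) :
    colourRoot e * colourRoot e = if e then 2 else -2 := by
  have h : (Real.sqrt 2 : ℂ) * (Real.sqrt 2 : ℂ) = 2 := by
    rw [← Complex.ofReal_mul, Real.mul_self_sqrt (by norm_num)]; norm_num
  cases e
  · simp only [colourRoot, Bool.false_eq_true, if_false]
    linear_combination Complex.I * Complex.I * h + 2 * Complex.I_mul_I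
  · simpa [colourRoot] using h

theorem colourRoot_ne_zero (e : Bool) : colourRoot e ≠ 0 := by
  intro h
  have := colourRoot_mul_self e
  rw [h] at this
  cases e <;> simp at this

/-- The product of the colour roots over all circles. -/
noncomputable def colourWeight (v : D.Resolution) (ε : D.Point → Bool) : ℂ :=
  ∏ C : D.Circle v, colourRoot (ε C.out)

theorem colourWeight_ne_zero (v : D.Resolution) (ε : D.Point → Bool) : colourWeight v ε ≠ 0 :=
  Finset.prod_ne_zero_iff.2 fun _ _ => colourRoot_ne_zero _

/-- The side before the merge has one circle more, of the same colour as the merged one. -/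
theorem colourWeight_merges {v v' : D.Resolution} {ε : D.Point → Bool} {p s : D.Point}
    (h : (D.circleSetoid v).Merges (D.circleSetoid v') p s) (hε : Compatible v' ε) :
    colourWeight v ε = colourRoot (ε p) * colourWeight v' ε := by
  have hε' : Compatible v ε := fun x y hxy => hε (h.le hxy)
  have := h.prod_mul_eq (fun C => colourRoot (ε C.out)) (fun C => colourRoot (ε C.out)) (by
    intro x _ _
    have h1 := hε.out x
    have h2 := hε'.out x
    simp only [circleOf] at h1 h2
    simp only [h1, h2])
  have h1 := hε.out p
  have h2 := hε'.out p
  have h3 := hε'.out s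
  simp only [circleOf] at h1 h2 h3
  simp only [h1, h2, h3, ← hε h.rel] at this
  refine mul_right_cancel₀ (colourRoot_ne_zero (ε p)) ?_
  rw [colourWeight, this, colourWeight]
  ring

/-- A merge loses one root while its factor is `1`; a split gains one root while its factor is the
root squared. After rescaling by weights, both act by the root of the colour at `c`, which does not
depend on the rest of the resolution. -/
theorem saddleFactor_mul_colourWeight {v : D.Resolution} {c : D.Crossing} {ε : D.Point → Bool}
    (hε : Compatible v ε) (hc : v c = true) (he : ε c.lowerLeft = ε c.upperRight) :
    saddleFactor (Function.update v c false) c ε * colourWeight (Function.update v c false) ε =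
      colourWeight v ε * colourRoot (ε c.lowerLeft) := by
  have h1 : ∀ c', c' ≠ c → v c' = Function.update v c false c' :=
    fun _ h => (Function.update_of_ne h _ _).symm
  have h2 : v c ≠ Function.update v c false c := by simp [hc]
  rw [saddleFactor]
  split_ifs with hr he'
  · rw [colourWeight_merges (circleSetoid_merges_of_rel h1 h2 hr) (hε.update_false hc he)]
    have := colourRoot_mul_self (ε c.lowerLeft)
    rw [if_pos he'] at this
    rw [← this]; ring
  · rw [colourWeight_merges (circleSetoid_merges_of_rel h1 h2 hr) (hε.update_false hc he)]
    have := colourRoot_mul_self (ε c.lowerLeft)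
    rw [if_neg he'] at this
    rw [← this]; ring
  · rw [colourWeight_merges (circleSetoid_merges_of_not h1 h2 hr) hε]
    ring

theorem edgeSign_update {v : D.Resolution} {c : D.Crossing} (hc : v c = true) (c' : D.Crossing) :
    D.edgeSign (Function.update v c false) c' =
      (if c.time < c'.time then -1 else 1) * D.edgeSign v c' := by
  classical
  unfold edgeSign
  split_ifs with h
  · have h1 : (Finset.univ.filter fun c'' : D.Crossing => c''.time < c'.time ∧ v c'' = true) =
        insert c (Finset.univ.filter fun c'' : D.Crossing => c''.time < c'.time ∧
          Function.update v c false c'' = true) := by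
      ext c''
      simp only [Finset.mem_filter, Finset.mem_univ, true_and, Finset.mem_insert]
      by_cases h2 : c'' = c
      · subst h2; simp [h, hc]
      · simp [h2]
    rw [h1, Finset.card_insert_of_notMem (by simp), pow_succ]
    ring
  · rw [one_mul]
    congr 3
    ext c''
    by_cases h2 : c'' = c
    · subst h2; simp [h]
    · simp [h2]

theorem evalFun_of_circle (v : D.Resolution) (e l : D.Circle v → Bool) :
    evalFun v (fun x => e (D.circleOf v x)) ⟨v, l⟩ = ∏ C, labelValue (l C) (e C) := by
  rw [evalFun, if_pos rfl, stateValue]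
  refine Finset.prod_congr rfl fun C _ => ?_
  have : D.circleOf v C.out = C := Quotient.out_eq C
  rw [this]

/-- Orthogonality of characters: summing over all colourings of the circles of `v`, the product of
the values of two labellings gives zero unless they coincide. So evaluations recover every
coordinate of a chain. -/
theorem eq_zero_of_evalAt {x : D.LeeChain}
    (h : ∀ v ε, Compatible v ε → evalAt v ε x = 0) : x = 0 := by
  classical
  funext S₀
  obtain ⟨v, l₀⟩ := S₀
  have h1 : ∑ e : D.Circle v → Bool, (∏ C, labelValue (l₀ C) (e C)) *
      evalAt v (fun x => e (D.circleOf v x)) x = 0 := by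
    refine Finset.sum_eq_zero fun e _ => ?_
    rw [h, mul_zero]
    intro p q hpq
    exact congrArg e (circleOf_eq_iff.2 hpq)
  have h2 : ∀ S : D.EnhancedState, S ≠ ⟨v, l₀⟩ →
      ∑ e : D.Circle v → Bool, (∏ C, labelValue (l₀ C) (e C)) *
        evalFun v (fun x => e (D.circleOf v x)) S = 0 := by
    rintro ⟨v', l⟩ hS
    by_cases hv : v' = v
    · subst hv
      simp only [evalFun_of_circle, ← Finset.prod_mul_distrib]
      have := Finset.prod_univ_sum (fun _ : D.Circle v' => (Finset.univ : Finset Bool))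
        (fun C b => labelValue (l₀ C) b * labelValue (l C) b)
      rw [Fintype.piFinset_univ] at this
      rw [← this]
      obtain ⟨C, hC⟩ : ∃ C, l C ≠ l₀ C := by
        by_contra! hcon
        exact hS (by rw [funext hcon])
      refine Finset.prod_eq_zero (Finset.mem_univ C) ?_
      rw [Fintype.sum_bool]
      revert hC
      cases l C <;> cases l₀ C <;> simp [labelValue]
    · simp [evalFun, hv]
  have h3 : ∑ e : D.Circle v → Bool, (∏ C, labelValue (l₀ C) (e C)) *
        evalFun v (fun x => e (D.circleOf v x)) ⟨v, l₀⟩ ≠ 0 := by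
    simp only [evalFun_of_circle, ← Finset.prod_mul_distrib, labelValue_mul_self]
    simp
  have h4 : (∑ e : D.Circle v → Bool, (∏ C, labelValue (l₀ C) (e C)) *
        evalFun v (fun x => e (D.circleOf v x)) ⟨v, l₀⟩) * x ⟨v, l₀⟩ = 0 := by
    rw [← h1]
    simp only [evalAt, Finset.mul_sum]
    rw [Finset.sum_comm, Finset.sum_mul]
    rw [Finset.sum_eq_single (⟨v, l₀⟩ : D.EnhancedState)]
    · exact Finset.sum_congr rfl fun e _ => by ring
    · intro S _ hS
      simp only [← mul_assoc]
      rw [← Finset.sum_mul, h2 S hS, zero_mul]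
    · simp
  exact (mul_eq_zero.1 h4).resolve_left h3

/-- In evaluations the square is a sum over ordered pairs of crossings. The two orders have equal
saddle factors and opposite signs, with no case distinction on how the crossings interact. -/
theorem leeDifferential_leeDifferential (x : D.LeeChain) :
    D.leeDifferential (D.leeDifferential x) = 0 := by
  classical
  refine eq_zero_of_evalAt fun v ε hε => ?_
  let T : D.Crossing → D.Crossing → ℂ := fun c c' =>
    if v c = true ∧ ε c.lowerLeft = ε c.upperRight then
      D.edgeSign (Function.update v c false) c * saddleFactor (Function.update v c false) c ε *
      (if Function.update v c false c' = true ∧ ε c'.lowerLeft = ε c'.upperRight then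
        D.edgeSign (Function.update (Function.update v c false) c' false) c' *
          saddleFactor (Function.update (Function.update v c false) c' false) c' ε *
          evalAt (Function.update (Function.update v c false) c' false) ε x else 0) else 0
  have hT : evalAt v ε (D.leeDifferential (D.leeDifferential x)) = ∑ c, ∑ c', T c c' := by
    rw [evalAt_leeDifferential hε]
    refine Finset.sum_congr rfl fun c _ => ?_
    simp only [T]
    split_ifs with h
    · rw [evalAt_leeDifferential (hε.update_false h.1 h.2), Finset.mul_sum]
    · simp
  have hanti : ∀ c c', T c c' = - T c' c := by
    intro c c'
    by_cases hcc : c = c'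
    · subst hcc; simp [T]
    · simp only [T, Function.update_of_ne hcc, Function.update_of_ne (Ne.symm hcc)]
      by_cases h1 : v c = true ∧ ε c.lowerLeft = ε c.upperRight
      · by_cases h2 : v c' = true ∧ ε c'.lowerLeft = ε c'.upperRight
        · rw [if_pos h1, if_pos h2, if_pos h1, if_pos h2]
          have hv1 : Function.update v c false c' = true := by
            rw [Function.update_of_ne (Ne.symm hcc), h2.1]
          have hv2 : Function.update v c' false c = true := by
            rw [Function.update_of_ne hcc, h1.1]
          have k1 := saddleFactor_mul_colourWeight hε h1.1 h1.2
          have k2 := saddleFactor_mul_colourWeight hε h2.1 h2.2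
          have k3 := saddleFactor_mul_colourWeight (hε.update_false h1.1 h1.2) hv1 h2.2
          have k4 := saddleFactor_mul_colourWeight (hε.update_false h2.1 h2.2) hv2 h1.2
          rw [edgeSign_update hv1, edgeSign_update hv2, edgeSign_update h1.1, edgeSign_update h1.1,
            edgeSign_update h2.1, edgeSign_update h2.1]
          have hcomm : Function.update (Function.update v c' false) c false =
              Function.update (Function.update v c false) c' false :=
            Function.update_comm (Ne.symm hcc) _ _ _
          rw [hcomm] at k4 ⊢
          have hne := colourWeight_ne_zero (Function.update (Function.update v c false) c' false) ε
          generalize colourWeight (Function.update (Function.update v c false) c' false) ε = g at *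
          -- After multiplication by the nonzero weight at the start of the square, both sides
          -- become the weight at its end times the two colour roots.
          have k5 : saddleFactor (Function.update v c false) c ε *
              saddleFactor (Function.update (Function.update v c false) c' false) c' ε =
              saddleFactor (Function.update v c' false) c' ε *
              saddleFactor (Function.update (Function.update v c false) c' false) c ε := by
            refine mul_right_cancel₀ hne ?_
            rw [mul_assoc, k3, mul_assoc, k4, ← mul_assoc, ← mul_assoc, k1, k2]
            ring
          have h3 : c.time ≠ c'.time := fun h => hcc (Crossing.ext_time h)
          rcases lt_or_gt_of_ne h3 with h3 | h3
          · simp only [h3, lt_irrefl, not_lt.2 h3.le, if_true, if_false]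
            linear_combination (-1) * D.edgeSign v c * D.edgeSign v c' *
              evalAt (Function.update (Function.update v c false) c' false) ε x * k5
          · simp only [h3, lt_irrefl, not_lt.2 h3.le, if_true, if_false]
            linear_combination D.edgeSign v c * D.edgeSign v c' *
              evalAt (Function.update (Function.update v c false) c' false) ε x * k5
        · simp only [if_neg h2]; simp
      · simp only [if_neg h1]; simp
  rw [hT]
  have h1 : ∑ c, ∑ c', T c c' = - ∑ c, ∑ c', T c c' := by
    conv_lhs => rw [Finset.sum_comm]
    rw [← Finset.sum_neg_distrib]
    refine Finset.sum_congr rfl fun c _ => ?_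
    rw [← Finset.sum_neg_distrib]
    exact Finset.sum_congr rfl fun c' _ => hanti c' c
  exact self_eq_neg.1 h1

/-! ### Colour chains -/

open Classical in
/-- The chain over the resolution `v` whose circles are labelled by `𝐚 = v₋ + v₊` where `ε` is true
and by `𝐛 = v₋ - v₊` where it is false. -/
noncomputable def colourChain (v : D.Resolution) (ε : D.Point → Bool) : D.LeeChain := fun S =>
  if S.1 = v then ∏ C : D.Circle S.1, if ε C.out = false ∧ S.2 C = true then -1 else 1 else 0

theorem evalAt_colourChain (v : D.Resolution) (ε ε' : D.Point → Bool) :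
    evalAt v ε' (colourChain v ε) = ∏ C : D.Circle v,
      ∑ b, labelValue b (ε' C.out) * (if ε C.out = false ∧ b = true then -1 else 1) := by
  classical
  have := Finset.prod_univ_sum (fun _ : D.Circle v => (Finset.univ : Finset Bool))
    (fun C b => labelValue b (ε' C.out) * (if ε C.out = false ∧ b = true then -1 else 1))
  rw [Fintype.piFinset_univ] at this
  rw [this, evalAt]
  symm
  refine Fintype.sum_of_injective (fun l => (⟨v, l⟩ : D.EnhancedState)) ?_ _ _ ?_ ?_
  · intro l l' h
    simpa using h
  · rintro ⟨v', l⟩ h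
    by_cases hv : v' = v
    · subst hv
      exact absurd ⟨l, rfl⟩ h
    · simp [evalFun, hv]
  · intro l
    rw [evalFun, if_pos rfl, colourChain, if_pos rfl, stateValue, ← Finset.prod_mul_distrib]

theorem evalAt_colourChain_self_ne_zero (v : D.Resolution) (ε : D.Point → Bool) :
    evalAt v ε (colourChain v ε) ≠ 0 := by
  rw [evalAt_colourChain]
  refine Finset.prod_ne_zero_iff.2 fun C _ => ?_
  rw [Fintype.sum_bool]
  cases ε C.out <;> norm_num [labelValue]

/-- The factor of the circle through `x` is `X + 1` at `X = -1` or `X - 1` at `X = 1`. So colour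
chains are, up to scalars, the delta functions of colourings. -/
theorem evalAt_colourChain_of_ne {v : D.Resolution} {ε ε' : D.Point → Bool} (hε : Compatible v ε)
    (hε' : Compatible v ε') {x : D.Point} (hx : ε x ≠ ε' x) :
    evalAt v ε' (colourChain v ε) = 0 := by
  rw [evalAt_colourChain]
  refine Finset.prod_eq_zero (Finset.mem_univ (D.circleOf v x)) ?_
  rw [hε.out, hε'.out, Fintype.sum_bool]
  revert hx
  cases ε x <;> cases ε' x <;> simp [labelValue]

theorem evalAt_colourChain_of_resolution_ne {v v' : D.Resolution} {ε ε' : D.Point → Bool}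
    (hv : v' ≠ v) : evalAt v' ε' (colourChain v ε) = 0 := by
  refine Finset.sum_eq_zero fun S _ => ?_
  simp only [evalFun, colourChain]
  split_ifs with h1 h2
  · exact absurd (h1.symm.trans h2) hv
  all_goals simp

/-- The two arcs at each crossing have different colours. -/
def Separating (ε : D.Point → Bool) : Prop :=
  ∀ c : D.Crossing, ε c.lowerLeft ≠ ε c.upperRight

/-- The differential at a colouring only involves crossings whose two arcs have equal colours, while
this chain is a multiple of a delta function at a colouring with no such crossing. -/
theorem leeDifferential_colourChain {v : D.Resolution} {ε : D.Point → Bool} (hε : Compatible v ε)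
    (hs : Separating ε) : D.leeDifferential (colourChain v ε) = 0 := by
  classical
  refine eq_zero_of_evalAt fun v' ε' hε' => ?_
  rw [evalAt_leeDifferential hε']
  refine Finset.sum_eq_zero fun c _ => ?_
  split_ifs with h
  · by_cases hv : Function.update v' c false = v
    · have h1 := hε'.update_false h.1 h.2
      rw [hv] at h1 ⊢
      by_cases h2 : ∃ x, ε x ≠ ε' x
      · obtain ⟨x, hx⟩ := h2
        rw [evalAt_colourChain_of_ne hε h1 hx, mul_zero]
      · push Not at h2
        exact absurd (by rw [h2, h2]; exact h.2) (hs c)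
    · rw [evalAt_colourChain_of_resolution_ne hv, mul_zero]
  · rfl

/-- No crossing contributes, so this evaluation is a functional on chains that vanishes on
boundaries; it detects the homology class of the colour chain. -/
theorem evalAt_leeDifferential_of_separating {v : D.Resolution} {ε : D.Point → Bool}
    (hε : Compatible v ε) (hs : Separating ε) (x : D.LeeChain) :
    evalAt v ε (D.leeDifferential x) = 0 := by
  classical
  rw [evalAt_leeDifferential hε]
  exact Finset.sum_eq_zero fun c _ => if_neg fun h => hs c h.2

end OrientedAnnularDiagram

/-! ### Orientations and the canonical colouring -/

namespace AnnularEvent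

theorem getElem?_apply_birth {l : List Bool} {i : ℕ} (b : Bool) (hi : i ≤ l.length) (p : ℕ) :
    ((birth i b).apply l)[p]? = if p < i then l[p]? else if p = i then some b
      else if p = i + 1 then some (!b) else l[p - 2]? := by
  simp only [apply]
  grind

theorem getElem?_apply_death {l : List Bool} {i : ℕ} (hi : i + 1 < l.length) (p : ℕ) :
    ((death i).apply l)[p]? = if p < i then l[p]? else l[p + 2]? := by
  simp only [apply]
  grind

theorem getElem?_apply_cross {l : List Bool} {i : ℕ} (s : Bool) (hi : i + 1 < l.length) (p : ℕ) :
    ((cross i s).apply l)[p]? = if p = i then l[i + 1]? else if p = i + 1 then l[i]? else l[p]? := by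
  obtain ⟨a, x, y, b, rfl, rfl⟩ : ∃ a x y b, l = a ++ x :: y :: b ∧ i = a.length := by
    refine ⟨l.take i, l[i], l[i + 1], l.drop (i + 2), ?_, ?_⟩
    · rw [← List.drop_eq_getElem_cons (by omega), ← List.drop_eq_getElem_cons (by omega),
        List.take_append_drop]
    · rw [List.length_take]; omega
  have h : (cross a.length s).apply (a ++ x :: y :: b) = a ++ y :: x :: b := by
    simp [apply, List.drop_append]
  rw [h]
  rcases lt_or_ge p a.length with hp | hp
  · rw [if_neg (by omega), if_neg (by omega), List.getElem?_append_left hp,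
      List.getElem?_append_left hp]
  · obtain ⟨q, rfl⟩ := Nat.exists_eq_add_of_le hp
    rw [List.getElem?_append_right hp, List.getElem?_append_right hp,
      List.getElem?_append_right (by omega), List.getElem?_append_right (by omega)]
    rcases q with _ | _ | q <;> simp

end AnnularEvent

theorem Nat.odd_iff_bodd {n : ℕ} : Odd n ↔ n.bodd = true := by
  rw [Nat.odd_iff, Nat.mod_two_of_bodd]
  cases n.bodd <;> simp

namespace OrientedAnnularDiagram

open AnnularEvent

variable {D : OrientedAnnularDiagram}

theorem Point.getElem?_coord (x : D.Point) : (D.level x.coord.1)[x.coord.2]? = some x.dir := by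
  rw [List.getElem?_eq_getElem x.inRange.2]
  rfl

theorem level_succ_of_getElem? {h : ℕ} {e : AnnularEvent} (he : D.word[h]? = some e) :
    D.level (h + 1) = e.apply (D.level h) ∧ e.Valid (D.level h) := by
  obtain ⟨hh, rfl⟩ := List.getElem?_eq_some_iff.1 he
  exact ⟨D.level_succ h hh, D.valid h hh⟩

theorem getElem?_level_birth {h i : ℕ} {b : Bool} (he : D.word[h]? = some (birth i b)) (p : ℕ) :
    (D.level (h + 1))[p]? = if p < i then (D.level h)[p]? else if p = i then some b
      else if p = i + 1 then some (!b) else (D.level h)[p - 2]? := by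
  obtain ⟨h1, h2⟩ := level_succ_of_getElem? he
  rw [h1, getElem?_apply_birth b h2]

theorem getElem?_level_death {h i : ℕ} (he : D.word[h]? = some (death i)) (p : ℕ) :
    (D.level (h + 1))[p]? = if p < i then (D.level h)[p]? else (D.level h)[p + 2]? := by
  obtain ⟨h1, h2⟩ := level_succ_of_getElem? he
  rw [h1, getElem?_apply_death ((length_apply h2).2.1 i rfl).2]

theorem getElem?_level_cross (c : D.Crossing) (p : ℕ) :
    (D.level (c.time + 1))[p]? = if p = c.pos then (D.level c.time)[c.pos + 1]?
      else if p = c.pos + 1 then (D.level c.time)[c.pos]? else (D.level c.time)[p]? := by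
  obtain ⟨h1, h2⟩ := level_succ_of_getElem? c.word_time?
  rw [h1, getElem?_apply_cross _ ((length_apply h2).2.2 _ _ rfl).2]

/-- Each event changes the number of strands by `0` or `±2`. -/
theorem bodd_length_level (h : ℕ) (hh : h ≤ D.word.length) :
    (D.level h).length.bodd = D.start.length.bodd := by
  induction h with
  | zero => rw [D.level_zero]
  | succ h ih =>
    rw [← ih (by omega)]
    obtain ⟨h4, h5⟩ := level_succ_of_getElem? (List.getElem?_eq_getElem (l := D.word) hh)
    obtain ⟨h1, h2, h3⟩ := length_apply h5
    rw [h4]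
    cases he : D.word[h] with
    | birth i b =>
      have h6 := (h1 i b he).1
      rw [he] at h6
      rw [h6, Nat.bodd_succ, Nat.bodd_succ, Bool.not_not]
    | death i =>
      have h6 := (h2 i he).1
      rw [he] at h6
      rw [← h6, Nat.bodd_succ, Nat.bodd_succ, Bool.not_not]
    | cross i s =>
      have h6 := (h3 i s he).1
      rw [he] at h6
      rw [h6]

theorem Crossing.dir_lowerLeft (c : D.Crossing) :
    (D.level c.time)[c.pos]? = some c.lowerLeft.dir := c.lowerLeft.getElem?_coord

theorem Crossing.dir_lowerRight (c : D.Crossing) :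
    (D.level c.time)[c.pos + 1]? = some c.lowerRight.dir := c.lowerRight.getElem?_coord

theorem Crossing.dir_upperRight (c : D.Crossing) : c.upperRight.dir = c.lowerLeft.dir := by
  have h1 : (D.level (c.time + 1))[c.pos + 1]? = some c.upperRight.dir :=
    c.upperRight.getElem?_coord
  rw [getElem?_level_cross] at h1
  simpa [c.dir_lowerLeft] using h1.symm

/-- The left side says that the oriented smoothing is vertical, which is the smoothing compatible
with parallel strands. -/
theorem orientedResolution_ne_iff (c : D.Crossing) :
    D.orientedResolution c ≠ c.risingOver ↔ c.lowerLeft.dir = c.lowerRight.dir := by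
  simp only [orientedResolution, Crossing.Positive]
  by_cases h : c.lowerLeft.dir = c.lowerRight.dir <;>
    rcases Bool.eq_false_or_eq_true c.risingOver with hr | hr <;> simp [h, hr]

/-- In the oriented resolution a passing strand keeps its direction and the parity of its position,
while a turn joins adjacent positions of opposite directions. -/
theorem Arc.bodd_xor_dir {x y : ℕ × ℕ} (h : D.Arc D.orientedResolution x y) {b b' : Bool}
    (hx : (D.level x.1)[x.2]? = some b) (hy : (D.level y.1)[y.2]? = some b') :
    (x.2.bodd ^^ b) = (y.2.bodd ^^ b') := by
  cases h with
  | close p =>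
    simp only [D.level_length, D.level_zero] at hx hy
    rw [hx] at hy
    simp only [Option.some.injEq] at hy
    simp [hy]
  | birth h i b e =>
    simp only [getElem?_level_birth e] at hx hy
    simp at hx hy
    subst hx hy
    simp
  | birth_left h i p b e hp =>
    simp only [getElem?_level_birth e, hp, if_true] at hx hy
    rw [hx] at hy
    simp_all
  | birth_right h i p b e hp =>
    simp only [getElem?_level_birth e] at hx hy
    rw [if_neg (by omega), if_neg (by omega), if_neg (by omega), Nat.add_sub_cancel, hx] at hy
    simp_all
  | death h i e =>
    obtain ⟨-, c, h1, h2⟩ := level_succ_of_getElem? e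
    simp only at hx hy
    rw [h1] at hx
    rw [h2] at hy
    simp at hx hy
    subst hx hy
    simp
  | death_left h i p e hp =>
    simp only [getElem?_level_death e, hp, if_true] at hx hy
    rw [hx] at hy
    simp_all
  | death_right h i p e hp =>
    simp only [getElem?_level_death e] at hx hy
    rw [if_neg (by omega), hx] at hy
    simp_all
  | cross_other c p hp hp' =>
    simp only [getElem?_level_cross, hp, hp', if_false] at hx hy
    rw [hx] at hy
    simp_all
  | vertical_left c hc =>
    rw [orientedResolution_ne_iff] at hc
    simp only [getElem?_level_cross, if_true, c.dir_lowerLeft, c.dir_lowerRight] at hx hy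
    simp_all
  | vertical_right c hc =>
    rw [orientedResolution_ne_iff] at hc
    simp only [getElem?_level_cross, c.dir_lowerLeft, c.dir_lowerRight] at hx hy
    simp_all
  | horizontal_bottom c hc =>
    replace hc := fun h => (orientedResolution_ne_iff c).2 h hc
    simp only [c.dir_lowerLeft, c.dir_lowerRight, Option.some.injEq] at hx hy
    subst hx hy
    simp only [Nat.bodd_succ]
    revert hc
    cases c.lowerLeft.dir <;> cases c.lowerRight.dir <;> simp
  | horizontal_top c hc =>
    replace hc := fun h => (orientedResolution_ne_iff c).2 h hc
    simp only [getElem?_level_cross, c.dir_lowerLeft, c.dir_lowerRight] at hx hy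
    simp at hx hy
    subst hx hy
    simp only [Nat.bodd_succ]
    revert hc
    cases c.lowerLeft.dir <;> cases c.lowerRight.dir <;> simp

/-- The number of strands further out is the length of the level minus position minus one, and the
parity of the length is the same at all levels. So the index depends only on the parity of the
position and on the direction, up to a global constant. -/
theorem Point.bodd_leeIndex (x : D.Point) :
    x.leeIndex.bodd = !(D.start.length.bodd ^^ (x.coord.2.bodd ^^ x.dir)) := by
  have h1 := x.inRange.2
  have h2 := bodd_length_level x.coord.1 x.inRange.1
  have h3 : (D.level x.coord.1).length =
      ((D.level x.coord.1).length - 1 - x.coord.2) + x.coord.2 + 1 := by omega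
  have h4 : x.leeIndex = ((D.level x.coord.1).length - 1 - x.coord.2) + (if x.dir then 1 else 0) :=
    rfl
  rw [h4]
  rw [h3, Nat.bodd_succ, Nat.bodd_add] at h2
  rw [Nat.bodd_add, ← h2]
  generalize ((D.level x.coord.1).length - 1 - x.coord.2).bodd = a
  generalize x.coord.2.bodd = b
  cases a <;> cases b <;> cases x.dir <;> simp

variable (D) in
/-- The colouring of the points that belongs to the canonical Lee cycle. -/
def leeColour (x : D.Point) : Bool := !x.leeIndex.bodd

theorem compatible_leeColour : Compatible D.orientedResolution D.leeColour := by
  intro x y h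
  change Relation.EqvGen _ x y at h
  induction h with
  | rel x y h =>
    have := h.bodd_xor_dir x.getElem?_coord y.getElem?_coord
    simp only [leeColour, Point.bodd_leeIndex, this]
  | refl x => rfl
  | symm x y _ ih => exact ih.symm
  | trans x y z _ _ ih ih' => exact ih.trans ih'

/-- The rising strand runs from the lower left to the upper right end: the direction is the same and
the position differs by one. -/
theorem separating_leeColour : Separating D.leeColour := by
  intro c
  simp only [leeColour, Point.bodd_leeIndex, c.dir_upperRight, c.coord_lowerLeft,
    c.coord_upperRight, Nat.bodd_succ]
  cases D.start.length.bodd <;> cases c.pos.bodd <;> cases c.lowerLeft.dir <;> simp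

theorem isB_iff (C : D.Circle D.orientedResolution) :
    D.IsB D.orientedResolution C ↔ D.leeColour C.out = false := by
  constructor
  · rintro ⟨x, rfl, h⟩
    rw [compatible_leeColour.out, leeColour, Nat.odd_iff_bodd.1 h]
    rfl
  · intro h
    refine ⟨C.out, Quotient.out_eq C, Nat.odd_iff_bodd.2 ?_⟩
    simpa [leeColour] using h

theorem canonicalCycle_eq : D.canonicalCycle = colourChain D.orientedResolution D.leeColour := by
  classical
  funext S
  obtain ⟨v, l⟩ := S
  simp only [canonicalCycle, colourChain]
  split_ifs with h
  · subst h
    refine Finset.prod_congr rfl fun C _ => ?_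
    simp only [isB_iff]
  · rfl

end OrientedAnnularDiagram

/-! ### The level of a homology class in a filtered complex -/

/-- The class of `s` in the homology of `d` has filtration level `a` with respect to the grading `j`
of the basis: it is represented by a cycle in level `a`, and some functional detects the class and
vanishes on all higher levels. -/
def AttainsLevel {ι : Type*} [Fintype ι] (d : (ι → ℂ) →ₗ[ℂ] (ι → ℂ)) (j : ι → ℝ) (s : ι → ℂ)
    (a : ℝ) : Prop :=
  (∃ x, d x = 0 ∧ x - s ∈ LinearMap.range d ∧ ∀ i, x i ≠ 0 → a ≤ j i) ∧
    ∃ f : ι → ℂ, (∀ i, f i ≠ 0 → j i ≤ a) ∧ (∀ z, ∑ i, f i * d z i = 0) ∧ ∑ i, f i * s i ≠ 0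

namespace AttainsLevel

variable {ι : Type*} [Fintype ι] {d : (ι → ℂ) →ₗ[ℂ] (ι → ℂ)} {j : ι → ℝ} {s : ι → ℂ} {a : ℝ}

/-- The best level of a representative is a maximum over the finitely many values of `j`. By
maximality `s` is not a sum of a boundary and a chain of higher level, so a linear functional
separates it from all such sums. -/
theorem exists_of_notMem_range (hd : ∀ x, d (d x) = 0) (hs : d s = 0)
    (hr : s ∉ LinearMap.range d) (j : ι → ℝ) : ∃ a, AttainsLevel d j s a := by
  classical
  let A : Finset ℝ := (Finset.univ.image j).filter fun a =>
    ∃ x, x - s ∈ LinearMap.range d ∧ ∀ i, x i ≠ 0 → a ≤ j i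
  have hmem : ∀ x, x - s ∈ LinearMap.range d → ∃ i, x i ≠ 0 ∧ j i ∈ A ∧ ∀ i', x i' ≠ 0 → j i ≤ j i' := by
    intro x hx
    have hne : (Finset.univ.filter fun i => x i ≠ 0).Nonempty := by
      by_contra hcon
      rw [Finset.not_nonempty_iff_eq_empty, Finset.filter_eq_empty_iff] at hcon
      have h0 : x = 0 := funext fun i => not_not.1 (hcon (Finset.mem_univ i))
      rw [h0, zero_sub] at hx
      exact hr (by simpa using neg_mem hx)
    obtain ⟨i, hi, hmin⟩ := Finset.exists_min_image _ j hne
    simp only [Finset.mem_filter, Finset.mem_univ, true_and] at hi hmin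
    refine ⟨i, hi, ?_, hmin⟩
    simp only [A, Finset.mem_filter, Finset.mem_image, Finset.mem_univ, true_and]
    exact ⟨⟨i, rfl⟩, x, hx, hmin⟩
  have hA : A.Nonempty := by
    obtain ⟨i, -, h, -⟩ := hmem s (by simp)
    exact ⟨_, h⟩
  have hmax := A.max'_mem hA
  refine ⟨A.max' hA, ?_, ?_⟩
  · obtain ⟨-, x, hx, hx'⟩ := Finset.mem_filter.1 hmax
    refine ⟨x, ?_, hx, hx'⟩
    obtain ⟨z, hz⟩ := hx
    rw [show x = s + d z by rw [hz]; abel, map_add, hs, hd, add_zero]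
  · let N : Submodule ℂ (ι → ℂ) :=
      { carrier := {x | ∀ i, x i ≠ 0 → A.max' hA < j i}
        add_mem' := by
          intro x y hx hy i hi
          by_cases h : x i = 0
          · exact hy i (fun h' => hi (by simp [h, h']))
          · exact hx i h
        zero_mem' := fun i hi => absurd rfl hi
        smul_mem' := by
          intro c x hx i hi
          exact hx i (fun h => hi (by simp [h])) }
    -- Otherwise the summand in `N` would represent the class of `s` and lie in a level above the
    -- maximum.
    have hnot : s ∉ N ⊔ LinearMap.range d := by
      intro h
      obtain ⟨y, hy, z, hz, hyz⟩ := Submodule.mem_sup.1 h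
      obtain ⟨i, hi, hiA, -⟩ := hmem y (by
        rw [← hyz, sub_add_cancel_left]; exact neg_mem hz)
      exact absurd (A.le_max' _ hiA) (not_le.2 (hy i hi))
    obtain ⟨φ, hφ, hker⟩ := Submodule.exists_le_ker_of_notMem hnot
    have hsum : ∀ x : ι → ℂ, φ x = ∑ i, φ (Pi.single i 1) * x i := by
      intro x
      conv_lhs => rw [pi_eq_sum_univ' x, map_sum]
      exact Finset.sum_congr rfl fun i _ => by rw [map_smul, smul_eq_mul, mul_comm]
    refine ⟨fun i => φ (Pi.single i 1), ?_, ?_, ?_⟩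
    · intro i hi
      by_contra hcon
      refine hi (hker (Submodule.mem_sup_left ?_))
      intro i' hi'
      by_cases h : i' = i
      · rw [h]; exact not_le.1 hcon
      · simp [h] at hi'
    · intro z
      rw [← hsum]
      exact hker (Submodule.mem_sup_right ⟨z, rfl⟩)
    · rw [← hsum]; exact hφ

theorem smul (h : AttainsLevel d j s a) {c : ℂ} (hc : c ≠ 0) : AttainsLevel d j (c • s) a := by
  obtain ⟨⟨x, h1, h2, h3⟩, f, h4, h5, h6⟩ := h
  refine ⟨⟨c • x, by rw [map_smul, h1, smul_zero], ?_, ?_⟩, f, h4, h5, ?_⟩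
  · rw [← smul_sub]; exact Submodule.smul_mem _ _ h2
  · exact fun i hi => h3 i (fun h => hi (by simp [h]))
  · have : ∑ i, f i * (c • s) i = c * ∑ i, f i * s i := by
      rw [Finset.mul_sum]
      exact Finset.sum_congr rfl fun i _ => by rw [Pi.smul_apply, smul_eq_mul]; ring
    rw [this]
    exact mul_ne_zero hc h6

/-- A diagonal automorphism preserves supports, hence every filtration step for every grading; the
functional is rescaled by the inverse entries. -/
theorem diagonal (h : AttainsLevel d j s a) {θ : ι → ℂ} (hθ : ∀ i, θ i ≠ 0)
    (hd : ∀ x, d (fun i => θ i * x i) = fun i => θ i * d x i) :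
    AttainsLevel d j (fun i => θ i * s i) a := by
  obtain ⟨⟨x, h1, ⟨z, h2⟩, h3⟩, f, h4, h5, h6⟩ := h
  refine ⟨⟨fun i => θ i * x i, ?_, ⟨fun i => θ i * z i, ?_⟩, ?_⟩, fun i => (θ i)⁻¹ * f i, ?_, ?_, ?_⟩
  · rw [hd, h1]; funext i; simp
  · rw [hd, h2]; funext i; simp [mul_sub]
  · exact fun i hi => h3 i (right_ne_zero_of_mul hi)
  · exact fun i hi => h4 i (right_ne_zero_of_mul hi)
  · intro z
    rw [← h5 (fun i => (θ i)⁻¹ * z i)]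
    have h7 := hd (fun i => (θ i)⁻¹ * z i)
    simp only [mul_inv_cancel_left₀ (hθ _)] at h7
    rw [h7]
    refine Finset.sum_congr rfl fun i _ => ?_
    have := hθ i
    field_simp
  · convert h6 using 2 with i
    have := hθ i
    field_simp

end AttainsLevel

/-! ### The filtration and the level of the canonical class -/

namespace OrientedAnnularDiagram

variable {D : OrientedAnnularDiagram}

theorem mem_filtration {t s : ℝ} {x : D.LeeChain} :
    x ∈ D.filtration t s ↔ ∀ S, x S ≠ 0 → s ≤ D.jtGrading t S := by
  classical
  constructor
  · intro h
    refine Submodule.span_induction (p := fun x _ => ∀ S, x S ≠ 0 → s ≤ D.jtGrading t S)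
      ?_ ?_ ?_ ?_ h
    · rintro _ ⟨S, hS, rfl⟩ S' hS'
      by_cases h : S' = S
      · rwa [h]
      · simp [h] at hS'
    · exact fun S hS => absurd rfl hS
    · intro x y _ _ hx hy S hS
      by_cases h : x S = 0
      · exact hy S (fun h' => hS (by simp [h, h']))
      · exact hx S h
    · exact fun c x _ hx S hS => hx S (fun h => hS (by simp [h]))
  · intro h
    rw [pi_eq_sum_univ' x]
    refine Submodule.sum_mem _ fun S _ => ?_
    by_cases hS : x S = 0
    · rw [hS, zero_smul]; exact Submodule.zero_mem _
    · refine Submodule.smul_mem _ _ (Submodule.subset_span ⟨S, h S hS, ?_⟩)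
      funext S'
      by_cases h : S' = S
      · subst h; simp
      · simp [h]

theorem le_gr {t a : ℝ} {x : D.LeeChain} (hx : x ≠ 0) (h : ∀ S, x S ≠ 0 → a ≤ D.jtGrading t S) :
    a ≤ D.gr t x := by
  obtain ⟨S, hS⟩ := Function.ne_iff.1 hx
  -- A nonzero coordinate bounds the levels of `x`. For `x = 0` every level occurs and the supremum
  -- would be a default value.
  exact le_csSup ⟨D.jtGrading t S, fun s hs => mem_filtration.1 hs S hS⟩ (mem_filtration.2 h)

theorem gr_le {t : ℝ} {x : D.LeeChain} {S : D.EnhancedState} (hS : x S ≠ 0) :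
    D.gr t x ≤ D.jtGrading t S := by
  obtain ⟨m, hm⟩ := (Set.finite_range (D.jtGrading t)).bddBelow
  exact csSup_le ⟨m, mem_filtration.2 fun S _ => hm ⟨S, rfl⟩⟩ fun s hs => mem_filtration.1 hs S hS

/-- The functional takes the same nonzero value on all representatives, so each has a nonzero
coordinate in its support, where the grading is at most `a`. -/
theorem AttainsLevel.isGreatest_classGradings {t a : ℝ}
    (h : AttainsLevel D.leeDifferential (D.jtGrading t) D.canonicalCycle a) :
    IsGreatest (D.classGradings t) a := by
  obtain ⟨⟨x, h1, h2, h3⟩, f, h4, h5, h6⟩ := h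
  have key : ∀ y : D.LeeChain, y - D.canonicalCycle ∈ LinearMap.range D.leeDifferential →
      ∃ S, y S ≠ 0 ∧ D.jtGrading t S ≤ a := by
    rintro y ⟨z, hz⟩
    have h7 : ∑ S, f S * y S ≠ 0 := by
      have : ∑ S, f S * y S = ∑ S, f S * D.canonicalCycle S := by
        have h8 := h5 z
        rw [hz] at h8
        simp only [Pi.sub_apply, mul_sub, Finset.sum_sub_distrib] at h8
        exact sub_eq_zero.1 h8
      rwa [this]
    obtain ⟨S, -, hS⟩ := Finset.exists_ne_zero_of_sum_ne_zero h7
    exact ⟨S, right_ne_zero_of_mul hS, h4 S (left_ne_zero_of_mul hS)⟩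
  have hle : ∀ y : D.LeeChain, y - D.canonicalCycle ∈ LinearMap.range D.leeDifferential →
      D.gr t y ≤ a := by
    intro y hy
    obtain ⟨S, hS, hSa⟩ := key y hy
    exact (gr_le hS).trans hSa
  constructor
  · refine ⟨x, h1, h2, le_antisymm (le_gr ?_ h3) (hle x h2)⟩
    rintro rfl
    obtain ⟨S, hS, -⟩ := key 0 h2
    exact hS rfl
  · rintro r ⟨y, -, hy, rfl⟩
    exact hle y hy

theorem AttainsLevel.annularRasmussen_eq {t a : ℝ}
    (h : AttainsLevel D.leeDifferential (D.jtGrading t) D.canonicalCycle a) :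
    D.annularRasmussen t = a :=
  (AttainsLevel.isGreatest_classGradings h).csSup_eq

theorem colourChain_notMem_range {v : D.Resolution} {ε : D.Point → Bool}
    (hε : Compatible v ε) (hs : Separating ε) :
    colourChain v ε ∉ LinearMap.range D.leeDifferential := by
  rintro ⟨z, hz⟩
  apply evalAt_colourChain_self_ne_zero v ε
  rw [← hz]
  exact evalAt_leeDifferential_of_separating hε hs z

variable (D) in
theorem attainsLevel_canonicalCycle (t : ℝ) :
    AttainsLevel D.leeDifferential (D.jtGrading t) D.canonicalCycle (D.annularRasmussen t) := by
  obtain ⟨a, ha⟩ := AttainsLevel.exists_of_notMem_range leeDifferential_leeDifferential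
    (leeDifferential_colourChain compatible_leeColour separating_leeColour)
    (colourChain_notMem_range compatible_leeColour separating_leeColour) (D.jtGrading t)
  rw [← canonicalCycle_eq] at ha
  rwa [AttainsLevel.annularRasmussen_eq ha]

/-! ### Exchanging the two colours -/

/-- The number of `1`-smoothings. -/
noncomputable def height (S : D.EnhancedState) : ℕ := Nat.card {c : D.Crossing // S.1 c = true}

theorem IsEdge.height_eq {c : D.Crossing} {S T : D.EnhancedState} (h : D.IsEdge c S T) :
    height T = height S + 1 := by
  have h1 : {c' : D.Crossing | T.1 c' = true} = insert c {c' | S.1 c' = true} := by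
    ext c'
    rw [Set.mem_ofPred_eq, Set.mem_insert_iff, Set.mem_ofPred_eq]
    by_cases hc : c' = c
    · simp [hc, h.2.1]
    · simp [hc, h.2.2.1 c' hc]
  have h2 : c ∉ {c' : D.Crossing | S.1 c' = true} := by simp [h.1]
  change Nat.card ({c' : D.Crossing | T.1 c' = true} : Set D.Crossing) =
    Nat.card ({c' : D.Crossing | S.1 c' = true} : Set D.Crossing) + 1
  rw [Nat.card_coe_set_eq, Nat.card_coe_set_eq, h1, Set.ncard_insert_of_notMem h2]

/-- The quantum grading as a power of the imaginary unit, up to a constant. -/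
noncomputable def phase (S : D.EnhancedState) : ℂ :=
  (∏ C : D.Circle S.1, if S.2 C then Complex.I else -Complex.I) * Complex.I ^ height S

theorem phase_ne_zero (S : D.EnhancedState) : phase S ≠ 0 := by
  refine mul_ne_zero (Finset.prod_ne_zero_iff.2 fun C _ => ?_) (pow_ne_zero _ Complex.I_ne_zero)
  split_ifs <;> simp

/-- Each nonzero term of Lee's maps changes `j` by `0` or `4`, and `I ^ 4 = 1`. -/
theorem IsEdge.phase_eq {c : D.Crossing} {S T : D.EnhancedState} (h : D.IsEdge c S T)
    (hST : D.saddleCoeff c S T ≠ 0) : phase T = phase S := by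
  have h1 : ∀ c', c' ≠ c → T.1 c' = S.1 c' := h.2.2.1
  have h2 : T.1 c ≠ S.1 c := by rw [h.1, h.2.1]; simp
  have hI := Complex.I_mul_I
  -- Modulo 4, the total degree of the labels drops by one; the new `1`-smoothing compensates for
  -- it.
  have h3 : ∏ C, (if S.2 C then Complex.I else -Complex.I) =
      Complex.I * ∏ C, (if T.2 C then Complex.I else -Complex.I) := by
    by_cases hr : D.circleSetoid S.1 c.lowerLeft c.upperRight
    · have hm := circleSetoid_merges_of_rel h1 h2 hr
      have h4 := hm.prod_mul_eq (fun C => if T.2 C then Complex.I else -Complex.I)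
        (fun C => if S.2 C then Complex.I else -Complex.I) (by
          intro x h5 h6
          have h7 : ¬ D.circleSetoid S.1 x c.lowerLeft := fun h8 =>
            ((hm.rel_left_iff x).1 h8).elim h5 h6
          have h8 := h.2.2.2 x (fun h9 => h7 (circleOf_eq_iff.1 h9))
            (fun h9 => h7 ((D.circleSetoid S.1).trans (circleOf_eq_iff.1 h9)
              ((D.circleSetoid S.1).symm hr)))
          simp only [circleOf] at h8
          rw [h8])
      rw [saddleCoeff, if_neg (not_not.2 (circleOf_eq_iff.2 hr))] at hST
      simp only [circleOf] at hST
      generalize (∏ C, if S.2 C then Complex.I else -Complex.I) = a at *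
      generalize (∏ C, if T.2 C then Complex.I else -Complex.I) = b at *
      generalize S.2 _ = x at *
      generalize T.2 _ = y at *
      generalize T.2 _ = z at *
      revert hST
      cases x <;> cases y <;> cases z <;> simp [leeComul] at h4 ⊢
      all_goals linear_combination (-1) * h4
    · have hm := circleSetoid_merges_of_not h1 h2 hr
      have h4 := hm.prod_mul_eq (fun C => if S.2 C then Complex.I else -Complex.I)
        (fun C => if T.2 C then Complex.I else -Complex.I) (by
          intro x h5 h6
          have h8 := h.2.2.2 x (fun h9 => h5 (circleOf_eq_iff.1 h9))
            (fun h9 => h6 (circleOf_eq_iff.1 h9))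
          simp only [circleOf] at h8
          rw [h8])
      rw [saddleCoeff, if_pos (fun h => hr (circleOf_eq_iff.1 h))] at hST
      simp only [circleOf] at hST
      generalize (∏ C, if S.2 C then Complex.I else -Complex.I) = a at *
      generalize (∏ C, if T.2 C then Complex.I else -Complex.I) = b at *
      generalize S.2 _ = x at *
      generalize S.2 _ = y at *
      generalize T.2 _ = z at *
      revert hST
      cases x <;> cases y <;> cases z <;> simp [leeMul] at h4 ⊢
      · linear_combination (-Complex.I) * h4 + a * hI
      · linear_combination (Complex.I) * h4 + a * hI
      · linear_combination (Complex.I) * h4 + a * hI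
      · linear_combination (-Complex.I) * h4 + a * hI
  rw [phase, phase, h3, h.height_eq, pow_succ]
  ring

theorem leeDifferential_phase_mul (x : D.LeeChain) :
    D.leeDifferential (fun S => phase S * x S) = fun S => phase S * D.leeDifferential x S := by
  classical
  funext T
  rw [leeDifferential_apply, leeDifferential_apply, Finset.mul_sum]
  refine Finset.sum_congr rfl fun S _ => ?_
  by_cases h : D.leeCoeff S T = 0
  · simp [h]
  · obtain ⟨c, -, hc⟩ := Finset.exists_ne_zero_of_sum_ne_zero h
    have h1 : D.IsEdge c S T := by
      by_contra h1
      exact hc (if_neg h1)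
    rw [if_pos h1] at hc
    rw [h1.phase_eq (right_ne_zero_of_mul hc)]
    ring

/-- On each circle the phase sends `v₊` to `I v₊` and `v₋` to `-I v₋`, hence `v₋ + v₊` to `-I (v₋ -
v₊)` and vice versa. The factors `-I`, together with the phase of the `1`-smoothings, make up the
constant. -/
theorem colourChain_not (v : D.Resolution) (ε : D.Point → Bool) :
    ∃ c : ℂ, c ≠ 0 ∧
      colourChain v (fun x => !ε x) = c • fun S => phase S * colourChain v ε S := by
  classical
  let c : ℂ := (∏ _C : D.Circle v, -Complex.I) *
    Complex.I ^ Nat.card {c : D.Crossing // v c = true}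
  have hc : c ≠ 0 := by
    refine mul_ne_zero (Finset.prod_ne_zero_iff.2 fun C _ => ?_) (pow_ne_zero _ Complex.I_ne_zero)
    simp
  refine ⟨c⁻¹, inv_ne_zero hc, ?_⟩
  funext ⟨v', l⟩
  rw [Pi.smul_apply, smul_eq_mul, eq_inv_mul_iff_mul_eq₀ hc]
  simp only [colourChain]
  split_ifs with hv
  · subst hv
    simp only [c, phase, height]
    have h1 : ∀ C : D.Circle v', -Complex.I * (if (!ε C.out) = false ∧ l C = true then -1 else 1) =
        (if l C then Complex.I else -Complex.I) * (if ε C.out = false ∧ l C = true then -1 else 1) := by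
      intro C
      cases ε C.out <;> cases l C <;> simp
    have h2 := Finset.prod_congr rfl (fun C (_ : C ∈ Finset.univ) => h1 C)
    rw [Finset.prod_mul_distrib, Finset.prod_mul_distrib] at h2
    linear_combination Complex.I ^ Nat.card {c : D.Crossing // v' c = true} * h2
  · simp

variable (D) in
theorem attainsLevel_colourChain_not (t : ℝ) :
    AttainsLevel D.leeDifferential (D.jtGrading t)
      (colourChain D.orientedResolution fun x => !D.leeColour x) (D.annularRasmussen t) := by
  obtain ⟨c, hc, h⟩ := colourChain_not D.orientedResolution D.leeColour
  rw [h, ← canonicalCycle_eq]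
  exact ((D.attainsLevel_canonicalCycle t).diagonal phase_ne_zero leeDifferential_phase_mul).smul hc

end OrientedAnnularDiagram

namespace OrientedAnnularDiagram

open AnnularEvent

/-! ### Points and crossings of an annular composition -/

section Composition

variable (D D' : OrientedAnnularDiagram)

theorem length_annularComp :
    (D.annularComp D').word.length = D'.word.length + D.word.length := by
  change (compWord D D').length = _
  simp [compWord]

theorem level_annularComp_inner {h : ℕ} (hh : h ≤ D'.word.length) :
    (D.annularComp D').level h = D'.level h ++ D.start := levelAt_comp_left D D' h hh

theorem level_annularComp_outer {h : ℕ} (hh : h ≤ D.word.length) :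
    (D.annularComp D').level (D'.word.length + h) = D'.start ++ D.level h :=
  levelAt_comp_right D D' h hh

theorem word_annularComp_inner {h : ℕ} (hh : h < D'.word.length) :
    (D.annularComp D').word[h]? = D'.word[h]? := by
  change (compWord D D')[h]? = _
  rw [compWord, List.getElem?_append_left hh]

theorem word_annularComp_outer (h : ℕ) :
    (D.annularComp D').word[D'.word.length + h]? =
      D.word[h]?.map (AnnularEvent.shift D'.start.length) := by
  change (compWord D D')[D'.word.length + h]? = _
  rw [compWord, List.getElem?_append_right (by omega), Nat.add_sub_cancel_left, List.getElem?_map]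

variable {D} in
/-- A point of the outer diagram as a point of the annular composition. -/
def outerPoint (x : D.Point) : (D.annularComp D').Point :=
  pointOf (x := (D'.word.length + x.coord.1, D'.start.length + x.coord.2)) (by
    have h1 := x.inRange
    refine ⟨?_, ?_⟩
    · rw [length_annularComp]; exact Nat.add_le_add_left h1.1 _
    · simp only [level_annularComp_outer D D' h1.1, List.length_append]
      exact Nat.add_lt_add_left h1.2 _)

variable {D'} in
/-- A point of the inner diagram as a point of the annular composition. -/
def innerPoint (x : D'.Point) : (D.annularComp D').Point :=
  pointOf (x := x.coord) (by
    have h1 := x.inRange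
    refine ⟨?_, ?_⟩
    · rw [length_annularComp]; exact h1.1.trans (Nat.le_add_right _ _)
    · rw [level_annularComp_inner D D' h1.1, List.length_append]
      exact h1.2.trans_le (Nat.le_add_right _ _))

@[simp] theorem coord_outerPoint (x : D.Point) : (outerPoint D' x).coord =
    (D'.word.length + x.coord.1, D'.start.length + x.coord.2) := rfl

@[simp] theorem coord_innerPoint (x : D'.Point) : (innerPoint D x).coord = x.coord := rfl

variable {D} in
theorem exists_outerCrossing (c : D.Crossing) : ∃ c' : (D.annularComp D').Crossing,
    c'.time = D'.word.length + c.time ∧ c'.pos = D'.start.length + c.pos ∧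
      c'.risingOver = c.risingOver := by
  have h := word_annularComp_outer D D' c.time
  rw [c.word_time?] at h
  obtain ⟨hh, h⟩ := List.getElem?_eq_some_iff.1 h
  exact exists_crossing hh h

variable {D'} in
theorem exists_innerCrossing (c : D'.Crossing) : ∃ c' : (D.annularComp D').Crossing,
    c'.time = c.time ∧ c'.pos = c.pos ∧ c'.risingOver = c.risingOver := by
  have h := word_annularComp_inner D D' c.time_lt
  rw [c.word_time?] at h
  obtain ⟨hh, h⟩ := List.getElem?_eq_some_iff.1 h
  exact exists_crossing hh h

variable {D} in
/-- A crossing of the outer diagram as a crossing of the annular composition. -/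
noncomputable def outerCrossing (c : D.Crossing) : (D.annularComp D').Crossing :=
  (exists_outerCrossing D' c).choose

variable {D'} in
/-- A crossing of the inner diagram as a crossing of the annular composition. -/
noncomputable def innerCrossing (c : D'.Crossing) : (D.annularComp D').Crossing :=
  (exists_innerCrossing D c).choose

@[simp] theorem time_outerCrossing (c : D.Crossing) :
    (outerCrossing D' c).time = D'.word.length + c.time := (exists_outerCrossing D' c).choose_spec.1

@[simp] theorem pos_outerCrossing (c : D.Crossing) :
    (outerCrossing D' c).pos = D'.start.length + c.pos := (exists_outerCrossing D' c).choose_spec.2.1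

@[simp] theorem risingOver_outerCrossing (c : D.Crossing) :
    (outerCrossing D' c).risingOver = c.risingOver := (exists_outerCrossing D' c).choose_spec.2.2

@[simp] theorem time_innerCrossing (c : D'.Crossing) :
    (innerCrossing D c).time = c.time := (exists_innerCrossing D c).choose_spec.1

@[simp] theorem pos_innerCrossing (c : D'.Crossing) :
    (innerCrossing D c).pos = c.pos := (exists_innerCrossing D c).choose_spec.2.1

@[simp] theorem risingOver_innerCrossing (c : D'.Crossing) :
    (innerCrossing D c).risingOver = c.risingOver := (exists_innerCrossing D c).choose_spec.2.2

theorem lowerLeft_outerCrossing (c : D.Crossing) :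
    (outerCrossing D' c).lowerLeft = outerPoint D' c.lowerLeft :=
  Point.coord_injective _ (by simp [Crossing.coord_lowerLeft])

theorem upperRight_outerCrossing (c : D.Crossing) :
    (outerCrossing D' c).upperRight = outerPoint D' c.upperRight :=
  Point.coord_injective _ (by simp [Crossing.coord_upperRight, add_assoc])

theorem lowerRight_outerCrossing (c : D.Crossing) :
    (outerCrossing D' c).lowerRight = outerPoint D' c.lowerRight :=
  Point.coord_injective _ (by
    change ((outerCrossing D' c).time, (outerCrossing D' c).pos + 1) =
      (D'.word.length + c.time, D'.start.length + (c.pos + 1))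
    simp [add_assoc])

theorem lowerLeft_innerCrossing (c : D'.Crossing) :
    (innerCrossing D c).lowerLeft = innerPoint D c.lowerLeft :=
  Point.coord_injective _ (by simp [Crossing.coord_lowerLeft])

theorem upperRight_innerCrossing (c : D'.Crossing) :
    (innerCrossing D c).upperRight = innerPoint D c.upperRight :=
  Point.coord_injective _ (by simp [Crossing.coord_upperRight])

theorem lowerRight_innerCrossing (c : D'.Crossing) :
    (innerCrossing D c).lowerRight = innerPoint D c.lowerRight :=
  Point.coord_injective _ (by
    change ((innerCrossing D c).time, (innerCrossing D c).pos + 1) = (c.time, c.pos + 1)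
    simp)

variable {D D'} in
theorem shift_eq_cross {m : ℕ} {e : AnnularEvent} {i : ℕ} {s : Bool}
    (h : e.shift m = cross i s) : ∃ i', e = cross i' s := by
  cases e with
  | birth => cases h
  | death => cases h
  | cross i' s' => cases h; exact ⟨i', rfl⟩

theorem crossing_cases (c : (D.annularComp D').Crossing) :
    (∃ c', c = outerCrossing D' c') ∨ ∃ c', c = innerCrossing D c' := by
  have h := c.word_time?
  by_cases hh : c.time < D'.word.length
  · right
    rw [word_annularComp_inner D D' hh] at h
    obtain ⟨_, h⟩ := List.getElem?_eq_some_iff.1 h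
    obtain ⟨c', h1, -, -⟩ := exists_crossing hh h
    exact ⟨c', Crossing.ext_time (by rw [time_innerCrossing, h1])⟩
  · left
    obtain ⟨k, hk⟩ := Nat.exists_eq_add_of_le (not_lt.1 hh)
    rw [hk, word_annularComp_outer, Option.map_eq_some_iff] at h
    obtain ⟨e, he, h⟩ := h
    obtain ⟨i, rfl⟩ := shift_eq_cross h
    obtain ⟨hk', he⟩ := List.getElem?_eq_some_iff.1 he
    obtain ⟨c', h1, -, -⟩ := exists_crossing hk' he
    exact ⟨c', Crossing.ext_time (by rw [time_outerCrossing, h1, hk])⟩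

variable {D D'}

/-- The restriction of a resolution to the outer diagram. -/
noncomputable def outerResolution (v : (D.annularComp D').Resolution) : D.Resolution :=
  fun c => v (outerCrossing D' c)

/-- The restriction of a resolution to the inner diagram. -/
noncomputable def innerResolution (v : (D.annularComp D').Resolution) : D'.Resolution :=
  fun c => v (innerCrossing D c)

variable (v : (D.annularComp D').Resolution)

/-! The arcs of the two diagrams are arcs of the composition. -/

theorem Arc.outer {x y : ℕ × ℕ} (h : D.Arc (outerResolution v) x y) :
    (D.annularComp D').Arc v (D'.word.length + x.1, D'.start.length + x.2)
      (D'.word.length + y.1, D'.start.length + y.2) ∨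
    ∃ p, x = (D.word.length, p) ∧ y = (0, p) := by
  have hw : ∀ {h : ℕ} {e}, D.word[h]? = some e →
      (D.annularComp D').word[D'.word.length + h]? = some (e.shift D'.start.length) := by
    intro h e he
    rw [word_annularComp_outer, he]; rfl
  cases h with
  | close p => exact Or.inr ⟨p, rfl, rfl⟩
  | birth h i b e => exact Or.inl (Arc.birth _ _ b (hw e))
  | birth_left h i p b e hp => exact Or.inl (Arc.birth_left _ _ _ b (hw e) (by omega))
  | birth_right h i p b e hp => exact Or.inl (Arc.birth_right _ _ _ b (hw e) (by omega))
  | death h i e => exact Or.inl (Arc.death _ _ (hw e))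
  | death_left h i p e hp => exact Or.inl (Arc.death_left _ _ _ (hw e) (by omega))
  | death_right h i p e hp => exact Or.inl (Arc.death_right _ _ _ (hw e)
      (show D'.start.length + i ≤ D'.start.length + p by omega))
  | cross_other c p hp hp' =>
    have := Arc.cross_other (v := v) (outerCrossing D' c) (D'.start.length + p)
      (by simpa using hp) (by simp; omega)
    left; simpa [add_assoc] using this
  | vertical_left c hc =>
    have := Arc.vertical_left (v := v) (outerCrossing D' c) (by simpa [outerResolution] using hc)
    left; simpa [add_assoc] using this
  | vertical_right c hc =>
    have := Arc.vertical_right (v := v) (outerCrossing D' c) (by simpa [outerResolution] using hc)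
    left; simpa [add_assoc] using this
  | horizontal_bottom c hc =>
    have := Arc.horizontal_bottom (v := v) (outerCrossing D' c) (by simpa [outerResolution] using hc)
    left; simpa [add_assoc] using this
  | horizontal_top c hc =>
    have := Arc.horizontal_top (v := v) (outerCrossing D' c) (by simpa [outerResolution] using hc)
    left; simpa [add_assoc] using this

theorem Arc.inner {x y : ℕ × ℕ} (h : D'.Arc (innerResolution v) x y) :
    (D.annularComp D').Arc v x y ∨ ∃ p, x = (D'.word.length, p) ∧ y = (0, p) := by
  have hw : ∀ {h : ℕ} {e}, D'.word[h]? = some e → (D.annularComp D').word[h]? = some e := by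
    intro h e he
    rwa [word_annularComp_inner _ _ (List.getElem?_eq_some_iff.1 he).1]
  cases h with
  | close p => exact Or.inr ⟨p, rfl, rfl⟩
  | birth h i b e => exact Or.inl (Arc.birth _ _ b (hw e))
  | birth_left h i p b e hp => exact Or.inl (Arc.birth_left _ _ _ b (hw e) hp)
  | birth_right h i p b e hp => exact Or.inl (Arc.birth_right _ _ _ b (hw e) hp)
  | death h i e => exact Or.inl (Arc.death _ _ (hw e))
  | death_left h i p e hp => exact Or.inl (Arc.death_left _ _ _ (hw e) hp)
  | death_right h i p e hp => exact Or.inl (Arc.death_right _ _ _ (hw e) hp)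
  | cross_other c p hp hp' =>
    have := Arc.cross_other (v := v) (innerCrossing D c) p (by simpa using hp) (by simpa using hp')
    left; simpa using this
  | vertical_left c hc =>
    have := Arc.vertical_left (v := v) (innerCrossing D c) (by simpa [innerResolution] using hc)
    left; simpa using this
  | vertical_right c hc =>
    have := Arc.vertical_right (v := v) (innerCrossing D c) (by simpa [innerResolution] using hc)
    left; simpa using this
  | horizontal_bottom c hc =>
    have := Arc.horizontal_bottom (v := v) (innerCrossing D c) (by simpa [innerResolution] using hc)
    left; simpa using this
  | horizontal_top c hc =>
    have := Arc.horizontal_top (v := v) (innerCrossing D c) (by simpa [innerResolution] using hc)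
    left; simpa using this

/-- The strands of the inner diagram pass below the events of the outer one. -/
theorem arc_inner_strand {h p : ℕ} (hh : h < D.word.length) (hp : p < D'.start.length) :
    (D.annularComp D').Arc v (D'.word.length + h, p) (D'.word.length + (h + 1), p) := by
  have he := List.getElem?_eq_getElem hh
  have hw := word_annularComp_outer D D' h
  rw [he] at hw
  change _ = some (AnnularEvent.shift _ _) at hw
  cases hc : D.word[h] with
  | birth i b =>
    rw [hc] at hw
    exact Arc.birth_left _ _ _ b hw (by omega)
  | death i =>
    rw [hc] at hw
    exact Arc.death_left _ _ _ hw (by omega)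
  | cross i s =>
    obtain ⟨c, h1, -, -⟩ := exists_crossing hh hc
    have := Arc.cross_other (v := v) (outerCrossing D' c) p (by simp; omega) (by simp; omega)
    simpa [h1, add_assoc] using this

/-- The strands of the outer diagram pass above the events of the inner one. -/
theorem arc_outer_strand {h q : ℕ} (hh : h < D'.word.length) :
    (D.annularComp D').Arc v (h, (D'.level h).length + q) (h + 1, (D'.level (h + 1)).length + q) := by
  have he := List.getElem?_eq_getElem hh
  have hw := word_annularComp_inner D D' hh
  rw [he] at hw
  obtain ⟨h4, h5⟩ := level_succ_of_getElem? he
  obtain ⟨h1, h2, h3⟩ := length_apply h5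
  cases hc : D'.word[h] with
  | birth i b =>
    rw [hc] at hw
    obtain ⟨h6, h7⟩ := h1 i b hc
    have := Arc.birth_right (v := v) h i ((D'.level h).length + q) b hw (by omega)
    rw [h4, h6]
    convert this using 2
    omega
  | death i =>
    rw [hc] at hw
    obtain ⟨h6, h7⟩ := h2 i hc
    have := Arc.death_right (v := v) h i ((D'.level (h + 1)).length + q) hw (by rw [h4]; omega)
    rw [← h4] at h6
    convert this using 2
    omega
  | cross i s =>
    obtain ⟨h6, h7⟩ := h3 i s hc
    obtain ⟨c, h8, h9, -⟩ := exists_crossing hh hc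
    have := Arc.cross_other (v := v) (innerCrossing D c) ((D'.level h).length + q)
      (by simp; omega) (by simp; omega)
    rw [h4, h6]
    simpa [h8] using this

theorem rel_inner_strand {p : ℕ} (hp : p < D'.start.length) {h : ℕ} (hh : h ≤ D.word.length)
    {x y : (D.annularComp D').Point} (hx : x.coord = (D'.word.length, p))
    (hy : y.coord = (D'.word.length + h, p)) : (D.annularComp D').circleSetoid v x y := by
  induction h generalizing y with
  | zero =>
    obtain rfl : x = y := Point.coord_injective _ (by rw [hx, hy]; rfl)
    exact Setoid.refl' _ _
  | succ h ih =>
    have hr : (D.annularComp D').InRange (D'.word.length + h, p) := by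
      refine ⟨by rw [length_annularComp]; simp only; omega, ?_⟩
      simp only [level_annularComp_outer D D' (show h ≤ D.word.length by omega),
        List.length_append]
      omega
    refine Setoid.trans' _ (ih (by omega) (coord_pointOf hr)) (Relation.EqvGen.rel _ _ ?_)
    rw [coord_pointOf, hy]
    exact arc_inner_strand v hh hp

theorem rel_outer_strand {q : ℕ} (hq : q < D.start.length) {h : ℕ} (hh : h ≤ D'.word.length)
    {x y : (D.annularComp D').Point} (hx : x.coord = (D'.word.length, D'.start.length + q))
    (hy : y.coord = (h, (D'.level h).length + q)) : (D.annularComp D').circleSetoid v y x := by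
  induction hh using Nat.decreasingInduction generalizing y with
  -- The induction runs downwards from the last inner level, where the outer strands are in their
  -- positions in `D`.
  | self =>
    obtain rfl : y = x := Point.coord_injective _ (by rw [hx, hy, D'.level_length])
    exact Setoid.refl' _ _
  | of_succ h hh ih =>
    have hr : (D.annularComp D').InRange (h + 1, (D'.level (h + 1)).length + q) := by
      refine ⟨by rw [length_annularComp]; simp only; omega, ?_⟩
      simp only [level_annularComp_inner D D' (show h + 1 ≤ D'.word.length by omega),
        List.length_append]
      omega
    refine Setoid.trans' _ (Relation.EqvGen.rel _ _ ?_) (ih (coord_pointOf hr))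
    rw [coord_pointOf, hy]
    exact arc_outer_strand v hh

/-- Only the closing arc of the outer diagram is not an arc of the composition: it becomes the
closing arc there followed by a straight strand past all inner events. -/
theorem rel_outerPoint {x y : D.Point} (h : D.circleSetoid (outerResolution v) x y) :
    (D.annularComp D').circleSetoid v (outerPoint D' x) (outerPoint D' y) := by
  change Relation.EqvGen _ x y at h
  induction h with
  | rel x y h =>
    rcases Arc.outer v h with h | ⟨p, hx, hy⟩
    · exact Relation.EqvGen.rel _ _ h
    · have hp : p < D.start.length := by
        have := y.inRange.2
        rw [hy, D.level_zero] at this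
        exact this
      have hr : (D.annularComp D').InRange (0, D'.start.length + p) := by
        refine ⟨Nat.zero_le _, ?_⟩
        simp only [level_annularComp_inner D D' (Nat.zero_le _), D'.level_zero, List.length_append]
        omega
      refine Setoid.trans' _ (Relation.EqvGen.rel _ _ ?_)
        (rel_outer_strand v hp (Nat.zero_le _) (y := pointOf hr) ?_ ?_)
      · rw [coord_outerPoint, hx, coord_pointOf]
        have := Arc.close (D := D.annularComp D') (v := v) (D'.start.length + p)
        rwa [length_annularComp] at this
      · rw [coord_outerPoint, hy, Nat.add_zero]
      · rw [coord_pointOf, D'.level_zero]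
  | refl x => exact Setoid.refl' _ _
  | symm x y _ ih => exact Setoid.symm' _ ih
  | trans x y z _ _ ih ih' => exact Setoid.trans' _ ih ih'

/-- Here the closing arc becomes a straight strand past all outer events followed by the closing arc
of the composition. -/
theorem rel_innerPoint {x y : D'.Point} (h : D'.circleSetoid (innerResolution v) x y) :
    (D.annularComp D').circleSetoid v (innerPoint D x) (innerPoint D y) := by
  change Relation.EqvGen _ x y at h
  induction h with
  | rel x y h =>
    rcases Arc.inner v h with h | ⟨p, hx, hy⟩
    · exact Relation.EqvGen.rel _ _ h
    · have hp : p < D'.start.length := by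
        have := y.inRange.2
        rw [hy, D'.level_zero] at this
        exact this
      have hr : (D.annularComp D').InRange (D'.word.length + D.word.length, p) := by
        refine ⟨by rw [length_annularComp], ?_⟩
        simp only [level_annularComp_outer D D' le_rfl, List.length_append]
        omega
      refine Setoid.trans' _ (rel_inner_strand v hp le_rfl (y := pointOf hr) ?_ ?_)
        (Relation.EqvGen.rel _ _ ?_)
      · rw [coord_innerPoint, hx]
      · rw [coord_pointOf]
      · rw [coord_innerPoint, hy, coord_pointOf]
        have := Arc.close (D := D.annularComp D') (v := v) p
        rwa [length_annularComp] at this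
  | refl x => exact Setoid.refl' _ _
  | symm x y _ ih => exact Setoid.symm' _ ih
  | trans x y z _ _ ih ih' => exact Setoid.trans' _ ih ih'

end Composition

end OrientedAnnularDiagram

namespace OrientedAnnularDiagram

open AnnularEvent

section Composition

variable {D D' : OrientedAnnularDiagram}

/-! ### Circles of an annular composition -/

variable (D') in
/-- The diagram and the coordinates to which a point of the annular composition of a diagram with
the inner diagram `D'` contracts. -/
def contract (x : ℕ × ℕ) : (ℕ × ℕ) ⊕ (ℕ × ℕ) :=
  if x.2 < (D'.level (min x.1 D'.word.length)).length then
    Sum.inr (min x.1 D'.word.length, x.2)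
  -- Truncated subtraction sends outer strands to level `0` of `D` during all inner events; the
  -- minimum keeps inner strands at the last level of `D'` during outer events.
  else Sum.inl (x.1 - D'.word.length, x.2 - (D'.level (min x.1 D'.word.length)).length)

theorem contract_inner {h p : ℕ} (hh : h ≤ D'.word.length) (hp : p < (D'.level h).length) :
    D'.contract (h, p) = Sum.inr (h, p) := by
  simp [contract, min_eq_left hh, hp]

theorem contract_outer_strand {h : ℕ} (hh : h ≤ D'.word.length) (q : ℕ) :
    D'.contract (h, (D'.level h).length + q) = Sum.inl (0, q) := by
  simp [contract, min_eq_left hh, Nat.sub_eq_zero_of_le hh]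

theorem contract_inner_strand {h p : ℕ} (hh : D'.word.length ≤ h) (hp : p < D'.start.length) :
    D'.contract (h, p) = Sum.inr (D'.word.length, p) := by
  simp [contract, D'.level_length, hp, min_eq_right hh]

theorem contract_outer {h p k q : ℕ} (hh : h = D'.word.length + k)
    (hp : p = D'.start.length + q) : D'.contract (h, p) = Sum.inl (k, q) := by
  subst hh hp
  simp [contract, D'.level_length]

/-- Two positions in the disjoint union of the diagrams coincide or are joined by an arc. -/
def SumArc (v : (D.annularComp D').Resolution) : (ℕ × ℕ) ⊕ (ℕ × ℕ) → (ℕ × ℕ) ⊕ (ℕ × ℕ) → Prop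
  | Sum.inl x, Sum.inl y => x = y ∨ D.Arc (outerResolution v) x y
  | Sum.inr x, Sum.inr y => x = y ∨ D'.Arc (innerResolution v) x y
  | _, _ => False

variable {v : (D.annularComp D').Resolution}

theorem SumArc.of_inner {x y : ℕ × ℕ} (h : D'.Arc (innerResolution v) x y)
    {h1 p1 h2 p2 : ℕ} (hx : D'.contract (h1, p1) = Sum.inr x) (hy : D'.contract (h2, p2) = Sum.inr y) :
    SumArc v (D'.contract (h1, p1)) (D'.contract (h2, p2)) := by
  rw [hx, hy]; exact Or.inr h

theorem SumArc.of_outer {x y : ℕ × ℕ} (h : D.Arc (outerResolution v) x y)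
    {h1 p1 h2 p2 : ℕ} (hx : D'.contract (h1, p1) = Sum.inl x) (hy : D'.contract (h2, p2) = Sum.inl y) :
    SumArc v (D'.contract (h1, p1)) (D'.contract (h2, p2)) := by
  rw [hx, hy]; exact Or.inr h

theorem SumArc.of_eq {x : (ℕ × ℕ) ⊕ (ℕ × ℕ)}
    {h1 p1 h2 p2 : ℕ} (hx : D'.contract (h1, p1) = x) (hy : D'.contract (h2, p2) = x) :
    SumArc v (D'.contract (h1, p1)) (D'.contract (h2, p2)) := by
  rw [hx, hy]
  cases x
  exacts [Or.inl rfl, Or.inl rfl]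

variable (D D') in
theorem event_cases {h : ℕ} {e : AnnularEvent} (he : (D.annularComp D').word[h]? = some e) :
    (h < D'.word.length ∧ D'.word[h]? = some e) ∨
      ∃ k e', h = D'.word.length + k ∧ D.word[k]? = some e' ∧ e = e'.shift D'.start.length := by
  by_cases hh : h < D'.word.length
  · left
    rw [word_annularComp_inner _ _ hh] at he
    exact ⟨hh, he⟩
  · right
    obtain ⟨k, rfl⟩ := Nat.exists_eq_add_of_le (not_lt.1 hh)
    rw [word_annularComp_outer, Option.map_eq_some_iff] at he
    obtain ⟨e', h1, h2⟩ := he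
    exact ⟨k, e', rfl, h1, h2.symm⟩

theorem length_level_birth {h i : ℕ} {b : Bool} (he : D.word[h]? = some (birth i b)) :
    (D.level (h + 1)).length = (D.level h).length + 2 ∧ i ≤ (D.level h).length := by
  obtain ⟨h4, h5⟩ := level_succ_of_getElem? he
  rw [h4]
  exact (length_apply h5).1 i b rfl

theorem length_level_death {h i : ℕ} (he : D.word[h]? = some (death i)) :
    (D.level (h + 1)).length + 2 = (D.level h).length ∧ i + 1 < (D.level h).length := by
  obtain ⟨h4, h5⟩ := level_succ_of_getElem? he
  rw [h4]
  exact (length_apply h5).2.1 i rfl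

theorem length_level_cross (c : D.Crossing) :
    (D.level (c.time + 1)).length = (D.level c.time).length ∧
      c.pos + 1 < (D.level c.time).length := by
  obtain ⟨h4, h5⟩ := level_succ_of_getElem? c.word_time?
  rw [h4]
  exact (length_apply h5).2.2 _ _ rfl

/-- An arc of the composition either comes from an arc of one diagram or is a piece of a strand
passing through the other diagram, which the contraction collapses to a point. -/
theorem Arc.contract {x y : ℕ × ℕ} (h : (D.annularComp D').Arc v x y) :
    SumArc v (D'.contract x) (D'.contract y) := by
  cases h with
  | close p =>
    rw [length_annularComp]
    by_cases hp : p < D'.start.length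
    · exact SumArc.of_inner (Arc.close p) (contract_inner_strand (by omega) hp)
        (contract_inner (Nat.zero_le _) (by rwa [D'.level_zero]))
    · obtain ⟨q, rfl⟩ := Nat.exists_eq_add_of_le (not_lt.1 hp)
      refine SumArc.of_outer (Arc.close q) (contract_outer (by omega) (by omega)) ?_
      have := contract_outer_strand (D' := D') (Nat.zero_le _) q
      rwa [D'.level_zero] at this
  | birth h i b e =>
    rcases event_cases D D' e with ⟨hh, he⟩ | ⟨k, e', rfl, he, h2⟩
    · obtain ⟨h3, h4⟩ := length_level_birth he
      exact SumArc.of_inner (Arc.birth h i b he) (contract_inner hh (by omega))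
        (contract_inner hh (by omega))
    · cases e' <;> cases h2
      exact SumArc.of_outer (Arc.birth k _ b he)
        (contract_outer (by omega) (by omega)) (contract_outer (by omega) (by omega))
  | birth_left h i p b e hp =>
    rcases event_cases D D' e with ⟨hh, he⟩ | ⟨k, e', rfl, he, h2⟩
    · obtain ⟨h3, h4⟩ := length_level_birth he
      exact SumArc.of_inner (Arc.birth_left h i p b he hp) (contract_inner hh.le (by omega))
        (contract_inner hh (by omega))
    · cases e' <;> cases h2
      by_cases hp' : p < D'.start.length
      · exact SumArc.of_eq
          (contract_inner_strand (by omega) hp') (contract_inner_strand (by omega) hp')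
      · obtain ⟨q, rfl⟩ := Nat.exists_eq_add_of_le (not_lt.1 hp')
        exact SumArc.of_outer (Arc.birth_left k _ q b he (by omega))
          (contract_outer (by omega) (by omega))
          (contract_outer (by omega) (by omega))
  | birth_right h i p b e hp =>
    rcases event_cases D D' e with ⟨hh, he⟩ | ⟨k, e', rfl, he, h2⟩
    · obtain ⟨h3, h4⟩ := length_level_birth he
      by_cases hp' : p < (D'.level h).length
      · exact SumArc.of_inner (Arc.birth_right h i p b he hp) (contract_inner hh.le (by omega))
          (contract_inner hh (by omega))
      · obtain ⟨q, rfl⟩ := Nat.exists_eq_add_of_le (not_lt.1 hp')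
        refine SumArc.of_eq (contract_outer_strand hh.le q) ?_
        rw [show (D'.level h).length + q + 2 = (D'.level (h + 1)).length + q by omega]
        exact contract_outer_strand hh q
    · cases e' <;> cases h2
      obtain ⟨q, rfl⟩ := Nat.exists_eq_add_of_le ((Nat.le_add_right _ _).trans hp)
      exact SumArc.of_outer (Arc.birth_right k _ q b he (by omega))
        (contract_outer (by omega) (by omega))
          (contract_outer (by omega) (by omega))
  | death h i e =>
    rcases event_cases D D' e with ⟨hh, he⟩ | ⟨k, e', rfl, he, h2⟩
    · obtain ⟨h3, h4⟩ := length_level_death he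
      exact SumArc.of_inner (Arc.death h i he) (contract_inner hh.le (by omega))
        (contract_inner hh.le (by omega))
    · cases e' <;> cases h2
      exact SumArc.of_outer (Arc.death k _ he)
        (contract_outer (by omega) (by omega)) (contract_outer (by omega) (by omega))
  | death_left h i p e hp =>
    rcases event_cases D D' e with ⟨hh, he⟩ | ⟨k, e', rfl, he, h2⟩
    · obtain ⟨h3, h4⟩ := length_level_death he
      exact SumArc.of_inner (Arc.death_left h i p he hp) (contract_inner hh.le (by omega))
        (contract_inner hh (by omega))
    · cases e' <;> cases h2
      by_cases hp' : p < D'.start.length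
      · exact SumArc.of_eq
          (contract_inner_strand (by omega) hp') (contract_inner_strand (by omega) hp')
      · obtain ⟨q, rfl⟩ := Nat.exists_eq_add_of_le (not_lt.1 hp')
        exact SumArc.of_outer (Arc.death_left k _ q he (by omega))
          (contract_outer (by omega) (by omega))
          (contract_outer (by omega) (by omega))
  | death_right h i p e hp =>
    rcases event_cases D D' e with ⟨hh, he⟩ | ⟨k, e', rfl, he, h2⟩
    · obtain ⟨h3, h4⟩ := length_level_death he
      by_cases hp' : p < (D'.level (h + 1)).length
      · exact SumArc.of_inner (Arc.death_right h i p he hp) (contract_inner hh.le (by omega))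
          (contract_inner hh (by omega))
      · obtain ⟨q, rfl⟩ := Nat.exists_eq_add_of_le (not_lt.1 hp')
        refine SumArc.of_eq ?_ (contract_outer_strand hh q)
        rw [show (D'.level (h + 1)).length + q + 2 = (D'.level h).length + q by omega]
        exact contract_outer_strand hh.le q
    · cases e' <;> cases h2
      obtain ⟨q, rfl⟩ := Nat.exists_eq_add_of_le ((Nat.le_add_right _ _).trans hp)
      exact SumArc.of_outer (Arc.death_right k _ q he (by omega))
        (contract_outer (by omega) (by omega))
          (contract_outer (by omega) (by omega))
  | cross_other c p hp hp' =>
    rcases crossing_cases _ _ c with ⟨c, rfl⟩ | ⟨c, rfl⟩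
    · simp only [time_outerCrossing, pos_outerCrossing] at *
      by_cases hp' : p < D'.start.length
      · exact SumArc.of_eq
          (contract_inner_strand (by omega) hp') (contract_inner_strand (by omega) hp')
      · obtain ⟨q, rfl⟩ := Nat.exists_eq_add_of_le (not_lt.1 hp')
        exact SumArc.of_outer (Arc.cross_other c q (by omega) (by omega))
          (contract_outer (by omega) (by omega))
          (contract_outer (by omega) (by omega))
    · simp only [time_innerCrossing, pos_innerCrossing] at *
      obtain ⟨h3, h4⟩ := length_level_cross c
      have hh := c.time_lt
      by_cases hp'' : p < (D'.level c.time).length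
      · exact SumArc.of_inner (Arc.cross_other c p hp hp') (contract_inner hh.le (by omega))
          (contract_inner hh (by omega))
      · obtain ⟨q, rfl⟩ := Nat.exists_eq_add_of_le (not_lt.1 hp'')
        refine SumArc.of_eq (contract_outer_strand hh.le q) ?_
        rw [← h3]
        exact contract_outer_strand hh q
  | vertical_left c hc =>
    rcases crossing_cases _ _ c with ⟨c, rfl⟩ | ⟨c, rfl⟩
    · simp only [time_outerCrossing, pos_outerCrossing, risingOver_outerCrossing] at *
      exact SumArc.of_outer (Arc.vertical_left c hc)
        (contract_outer (by omega) (by omega)) (contract_outer (by omega) (by omega))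
    · simp only [time_innerCrossing, pos_innerCrossing, risingOver_innerCrossing] at *
      obtain ⟨h3, h4⟩ := length_level_cross c
      have hh := c.time_lt
      exact SumArc.of_inner (Arc.vertical_left c hc) (contract_inner hh.le (by omega))
          (contract_inner hh (by omega))
  | vertical_right c hc =>
    rcases crossing_cases _ _ c with ⟨c, rfl⟩ | ⟨c, rfl⟩
    · simp only [time_outerCrossing, pos_outerCrossing, risingOver_outerCrossing] at *
      exact SumArc.of_outer (Arc.vertical_right c hc)
        (contract_outer (by omega) (by omega)) (contract_outer (by omega) (by omega))
    · simp only [time_innerCrossing, pos_innerCrossing, risingOver_innerCrossing] at *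
      obtain ⟨h3, h4⟩ := length_level_cross c
      have hh := c.time_lt
      exact SumArc.of_inner (Arc.vertical_right c hc) (contract_inner hh.le (by omega))
          (contract_inner hh (by omega))
  | horizontal_bottom c hc =>
    rcases crossing_cases _ _ c with ⟨c, rfl⟩ | ⟨c, rfl⟩
    · simp only [time_outerCrossing, pos_outerCrossing, risingOver_outerCrossing] at *
      exact SumArc.of_outer (Arc.horizontal_bottom c hc)
        (contract_outer (by omega) (by omega)) (contract_outer (by omega) (by omega))
    · simp only [time_innerCrossing, pos_innerCrossing, risingOver_innerCrossing] at *
      obtain ⟨h3, h4⟩ := length_level_cross c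
      have hh := c.time_lt
      exact SumArc.of_inner (Arc.horizontal_bottom c hc) (contract_inner hh.le (by omega))
          (contract_inner hh.le (by omega))
  | horizontal_top c hc =>
    rcases crossing_cases _ _ c with ⟨c, rfl⟩ | ⟨c, rfl⟩
    · simp only [time_outerCrossing, pos_outerCrossing, risingOver_outerCrossing] at *
      exact SumArc.of_outer (Arc.horizontal_top c hc)
        (contract_outer (by omega) (by omega)) (contract_outer (by omega) (by omega))
    · simp only [time_innerCrossing, pos_innerCrossing, risingOver_innerCrossing] at *
      obtain ⟨h3, h4⟩ := length_level_cross c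
      have hh := c.time_lt
      exact SumArc.of_inner (Arc.horizontal_top c hc) (contract_inner hh (by omega))
          (contract_inner hh (by omega))

/-- Every point of the composition lies on a strand of one of the two diagrams. -/
theorem exists_strand (v : (D.annularComp D').Resolution) (z : (D.annularComp D').Point) :
    (∃ x : D.Point, D'.contract z.coord = Sum.inl x.coord ∧
      (D.annularComp D').circleSetoid v z (outerPoint D' x)) ∨
    ∃ y : D'.Point, D'.contract z.coord = Sum.inr y.coord ∧
      (D.annularComp D').circleSetoid v z (innerPoint D y) := by
  obtain ⟨⟨h, p⟩, hz⟩ : ∃ x, z.coord = x := ⟨_, rfl⟩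
  obtain ⟨h1, h2⟩ := z.inRange
  rw [hz] at h1 h2
  rw [length_annularComp] at h1
  simp only at h1 h2
  rcases le_total h D'.word.length with hh | hh
  · rw [level_annularComp_inner D D' hh, List.length_append] at h2
    by_cases hp : p < (D'.level h).length
    · right
      have hr : D'.InRange (h, p) := ⟨hh, hp⟩
      refine ⟨pointOf hr, by rw [hz, contract_inner hh hp, coord_pointOf], ?_⟩
      obtain rfl : z = innerPoint D (pointOf hr) :=
        Point.coord_injective _ (by rw [hz, coord_innerPoint, coord_pointOf])
      exact Setoid.refl' _ _
    · left
      obtain ⟨q, rfl⟩ := Nat.exists_eq_add_of_le (not_lt.1 hp)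
      have hq : q < D.start.length := by omega
      have hr : D.InRange (0, q) := ⟨Nat.zero_le _, by rwa [D.level_zero]⟩
      refine ⟨pointOf hr, by rw [hz, contract_outer_strand hh, coord_pointOf], ?_⟩
      exact rel_outer_strand v hq hh (by rw [coord_outerPoint, coord_pointOf, Nat.add_zero]) hz
  · obtain ⟨k, rfl⟩ := Nat.exists_eq_add_of_le hh
    have hk : k ≤ D.word.length := by omega
    rw [level_annularComp_outer D D' hk, List.length_append] at h2
    by_cases hp : p < D'.start.length
    · right
      have hr : D'.InRange (D'.word.length, p) := ⟨le_rfl, by rwa [D'.level_length]⟩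
      refine ⟨pointOf hr, by rw [hz, contract_inner_strand hh hp, coord_pointOf], ?_⟩
      exact Setoid.symm' _ (rel_inner_strand v hp hk (by rw [coord_innerPoint, coord_pointOf]) hz)
    · left
      obtain ⟨q, rfl⟩ := Nat.exists_eq_add_of_le (not_lt.1 hp)
      have hr : D.InRange (k, q) := ⟨hk, by simp only; omega⟩
      refine ⟨pointOf hr, by rw [hz, contract_outer rfl rfl, coord_pointOf], ?_⟩
      obtain rfl : z = outerPoint D' (pointOf hr) :=
        Point.coord_injective _ (by rw [hz, coord_outerPoint, coord_pointOf])
      exact Setoid.refl' _ _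

theorem contract_outerPoint (x : D.Point) :
    D'.contract (outerPoint D' x).coord = Sum.inl x.coord := contract_outer rfl rfl

theorem contract_innerPoint (x : D'.Point) :
    D'.contract (innerPoint D x).coord = Sum.inr x.coord :=
  contract_inner x.inRange.1 x.inRange.2

/-- Points on the same circle of the composition contract to points on the same circle. -/
theorem rel_contract {z w : (D.annularComp D').Point}
    (h : (D.annularComp D').circleSetoid v z w) :
    (∃ x y : D.Point, D'.contract z.coord = Sum.inl x.coord ∧ D'.contract w.coord = Sum.inl y.coord ∧
      D.circleSetoid (outerResolution v) x y) ∨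
    ∃ x y : D'.Point, D'.contract z.coord = Sum.inr x.coord ∧ D'.contract w.coord = Sum.inr y.coord ∧
      D'.circleSetoid (innerResolution v) x y := by
  change Relation.EqvGen _ z w at h
  induction h with
  | rel z w h =>
    have h' := h.contract
    rcases exists_strand v z with ⟨x, hx, -⟩ | ⟨x, hx, -⟩ <;>
      rcases exists_strand v w with ⟨y, hy, -⟩ | ⟨y, hy, -⟩ <;> rw [hx, hy] at h'
    · refine Or.inl ⟨x, y, hx, hy, ?_⟩
      rcases h' with h' | h'
      · rw [Point.coord_injective _ h']
      · exact Relation.EqvGen.rel _ _ h'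
    · exact h'.elim
    · exact h'.elim
    · refine Or.inr ⟨x, y, hx, hy, ?_⟩
      rcases h' with h' | h'
      · rw [Point.coord_injective _ h']
      · exact Relation.EqvGen.rel _ _ h'
  | refl z =>
    rcases exists_strand v z with ⟨x, hx, -⟩ | ⟨x, hx, -⟩
    · exact Or.inl ⟨x, x, hx, hx, Setoid.refl' _ _⟩
    · exact Or.inr ⟨x, x, hx, hx, Setoid.refl' _ _⟩
  | symm z w _ ih =>
    rcases ih with ⟨x, y, hx, hy, h⟩ | ⟨x, y, hx, hy, h⟩
    · exact Or.inl ⟨y, x, hy, hx, Setoid.symm' _ h⟩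
    · exact Or.inr ⟨y, x, hy, hx, Setoid.symm' _ h⟩
  | trans z w u _ _ ih ih' =>
    rcases ih with ⟨x, y, hx, hy, h⟩ | ⟨x, y, hx, hy, h⟩ <;>
      rcases ih' with ⟨x', y', hx', hy', h'⟩ | ⟨x', y', hx', hy', h'⟩ <;> rw [hy] at hx'
    · obtain rfl := Point.coord_injective _ (Sum.inl_injective hx')
      exact Or.inl ⟨x, y', hx, hy', Setoid.trans' _ h h'⟩
    · cases hx'
    · cases hx'
    · obtain rfl := Point.coord_injective _ (Sum.inr_injective hx')
      exact Or.inr ⟨x, y', hx, hy', Setoid.trans' _ h h'⟩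

theorem rel_outerPoint_iff {x y : D.Point} :
    (D.annularComp D').circleSetoid v (outerPoint D' x) (outerPoint D' y) ↔
      D.circleSetoid (outerResolution v) x y := by
  refine ⟨fun h => ?_, rel_outerPoint v⟩
  rcases rel_contract h with ⟨x', y', hx, hy, h⟩ | ⟨x', y', hx, hy, h⟩ <;>
    rw [contract_outerPoint] at hx hy
  · rwa [Point.coord_injective _ (Sum.inl_injective hx), Point.coord_injective _ (Sum.inl_injective hy)]
  · cases hx

theorem rel_innerPoint_iff {x y : D'.Point} :
    (D.annularComp D').circleSetoid v (innerPoint D x) (innerPoint D y) ↔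
      D'.circleSetoid (innerResolution v) x y := by
  refine ⟨fun h => ?_, rel_innerPoint v⟩
  rcases rel_contract h with ⟨x', y', hx, hy, h⟩ | ⟨x', y', hx, hy, h⟩ <;>
    rw [contract_innerPoint] at hx hy
  · cases hx
  · rwa [Point.coord_injective _ (Sum.inr_injective hx), Point.coord_injective _ (Sum.inr_injective hy)]

theorem not_rel_outerPoint_innerPoint (x : D.Point) (y : D'.Point) :
    ¬ (D.annularComp D').circleSetoid v (outerPoint D' x) (innerPoint D y) := by
  intro h
  rcases rel_contract h with ⟨x', y', hx, hy, h⟩ | ⟨x', y', hx, hy, h⟩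
  · rw [contract_innerPoint] at hy; cases hy
  · rw [contract_outerPoint] at hx; cases hx

/-- The circle of the composition given by a circle of one of the two diagrams. -/
noncomputable def sumCircle (v : (D.annularComp D').Resolution) :
    D.Circle (outerResolution v) ⊕ D'.Circle (innerResolution v) → (D.annularComp D').Circle v :=
  Sum.elim (Quotient.map (outerPoint D') fun _ _ h => rel_outerPoint v h)
    (Quotient.map (innerPoint D) fun _ _ h => rel_innerPoint v h)

/-- The contraction shows that circles are neither joined nor mixed, and every point of the
composition can be slid along a strand to a point of one of the diagrams. -/
theorem sumCircle_bijective (v : (D.annularComp D').Resolution) :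
    Function.Bijective (sumCircle v) := by
  constructor
  · rintro (C | C) (C' | C') h <;> induction C using Quotient.inductionOn with | h x => ?_ <;>
      induction C' using Quotient.inductionOn with | h y => ?_
    · exact congrArg Sum.inl (Quotient.sound (rel_outerPoint_iff.1 (Quotient.exact h)))
    · exact absurd (Quotient.exact h) (not_rel_outerPoint_innerPoint x y)
    · exact absurd (Quotient.exact h.symm) (not_rel_outerPoint_innerPoint y x)
    · exact congrArg Sum.inr (Quotient.sound (rel_innerPoint_iff.1 (Quotient.exact h)))
  · intro C
    induction C using Quotient.inductionOn with | h z => ?_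
    rcases exists_strand v z with ⟨x, -, hx⟩ | ⟨x, -, hx⟩
    · exact ⟨Sum.inl (D.circleOf _ x), Quotient.sound (Setoid.symm' _ hx)⟩
    · exact ⟨Sum.inr (D'.circleOf _ x), Quotient.sound (Setoid.symm' _ hx)⟩

/-- The circles of the composition are those of the two diagrams. -/
noncomputable def circleEquiv (v : (D.annularComp D').Resolution) :
    D.Circle (outerResolution v) ⊕ D'.Circle (innerResolution v) ≃ (D.annularComp D').Circle v :=
  Equiv.ofBijective _ (sumCircle_bijective v)

theorem circleEquiv_inl (v : (D.annularComp D').Resolution) (x : D.Point) :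
    circleEquiv v (Sum.inl (D.circleOf _ x)) = (D.annularComp D').circleOf v (outerPoint D' x) :=
        rfl

theorem circleEquiv_inr (v : (D.annularComp D').Resolution) (x : D'.Point) :
    circleEquiv v (Sum.inr (D'.circleOf _ x)) = (D.annularComp D').circleOf v (innerPoint D x) :=
        rfl

variable (D D') in
/-- The crossings of the composition are those of the two diagrams. -/
noncomputable def crossingEquiv : D.Crossing ⊕ D'.Crossing ≃ (D.annularComp D').Crossing :=
  Equiv.ofBijective (Sum.elim (outerCrossing D') (innerCrossing D)) (by
    constructor
    · have h1 : ∀ (c : D.Crossing) (c' : D'.Crossing), outerCrossing D' c ≠ innerCrossing D c' := by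
        intro c c' h
        have h := congrArg Crossing.time h
        rw [time_outerCrossing, time_innerCrossing] at h
        have := c'.time_lt
        omega
      rintro (c | c) (c' | c') h <;> simp only [Sum.elim_inl, Sum.elim_inr] at h
      · have h := congrArg Crossing.time h
        rw [time_outerCrossing, time_outerCrossing] at h
        rw [Crossing.ext_time (Nat.add_left_cancel h)]
      · exact absurd h (h1 c c')
      · exact absurd h.symm (h1 c' c)
      · have h := congrArg Crossing.time h
        rw [time_innerCrossing, time_innerCrossing] at h
        rw [Crossing.ext_time h]
    · intro c
      rcases crossing_cases D D' c with ⟨c, rfl⟩ | ⟨c, rfl⟩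
      exacts [⟨Sum.inl c, rfl⟩, ⟨Sum.inr c, rfl⟩])

@[simp] theorem crossingEquiv_inl (c : D.Crossing) :
    crossingEquiv D D' (Sum.inl c) = outerCrossing D' c := rfl

@[simp] theorem crossingEquiv_inr (c : D'.Crossing) :
    crossingEquiv D D' (Sum.inr c) = innerCrossing D c := rfl

theorem card_crossing (P : (D.annularComp D').Crossing → Prop) :
    Nat.card {c // P c} =
      Nat.card {c : D.Crossing // P (outerCrossing D' c)} +
        Nat.card {c : D'.Crossing // P (innerCrossing D c)} := by
  rw [← Nat.card_sum]
  exact Nat.card_congr (((crossingEquiv D D').subtypeEquivOfSubtype (p := P)).symm.trans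
    Equiv.subtypeSum)

end Composition

end OrientedAnnularDiagram

namespace OrientedAnnularDiagram

open AnnularEvent

section Composition

variable {D D' : OrientedAnnularDiagram}

/-! ### Enhanced states of an annular composition -/

/-- The restriction of an enhanced state to the outer diagram. -/
noncomputable def outerState (S : (D.annularComp D').EnhancedState) : D.EnhancedState :=
  ⟨outerResolution S.1, fun C => S.2 (circleEquiv S.1 (Sum.inl C))⟩

/-- The restriction of an enhanced state to the inner diagram. -/
noncomputable def innerState (S : (D.annularComp D').EnhancedState) : D'.EnhancedState :=
  ⟨innerResolution S.1, fun C => S.2 (circleEquiv S.1 (Sum.inr C))⟩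

theorem outerState_label (S : (D.annularComp D').EnhancedState) (x : D.Point) :
    (outerState S).2 (D.circleOf (outerState S).1 x) =
      S.2 ((D.annularComp D').circleOf S.1 (outerPoint D' x)) := rfl

theorem innerState_label (S : (D.annularComp D').EnhancedState) (x : D'.Point) :
    (innerState S).2 (D'.circleOf (innerState S).1 x) =
      S.2 ((D.annularComp D').circleOf S.1 (innerPoint D x)) := rfl

theorem resolution_ext {v w : (D.annularComp D').Resolution}
    (h1 : outerResolution v = outerResolution w) (h2 : innerResolution v = innerResolution w) :
    v = w := by
  funext c
  rcases crossing_cases D D' c with ⟨c, rfl⟩ | ⟨c, rfl⟩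
  exacts [congrFun h1 c, congrFun h2 c]

theorem label_ext {S T : (D.annularComp D').EnhancedState}
    (h1 : ∀ x, S.2 ((D.annularComp D').circleOf S.1 (outerPoint D' x)) =
      T.2 ((D.annularComp D').circleOf T.1 (outerPoint D' x)))
    (h2 : ∀ x, S.2 ((D.annularComp D').circleOf S.1 (innerPoint D x)) =
      T.2 ((D.annularComp D').circleOf T.1 (innerPoint D x)))
    (hv : S.1 = T.1) : S = T := by
  refine EnhancedState.ext_circleOf hv fun z => ?_
  rcases exists_strand S.1 z with ⟨x, -, hx⟩ | ⟨x, -, hx⟩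
  · have hx' := hx
    rw [hv] at hx'
    rw [circleOf_eq_iff.2 hx, circleOf_eq_iff.2 hx', h1]
  · have hx' := hx
    rw [hv] at hx'
    rw [circleOf_eq_iff.2 hx, circleOf_eq_iff.2 hx', h2]

theorem state_label_eq {S T : D.EnhancedState} (h : S = T) (x : D.Point) :
    S.2 (D.circleOf S.1 x) = T.2 (D.circleOf T.1 x) := by rw [h]

theorem stateSplit_bijective :
    Function.Bijective fun S : (D.annularComp D').EnhancedState => (outerState S, innerState S) := by
  constructor
  · intro S T h
    simp only [Prod.mk.injEq] at h
    refine label_ext (fun x => ?_) (fun x => ?_) (resolution_ext (congrArg Sigma.fst h.1)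
      (congrArg Sigma.fst h.2))
    · exact state_label_eq h.1 x
    · exact state_label_eq h.2 x
  · rintro ⟨⟨v₁, l₁⟩, ⟨v₂, l₂⟩⟩
    obtain ⟨v, rfl, rfl⟩ : ∃ v : (D.annularComp D').Resolution,
        outerResolution v = v₁ ∧ innerResolution v = v₂ := by
      refine ⟨fun c => Sum.elim v₁ v₂ ((crossingEquiv D D').symm c), ?_, ?_⟩
      · funext c
        change Sum.elim v₁ v₂ ((crossingEquiv D D').symm (crossingEquiv D D' (Sum.inl c))) = _
        rw [Equiv.symm_apply_apply, Sum.elim_inl]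
      · funext c
        change Sum.elim v₁ v₂ ((crossingEquiv D D').symm (crossingEquiv D D' (Sum.inr c))) = _
        rw [Equiv.symm_apply_apply, Sum.elim_inr]
    refine ⟨⟨v, fun C => Sum.elim l₁ l₂ ((circleEquiv v).symm C)⟩, ?_⟩
    simp only [outerState, innerState, Equiv.symm_apply_apply, Sum.elim_inl, Sum.elim_inr]

variable (D D') in
/-- The enhanced states of the composition are pairs of enhanced states. -/
noncomputable def stateEquiv :
    (D.annularComp D').EnhancedState ≃ D.EnhancedState × D'.EnhancedState :=
  Equiv.ofBijective _ stateSplit_bijective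

theorem sum_states (F : D.EnhancedState → D'.EnhancedState → ℂ) :
    ∑ S : (D.annularComp D').EnhancedState, F (outerState S) (innerState S) =
      ∑ S, ∑ S', F S S' := by
  rw [← Fintype.sum_prod_type']
  exact (stateEquiv D D').sum_comp (fun p => F p.1 p.2)

theorem state_ext {S T : (D.annularComp D').EnhancedState} (h1 : outerState S = outerState T)
    (h2 : innerState S = innerState T) : S = T :=
  stateSplit_bijective.1 (Prod.ext h1 h2)

/-! ### Gradings of an annular composition -/

theorem dir_outerPoint (x : D.Point) : (outerPoint D' x).dir = x.dir := by
  have h1 := (outerPoint D' x).getElem?_coord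
  have h2 := x.getElem?_coord
  rw [coord_outerPoint, level_annularComp_outer D D' x.inRange.1,
    List.getElem?_append_right (Nat.le_add_right _ _), Nat.add_sub_cancel_left, h2] at h1
  exact (Option.some_injective _ h1).symm

theorem dir_innerPoint (x : D'.Point) : (innerPoint D x).dir = x.dir := by
  have h1 := (innerPoint D x).getElem?_coord
  have h2 := x.getElem?_coord
  rw [coord_innerPoint, level_annularComp_inner D D' x.inRange.1,
    List.getElem?_append_left x.inRange.2, h2] at h1
  exact (Option.some_injective _ h1).symm

theorem positive_outerCrossing (c : D.Crossing) :
    (outerCrossing D' c).Positive ↔ c.Positive := by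
  rw [Crossing.Positive, Crossing.Positive, lowerLeft_outerCrossing, lowerRight_outerCrossing,
    dir_outerPoint, dir_outerPoint, risingOver_outerCrossing]

theorem positive_innerCrossing (c : D'.Crossing) :
    (innerCrossing D c).Positive ↔ c.Positive := by
  rw [Crossing.Positive, Crossing.Positive, lowerLeft_innerCrossing, lowerRight_innerCrossing,
    dir_innerPoint, dir_innerPoint, risingOver_innerCrossing]

theorem nPlus_annularComp : (D.annularComp D').nPlus = D.nPlus + D'.nPlus := by
  simp only [nPlus, card_crossing, positive_outerCrossing, positive_innerCrossing]

theorem nMinus_annularComp : (D.annularComp D').nMinus = D.nMinus + D'.nMinus := by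
  simp only [nMinus, card_crossing, positive_outerCrossing, positive_innerCrossing]

theorem height_annularComp (S : (D.annularComp D').EnhancedState) :
    height S = height (outerState S) + height (innerState S) := card_crossing _

theorem sum_circle {M : Type*} [AddCommMonoid M] (v : (D.annularComp D').Resolution)
    (F : (D.annularComp D').Circle v → M) :
    ∑ C, F C = ∑ C, F (circleEquiv v (Sum.inl C)) + ∑ C, F (circleEquiv v (Sum.inr C)) := by
  rw [← (circleEquiv v).sum_comp, Fintype.sum_sum_type]

theorem prod_circle {M : Type*} [CommMonoid M] (v : (D.annularComp D').Resolution)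
    (F : (D.annularComp D').Circle v → M) :
    ∏ C, F C = (∏ C, F (circleEquiv v (Sum.inl C))) * ∏ C, F (circleEquiv v (Sum.inr C)) := by
  rw [← (circleEquiv v).prod_comp, Fintype.prod_sum_type]

theorem jGrading_annularComp (S : (D.annularComp D').EnhancedState) :
    (D.annularComp D').jGrading S = D.jGrading (outerState S) + D'.jGrading (innerState S) := by
  have h := height_annularComp S
  simp only [height] at h
  have hs : ∑ C, labelDegree (S.2 C) =
      ∑ C : D.Circle (outerState S).1, labelDegree ((outerState S).2 C) +
        ∑ C : D'.Circle (innerState S).1, labelDegree ((innerState S).2 C) :=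
    sum_circle S.1 fun C => labelDegree (S.2 C)
  rw [jGrading, jGrading, jGrading, hs, nPlus_annularComp, nMinus_annularComp, h]
  push_cast
  ring

/-- Points of `D` at angle `0` sit after the inner events in the composition, so they are slid back
to level `0` along the straight outer strands. The arc thus meets each outer circle equally often in
both diagrams. -/
theorem card_outer (v : (D.annularComp D').Resolution) (C : D.Circle (outerResolution v)) :
    Nat.card {z : (D.annularComp D').Point //
      z.1 = 0 ∧ (D.annularComp D').circleOf v z = circleEquiv v (Sum.inl C)} =
    Nat.card {x : D.Point // x.1 = 0 ∧ D.circleOf (outerResolution v) x = C} := by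
  have hr : ∀ x : D.Point, x.1 = 0 →
      x.coord.2 < D.start.length ∧ (D.annularComp D').InRange (0, D'.start.length + x.coord.2) := by
    intro x hx
    have h := x.inRange.2
    have h0 : x.coord.1 = 0 := congrArg Fin.val hx
    rw [h0, D.level_zero] at h
    refine ⟨h, Nat.zero_le _, ?_⟩
    simp only [level_annularComp_inner D D' (Nat.zero_le _), D'.level_zero, List.length_append]
    omega
  have hrel : ∀ (x : D.Point) (hx : x.1 = 0),
      (D.annularComp D').circleSetoid v (pointOf (hr x hx).2) (outerPoint D' x) := by
    intro x hx
    refine rel_outer_strand v (hr x hx).1 (Nat.zero_le _) ?_ ?_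
    · rw [coord_outerPoint, show x.coord.1 = 0 from congrArg Fin.val hx, Nat.add_zero]
    · rw [coord_pointOf, D'.level_zero]
  symm
  refine Nat.card_congr (Equiv.ofBijective (fun x => ⟨pointOf (hr x.1 x.2.1).2, rfl, ?_⟩) ⟨?_, ?_⟩)
  · rw [circleOf_eq_iff.2 (hrel x.1 x.2.1), ← circleEquiv_inl, x.2.2]
  · rintro ⟨x, hx, hx'⟩ ⟨y, hy, hy'⟩ h
    have h := congrArg (fun z => z.1.coord.2) h
    simp only [coord_pointOf, Nat.add_left_cancel_iff] at h
    refine Subtype.ext (Point.coord_injective _ (Prod.ext ?_ h))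
    exact (congrArg Fin.val hx).trans (congrArg Fin.val hy).symm
  · rintro ⟨z, hz, hz'⟩
    have h0 : z.coord.1 = 0 := congrArg Fin.val hz
    rcases exists_strand v z with ⟨x, hx, hzx⟩ | ⟨x, hx, hzx⟩
    · have h1 : z.coord = (0, z.coord.2) := Prod.ext h0 rfl
      rw [h1] at hx
      have h2 : ¬ z.coord.2 < D'.start.length := by
        intro h2
        rw [contract_inner (Nat.zero_le _) (by rwa [D'.level_zero])] at hx
        cases hx
      obtain ⟨q, hq⟩ := Nat.exists_eq_add_of_le (not_lt.1 h2)
      have h3 := contract_outer_strand (D' := D') (Nat.zero_le _) q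
      rw [D'.level_zero, ← hq, hx] at h3
      have h4 : x.coord = (0, q) := Sum.inl_injective h3
      have hx0 : x.1 = 0 := Fin.ext (congrArg Prod.fst h4)
      refine ⟨⟨x, hx0, ?_⟩, Subtype.ext (Point.coord_injective _ ?_)⟩
      · have h5 : circleEquiv v (Sum.inl (D.circleOf _ x)) = circleEquiv v (Sum.inl C) := by
          rw [circleEquiv_inl, ← hz', circleOf_eq_iff.2 hzx]
        exact Sum.inl_injective ((circleEquiv v).injective h5)
      · rw [coord_pointOf, h4, h1, hq]
    · rw [circleOf_eq_iff.2 hzx, ← circleEquiv_inr] at hz'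
      cases (circleEquiv v).injective hz'

theorem card_inner (v : (D.annularComp D').Resolution) (C : D'.Circle (innerResolution v)) :
    Nat.card {z : (D.annularComp D').Point //
      z.1 = 0 ∧ (D.annularComp D').circleOf v z = circleEquiv v (Sum.inr C)} =
    Nat.card {x : D'.Point // x.1 = 0 ∧ D'.circleOf (innerResolution v) x = C} := by
  symm
  refine Nat.card_congr (Equiv.ofBijective (fun x => ⟨innerPoint D x.1,
    Fin.ext (show x.1.coord.1 = 0 from congrArg Fin.val x.2.1), ?_⟩) ⟨?_, ?_⟩)
  · rw [← circleEquiv_inr, x.2.2]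
  · rintro ⟨x, hx, hx'⟩ ⟨y, hy, hy'⟩ h
    have h := congrArg (fun z => z.1.coord) h
    exact Subtype.ext (Point.coord_injective _ h)
  · rintro ⟨z, hz, hz'⟩
    have h0 : z.coord.1 = 0 := congrArg Fin.val hz
    have h1 : z.coord = (0, z.coord.2) := Prod.ext h0 rfl
    rcases exists_strand v z with ⟨x, hx, hzx⟩ | ⟨x, hx, hzx⟩
    · rw [circleOf_eq_iff.2 hzx, ← circleEquiv_inl] at hz'
      cases (circleEquiv v).injective hz'
    · rw [h1] at hx
      have h2 : z.coord.2 < D'.start.length := by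
        by_contra h2
        obtain ⟨q, hq⟩ := Nat.exists_eq_add_of_le (not_lt.1 h2)
        have h3 := contract_outer_strand (D' := D') (Nat.zero_le _) q
        rw [D'.level_zero, ← hq, hx] at h3
        cases h3
      rw [contract_inner (Nat.zero_le _) (by rwa [D'.level_zero])] at hx
      have h4 : (0, z.coord.2) = x.coord := Sum.inr_injective hx
      refine ⟨⟨x, Fin.ext (congrArg Prod.fst h4).symm, ?_⟩,
        Subtype.ext (Point.coord_injective _ ?_)⟩
      · have h5 : circleEquiv v (Sum.inr (D'.circleOf _ x)) = circleEquiv v (Sum.inr C) := by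
          rw [circleEquiv_inr, ← hz', circleOf_eq_iff.2 hzx]
        exact Sum.inr_injective ((circleEquiv v).injective h5)
      · rw [coord_innerPoint, ← h4, h1]

theorem kGrading_annularComp (S : (D.annularComp D').EnhancedState) :
    (D.annularComp D').kGrading S = D.kGrading (outerState S) + D'.kGrading (innerState S) := by
  classical
  have h1 : ∀ C, (D.annularComp D').Nontrivial S.1 (circleEquiv S.1 (Sum.inl C)) ↔
      D.Nontrivial (outerState S).1 C := fun C => by
    rw [Nontrivial, card_outer]; rfl
  have h2 : ∀ C, (D.annularComp D').Nontrivial S.1 (circleEquiv S.1 (Sum.inr C)) ↔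
      D'.Nontrivial (innerState S).1 C := fun C => by
    rw [Nontrivial, card_inner]; rfl
  rw [kGrading, kGrading, kGrading, sum_circle]
  exact congrArg₂ _ (Finset.sum_congr rfl fun C _ => if_congr (h1 C) rfl rfl)
    (Finset.sum_congr rfl fun C _ => if_congr (h2 C) rfl rfl)

theorem jtGrading_annularComp (t : ℝ) (S : (D.annularComp D').EnhancedState) :
    (D.annularComp D').jtGrading t S =
      D.jtGrading t (outerState S) + D'.jtGrading t (innerState S) := by
  rw [jtGrading, jtGrading, jtGrading, jGrading_annularComp, kGrading_annularComp]
  push_cast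
  ring

/-! ### The canonical cycle of an annular composition -/

theorem outerResolution_orientedResolution :
    outerResolution (D.annularComp D').orientedResolution = D.orientedResolution := by
  classical
  funext c
  simp only [outerResolution, orientedResolution, positive_outerCrossing]

theorem innerResolution_orientedResolution :
    innerResolution (D.annularComp D').orientedResolution = D'.orientedResolution := by
  classical
  funext c
  simp only [innerResolution, orientedResolution, positive_innerCrossing]

theorem length_start_annularComp :
    (D.annularComp D').start.length = D'.start.length + D.start.length :=
  List.length_append

/-- The inner strands shift the position and the number of strands alike, and the two parities
cancel. -/
theorem leeColour_outerPoint (x : D.Point) :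
    (D.annularComp D').leeColour (outerPoint D' x) = D.leeColour x := by
  simp only [leeColour, Point.bodd_leeIndex, length_start_annularComp, coord_outerPoint,
    dir_outerPoint, Nat.bodd_add]
  cases D'.start.length.bodd <;> cases D.start.length.bodd <;> simp

/-- The outer strands lie between the point and `O` but do not change its position, so their parity
remains. -/
theorem leeColour_innerPoint (x : D'.Point) :
    (D.annularComp D').leeColour (innerPoint D x) = (D.start.length.bodd ^^ D'.leeColour x) := by
  simp only [leeColour, Point.bodd_leeIndex, length_start_annularComp, coord_innerPoint,
    dir_innerPoint, Nat.bodd_add]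
  cases D'.start.length.bodd <;> cases D.start.length.bodd <;> simp

theorem canonicalCycle_annularComp (S : (D.annularComp D').EnhancedState) :
    (D.annularComp D').canonicalCycle S = D.canonicalCycle (outerState S) *
      colourChain D'.orientedResolution (fun x => D.start.length.bodd ^^ D'.leeColour x)
        (innerState S) := by
  classical
  rw [canonicalCycle_eq, canonicalCycle_eq]
  simp only [colourChain]
  by_cases h : S.1 = (D.annularComp D').orientedResolution
  · have h1 : (outerState S).1 = D.orientedResolution := by
      change outerResolution S.1 = _
      rw [h, outerResolution_orientedResolution]
    have h2 : (innerState S).1 = D'.orientedResolution := by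
      change innerResolution S.1 = _
      rw [h, innerResolution_orientedResolution]
    rw [if_pos h, if_pos h1, if_pos h2, prod_circle]
    have hc : Compatible S.1 (D.annularComp D').leeColour := by
      rw [h]; exact compatible_leeColour
    congr 1
    · refine Finset.prod_congr rfl fun C _ => ?_
      have h3 : circleEquiv S.1 (Sum.inl C) =
          (D.annularComp D').circleOf S.1 (outerPoint D' C.out) := by
        rw [← circleEquiv_inl]
        congr 2
        exact (Quotient.out_eq C).symm
      have h4 : (D.annularComp D').leeColour (circleEquiv S.1 (Sum.inl C)).out =
          D.leeColour C.out := by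
        rw [h3, hc.out, leeColour_outerPoint]
      rw [h4]
      rfl
    · refine Finset.prod_congr rfl fun C _ => ?_
      have h3 : circleEquiv S.1 (Sum.inr C) =
          (D.annularComp D').circleOf S.1 (innerPoint D C.out) := by
        rw [← circleEquiv_inr]
        congr 2
        exact (Quotient.out_eq C).symm
      have h4 : (D.annularComp D').leeColour (circleEquiv S.1 (Sum.inr C)).out =
          (D.start.length.bodd ^^ D'.leeColour C.out) := by
        rw [h3, hc.out, leeColour_innerPoint]
      rw [h4]
      rfl
  · rw [if_neg h]
    by_cases h1 : (outerState S).1 = D.orientedResolution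
    · have h2 : (innerState S).1 ≠ D'.orientedResolution := by
        intro h2
        exact h (resolution_ext (h1.trans outerResolution_orientedResolution.symm)
          (h2.trans innerResolution_orientedResolution.symm))
      rw [if_neg h2, mul_zero]
    · rw [if_neg h1, zero_mul]

end Composition

end OrientedAnnularDiagram

namespace OrientedAnnularDiagram

open AnnularEvent

section Leibniz

variable {D D' : OrientedAnnularDiagram}

/-! ### The Lee differential of an annular composition -/

theorem outerCrossing_injective : Function.Injective (outerCrossing (D := D) D') := fun c c' h =>
  Sum.inl_injective ((crossingEquiv D D').injective (by simpa using h))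

theorem innerCrossing_injective : Function.Injective (innerCrossing (D' := D') D) := fun c c' h =>
  Sum.inr_injective ((crossingEquiv D D').injective (by simpa using h))

theorem outerCrossing_ne_innerCrossing (c : D.Crossing) (c' : D'.Crossing) :
    outerCrossing D' c ≠ innerCrossing D c' := fun h =>
  Sum.inl_ne_inr ((crossingEquiv D D').injective
    (show crossingEquiv D D' (Sum.inl c) = crossingEquiv D D' (Sum.inr c') by simpa using h))

theorem circleOf_outerPoint_eq_iff {v : (D.annularComp D').Resolution} {x y : D.Point} :
    (D.annularComp D').circleOf v (outerPoint D' x) =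
      (D.annularComp D').circleOf v (outerPoint D' y) ↔
    D.circleOf (outerResolution v) x = D.circleOf (outerResolution v) y := by
  rw [circleOf_eq_iff, circleOf_eq_iff, rel_outerPoint_iff]

theorem circleOf_innerPoint_eq_iff {v : (D.annularComp D').Resolution} {x y : D'.Point} :
    (D.annularComp D').circleOf v (innerPoint D x) =
      (D.annularComp D').circleOf v (innerPoint D y) ↔
    D'.circleOf (innerResolution v) x = D'.circleOf (innerResolution v) y := by
  rw [circleOf_eq_iff, circleOf_eq_iff, rel_innerPoint_iff]

theorem circleOf_outerPoint_ne {v : (D.annularComp D').Resolution} (x : D.Point) (y : D'.Point) :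
    (D.annularComp D').circleOf v (outerPoint D' x) ≠
      (D.annularComp D').circleOf v (innerPoint D y) := fun h =>
  not_rel_outerPoint_innerPoint x y (circleOf_eq_iff.1 h)

variable {S T : (D.annularComp D').EnhancedState}

/-- A saddle at an outer crossing touches no inner circle, so the inner states at both ends of the
edge are the same. -/
theorem isEdge_outerCrossing {c : D.Crossing} :
    (D.annularComp D').IsEdge (outerCrossing D' c) S T ↔
      D.IsEdge c (outerState S) (outerState T) ∧ innerState S = innerState T := by
  constructor
  · rintro ⟨h1, h2, h3, h4⟩
    refine ⟨⟨h1, h2, fun c' hc' => h3 _ (outerCrossing_injective.ne hc'), fun x hx hy => ?_⟩, ?_⟩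
    · rw [outerState_label, outerState_label]
      refine h4 _ ?_ ?_
      · rw [lowerLeft_outerCrossing]
        exact fun h => hx (circleOf_outerPoint_eq_iff.1 h)
      · rw [upperRight_outerCrossing]
        exact fun h => hy (circleOf_outerPoint_eq_iff.1 h)
    · refine EnhancedState.ext_circleOf ?_ fun x => ?_
      · funext c'
        exact (h3 _ (outerCrossing_ne_innerCrossing c c').symm).symm
      · rw [innerState_label, innerState_label]
        refine (h4 _ ?_ ?_).symm
        · rw [lowerLeft_outerCrossing]
          exact (circleOf_outerPoint_ne _ _).symm
        · rw [upperRight_outerCrossing]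
          exact (circleOf_outerPoint_ne _ _).symm
  · rintro ⟨⟨h1, h2, h3, h4⟩, h5⟩
    have hv : ∀ c', c' ≠ outerCrossing D' c → T.1 c' = S.1 c' := by
      intro c' hc'
      rcases crossing_cases D D' c' with ⟨c', rfl⟩ | ⟨c', rfl⟩
      · exact h3 c' fun h => hc' (h ▸ rfl)
      · exact (congrFun (congrArg Sigma.fst h5) c').symm
    refine ⟨h1, h2, hv, fun z hz hz' => ?_⟩
    rw [lowerLeft_outerCrossing] at hz
    rw [upperRight_outerCrossing] at hz'
    -- The contraction does not depend on the resolution, so `z` slides to the same point of the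
    -- same diagram in `S` and in `T`.
    rcases exists_strand S.1 z with ⟨x, hzx, hx⟩ | ⟨x, hzx, hx⟩
    · rcases exists_strand T.1 z with ⟨y, hzy, hy⟩ | ⟨y, hzy, hy⟩
      · rw [hzx] at hzy
        obtain rfl := Point.coord_injective _ (Sum.inl_injective hzy)
        rw [circleOf_eq_iff.2 hx] at hz hz'
        rw [circleOf_eq_iff.2 hx, circleOf_eq_iff.2 hy]
        exact h4 x (fun h => hz (circleOf_outerPoint_eq_iff.2 h))
          fun h => hz' (circleOf_outerPoint_eq_iff.2 h)
      · rw [hzx] at hzy; cases hzy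
    · rcases exists_strand T.1 z with ⟨y, hzy, hy⟩ | ⟨y, hzy, hy⟩
      · rw [hzx] at hzy; cases hzy
      · rw [hzx] at hzy
        obtain rfl := Point.coord_injective _ (Sum.inr_injective hzy)
        rw [circleOf_eq_iff.2 hx, circleOf_eq_iff.2 hy]
        exact (state_label_eq h5 x).symm

theorem isEdge_innerCrossing {c : D'.Crossing} :
    (D.annularComp D').IsEdge (innerCrossing D c) S T ↔
      D'.IsEdge c (innerState S) (innerState T) ∧ outerState S = outerState T := by
  constructor
  · rintro ⟨h1, h2, h3, h4⟩
    refine ⟨⟨h1, h2, fun c' hc' => h3 _ (innerCrossing_injective.ne hc'), fun x hx hy => ?_⟩, ?_⟩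
    · rw [innerState_label, innerState_label]
      refine h4 _ ?_ ?_
      · rw [lowerLeft_innerCrossing]
        exact fun h => hx (circleOf_innerPoint_eq_iff.1 h)
      · rw [upperRight_innerCrossing]
        exact fun h => hy (circleOf_innerPoint_eq_iff.1 h)
    · refine EnhancedState.ext_circleOf ?_ fun x => ?_
      · funext c'
        exact (h3 _ (outerCrossing_ne_innerCrossing c' c)).symm
      · rw [outerState_label, outerState_label]
        refine (h4 _ ?_ ?_).symm
        · rw [lowerLeft_innerCrossing]
          exact circleOf_outerPoint_ne _ _
        · rw [upperRight_innerCrossing]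
          exact circleOf_outerPoint_ne _ _
  · rintro ⟨⟨h1, h2, h3, h4⟩, h5⟩
    have hv : ∀ c', c' ≠ innerCrossing D c → T.1 c' = S.1 c' := by
      intro c' hc'
      rcases crossing_cases D D' c' with ⟨c', rfl⟩ | ⟨c', rfl⟩
      · exact (congrFun (congrArg Sigma.fst h5) c').symm
      · exact h3 c' fun h => hc' (h ▸ rfl)
    refine ⟨h1, h2, hv, fun z hz hz' => ?_⟩
    rw [lowerLeft_innerCrossing] at hz
    rw [upperRight_innerCrossing] at hz'
    rcases exists_strand S.1 z with ⟨x, hzx, hx⟩ | ⟨x, hzx, hx⟩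
    · rcases exists_strand T.1 z with ⟨y, hzy, hy⟩ | ⟨y, hzy, hy⟩
      · rw [hzx] at hzy
        obtain rfl := Point.coord_injective _ (Sum.inl_injective hzy)
        rw [circleOf_eq_iff.2 hx, circleOf_eq_iff.2 hy]
        exact (state_label_eq h5 x).symm
      · rw [hzx] at hzy; cases hzy
    · rcases exists_strand T.1 z with ⟨y, hzy, hy⟩ | ⟨y, hzy, hy⟩
      · rw [hzx] at hzy; cases hzy
      · rw [hzx] at hzy
        obtain rfl := Point.coord_injective _ (Sum.inr_injective hzy)
        rw [circleOf_eq_iff.2 hx] at hz hz'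
        rw [circleOf_eq_iff.2 hx, circleOf_eq_iff.2 hy]
        exact h4 x (fun h => hz (circleOf_innerPoint_eq_iff.2 h))
          fun h => hz' (circleOf_innerPoint_eq_iff.2 h)

theorem saddleCoeff_outerCrossing (c : D.Crossing) :
    (D.annularComp D').saddleCoeff (outerCrossing D' c) S T =
      D.saddleCoeff c (outerState S) (outerState T) := by
  classical
  unfold saddleCoeff
  rw [lowerLeft_outerCrossing, upperRight_outerCrossing]
  exact if_congr (not_congr circleOf_outerPoint_eq_iff) rfl rfl

theorem saddleCoeff_innerCrossing (c : D'.Crossing) :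
    (D.annularComp D').saddleCoeff (innerCrossing D c) S T =
      D'.saddleCoeff c (innerState S) (innerState T) := by
  classical
  unfold saddleCoeff
  rw [lowerLeft_innerCrossing, upperRight_innerCrossing]
  exact if_congr (not_congr circleOf_innerPoint_eq_iff) rfl rfl

theorem edgeSign_eq_card (v : D.Resolution) (c : D.Crossing) :
    D.edgeSign v c = (-1) ^ Nat.card {c' : D.Crossing // c'.time < c.time ∧ v c' = true} := by
  classical
  rw [edgeSign, Nat.card_eq_fintype_card, Fintype.card_subtype]

/-- All inner crossings precede all outer ones, so each inner `1`-smoothing adds a sign; conversely,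
outer smoothings never affect inner edges. -/
theorem edgeSign_outerCrossing (c : D.Crossing) :
    (D.annularComp D').edgeSign S.1 (outerCrossing D' c) =
      (-1) ^ height (innerState S) * D.edgeSign (outerState S).1 c := by
  rw [edgeSign_eq_card, edgeSign_eq_card, card_crossing, add_comm, pow_add, height]
  simp only [time_outerCrossing, time_innerCrossing, Nat.add_lt_add_iff_left]
  have h : ∀ c' : D'.Crossing, (c'.time < D'.word.length + c.time ∧ S.1 (innerCrossing D c') = true) ↔
      (innerState S).1 c' = true := fun c' => by
    have := c'.time_lt
    exact and_iff_right (by omega)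
  simp only [h]
  rfl

theorem edgeSign_innerCrossing (c : D'.Crossing) :
    (D.annularComp D').edgeSign S.1 (innerCrossing D c) = D'.edgeSign (innerState S).1 c := by
  rw [edgeSign_eq_card, edgeSign_eq_card, card_crossing]
  simp only [time_outerCrossing, time_innerCrossing]
  have h : IsEmpty {c' : D.Crossing //
      D'.word.length + c'.time < c.time ∧ S.1 (outerCrossing D' c') = true} :=
    ⟨fun c' => by
      have h1 := c.time_lt
      have h2 := c'.2.1
      omega⟩
  rw [Nat.card_of_isEmpty, zero_add]
  rfl

open Classical in
theorem leeCoeff_annularComp :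
    (D.annularComp D').leeCoeff S T =
      (if innerState S = innerState T then
        (-1) ^ height (innerState S) * D.leeCoeff (outerState S) (outerState T) else 0) +
      (if outerState S = outerState T then
        D'.leeCoeff (innerState S) (innerState T) else 0) := by
  rw [leeCoeff, ← (crossingEquiv D D').sum_comp, Fintype.sum_sum_type]
  simp only [crossingEquiv_inl, crossingEquiv_inr, isEdge_outerCrossing, isEdge_innerCrossing,
    saddleCoeff_outerCrossing, saddleCoeff_innerCrossing, edgeSign_outerCrossing,
    edgeSign_innerCrossing]
  congr 1
  · by_cases h : innerState S = innerState T
    · simp only [h, and_true, if_true, leeCoeff, Finset.mul_sum]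
      refine Finset.sum_congr rfl fun c _ => ?_
      split_ifs
      · ring
      · simp
    · simp [h]
  · by_cases h : outerState S = outerState T
    · simp only [h, and_true, if_true, leeCoeff]
    · simp [h]

/-- The product of chains of two diagrams, as a chain of their annular composition. -/
noncomputable def tensorChain (x : D.LeeChain) (y : D'.LeeChain) : (D.annularComp D').LeeChain :=
  fun S => x (outerState S) * y (innerState S)

/-- The sign involution of the Lee complex. -/
noncomputable def signChain (y : D.LeeChain) : D.LeeChain := fun S => (-1) ^ height S * y S

theorem leeDifferential_signChain (y : D.LeeChain) :
    D.leeDifferential (signChain y) = -signChain (D.leeDifferential y) := by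
  classical
  funext T
  simp only [Pi.neg_apply, signChain, leeDifferential_apply, Finset.mul_sum,
    ← Finset.sum_neg_distrib]
  refine Finset.sum_congr rfl fun S _ => ?_
  by_cases h : ∃ c, D.IsEdge c S T
  · obtain ⟨c, h⟩ := h
    rw [h.height_eq, pow_succ]
    ring
  · have h0 : D.leeCoeff S T = 0 :=
      Finset.sum_eq_zero fun c _ => if_neg fun hc => h ⟨c, hc⟩
    rw [h0]
    ring

theorem leeDifferential_tensorChain (x : D.LeeChain) (y : D'.LeeChain) :
    (D.annularComp D').leeDifferential (tensorChain x y) =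
      tensorChain (D.leeDifferential x) (signChain y) + tensorChain x (D'.leeDifferential y) := by
  classical
  funext T
  simp only [Pi.add_apply, tensorChain, leeDifferential_apply, leeCoeff_annularComp]
  rw [sum_states fun S S' => ((if S' = innerState T then
    (-1) ^ height S' * D.leeCoeff S (outerState T) else 0) +
      (if S = outerState T then D'.leeCoeff S' (innerState T) else 0)) * (x S * y S')]
  simp only [add_mul, ite_mul, zero_mul, Finset.sum_add_distrib, Finset.sum_ite_eq',
    Finset.mem_univ, if_true, signChain]
  rw [Finset.sum_mul, Finset.mul_sum]
  congr 1
  · refine Finset.sum_congr rfl fun S _ => ?_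
    ring
  · rw [Finset.sum_comm]
    simp only [Finset.sum_ite_eq', Finset.mem_univ, if_true]
    refine Finset.sum_congr rfl fun S _ => ?_
    ring

theorem sum_tensorChain (x : D.LeeChain) (y : D'.LeeChain) (f : D.LeeChain) (g : D'.LeeChain) :
    ∑ S, tensorChain f g S * tensorChain x y S = (∑ S, f S * x S) * ∑ S, g S * y S := by
  simp only [tensorChain]
  rw [sum_states fun S S' => f S * g S' * (x S * y S'), Finset.sum_mul_sum]
  exact Finset.sum_congr rfl fun S _ => Finset.sum_congr rfl fun S' _ => by ring

theorem tensorChain_single [DecidableEq D.EnhancedState] [DecidableEq D'.EnhancedState]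
    [DecidableEq (D.annularComp D').EnhancedState] (S : (D.annularComp D').EnhancedState) :
    tensorChain (Pi.single (outerState S) 1) (Pi.single (innerState S) 1) =
      (Pi.single S 1 : (D.annularComp D').LeeChain) := by
  funext T
  simp only [tensorChain, Pi.single_apply]
  by_cases h : T = S
  · simp [h]
  · rw [if_neg h, mul_ite, mul_one, mul_zero]
    split_ifs with h1 h2
    · exact absurd (state_ext h2 h1) h
    all_goals rfl

/-- Representatives and detecting functionals are both tensored. The tensor functional kills
boundaries because, by the Leibniz rule, the boundary of a product has a boundary in one factor of
each term. -/
theorem attainsLevel_tensorChain {t a a' : ℝ} {s : D.LeeChain} {s' : D'.LeeChain}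
    (hs : D.leeDifferential s = 0)
    (h : AttainsLevel D.leeDifferential (D.jtGrading t) s a)
    (h' : AttainsLevel D'.leeDifferential (D'.jtGrading t) s' a') :
    AttainsLevel (D.annularComp D').leeDifferential ((D.annularComp D').jtGrading t)
      (tensorChain s s') (a + a') := by
  classical
  obtain ⟨⟨x, hx, ⟨z, hz⟩, hxa⟩, f, hf, hfd, hfs⟩ := h
  obtain ⟨⟨x', hx', ⟨z', hz'⟩, hxa'⟩, f', hf', hfd', hfs'⟩ := h'
  -- The primitive follows the splitting `x ⊗ x' - s ⊗ s' = (x - s) ⊗ x' + s ⊗ (x' - s')`, where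
  -- `x'` and `s` are cycles; the sign involution cancels the one in the Leibniz rule.
  refine ⟨⟨tensorChain x x', ?_, ⟨tensorChain z (signChain x') + tensorChain s z', ?_⟩, ?_⟩,
    tensorChain f f', ?_, ?_, ?_⟩
  · rw [leeDifferential_tensorChain, hx, hx']
    funext S
    simp [tensorChain]
  · rw [map_add, leeDifferential_tensorChain, leeDifferential_tensorChain, hs,
      leeDifferential_signChain, hx', hz, hz']
    funext S
    simp only [tensorChain, signChain, Pi.add_apply, Pi.sub_apply, Pi.neg_apply, Pi.zero_apply]
    have hsq : ((-1 : ℂ) ^ height (innerState S)) * (-1) ^ height (innerState S) = 1 := by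
      rw [← mul_pow]; simp
    linear_combination (x (outerState S) - s (outerState S)) * x' (innerState S) * hsq
  · intro S hS
    rw [jtGrading_annularComp]
    exact add_le_add (hxa _ (left_ne_zero_of_mul hS)) (hxa' _ (right_ne_zero_of_mul hS))
  · intro S hS
    rw [jtGrading_annularComp]
    exact add_le_add (hf _ (left_ne_zero_of_mul hS)) (hf' _ (right_ne_zero_of_mul hS))
  · intro w
    -- It suffices to test basis elements, which are products.
    have hsingle : ∀ S, ∑ T, tensorChain f f' T * (D.annularComp D').leeDifferential
        (Pi.single S 1) T = 0 := by
      intro S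
      rw [← tensorChain_single, leeDifferential_tensorChain]
      simp only [Pi.add_apply, mul_add, Finset.sum_add_distrib, sum_tensorChain, hfd, hfd',
        zero_mul, mul_zero, add_zero]
    have hsum : ∀ T, (D.annularComp D').leeDifferential w T =
        ∑ S, w S * (D.annularComp D').leeDifferential (Pi.single S 1) T := by
      intro T
      simp only [leeDifferential_apply, Pi.single_apply, mul_ite, mul_one, mul_zero,
        Finset.sum_ite_eq', Finset.mem_univ, if_true]
      exact Finset.sum_congr rfl fun S _ => mul_comm _ _
    simp only [hsum, Finset.mul_sum]
    rw [Finset.sum_comm]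
    refine Finset.sum_eq_zero fun S _ => ?_
    rw [← mul_zero (w S), ← hsingle S, Finset.mul_sum]
    exact Finset.sum_congr rfl fun T _ => by ring
  · rw [sum_tensorChain]
    exact mul_ne_zero hfs hfs'

theorem leeDifferential_canonicalCycle : D.leeDifferential D.canonicalCycle = 0 := by
  rw [canonicalCycle_eq]
  exact leeDifferential_colourChain compatible_leeColour separating_leeColour

variable (D D')

/-- The inner tensor factor is the canonical cycle of `D'` or its colour exchange, according to the
parity of the number of outer strands; both have the same level. -/
theorem annularRasmussen_annularComp (t : ℝ) :
    (D.annularComp D').annularRasmussen t = D.annularRasmussen t + D'.annularRasmussen t := by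
  have h : AttainsLevel D'.leeDifferential (D'.jtGrading t)
      (colourChain D'.orientedResolution fun x => D.start.length.bodd ^^ D'.leeColour x)
      (D'.annularRasmussen t) := by
    cases D.start.length.bodd
    · simp only [Bool.false_bne]
      rw [← canonicalCycle_eq]
      exact D'.attainsLevel_canonicalCycle t
    · simp only [Bool.true_bne]
      exact D'.attainsLevel_colourChain_not t
  have h := attainsLevel_tensorChain leeDifferential_canonicalCycle
    (D.attainsLevel_canonicalCycle t) h
  refine AttainsLevel.annularRasmussen_eq ?_
  rwa [show (D.annularComp D').canonicalCycle = tensorChain _ _ from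
    funext canonicalCycle_annularComp]

end Leibniz

end OrientedAnnularDiagram

/-! ### Right-affine germs under maxima and minima -/

/-- The germ of `g` to the right of `t` is affine. -/
def RightAffine (g : ℝ → ℝ) (t : ℝ) : Prop :=
  ∃ m, ∀ᶠ ε in 𝓝[>] (0 : ℝ), g (t + ε) = g t + m * ε

namespace RightAffine

variable {g h : ℝ → ℝ} {t : ℝ}

/-- If the values at `t` differ, continuity of the affine germs decides; if they agree, the slopes
decide. So two such germs are always comparable, and their maximum and minimum are again one of the
two. -/
theorem eventually_le_or (hg : RightAffine g t) (hh : RightAffine h t) :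
    (g t ≤ h t ∧ ∀ᶠ ε in 𝓝[>] (0 : ℝ), g (t + ε) ≤ h (t + ε)) ∨
      (h t ≤ g t ∧ ∀ᶠ ε in 𝓝[>] (0 : ℝ), h (t + ε) ≤ g (t + ε)) := by
  have key : ∀ {g h : ℝ → ℝ} {m n : ℝ}, (∀ᶠ ε in 𝓝[>] (0 : ℝ), g (t + ε) = g t + m * ε) →
      (∀ᶠ ε in 𝓝[>] (0 : ℝ), h (t + ε) = h t + n * ε) → g t < h t →
      ∀ᶠ ε in 𝓝[>] (0 : ℝ), g (t + ε) ≤ h (t + ε) := by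
    intro g h m n hg hh hlt
    have hc : Tendsto (fun ε : ℝ => h t + n * ε - (g t + m * ε)) (𝓝[>] 0)
        (𝓝 (h t + n * 0 - (g t + m * 0))) :=
      (Continuous.tendsto (by fun_prop) 0).mono_left nhdsWithin_le_nhds
    filter_upwards [hg, hh, hc.eventually_const_lt (u := 0) (by linarith)] with ε h1 h2 h3
    linarith
  obtain ⟨m, hm⟩ := hg
  obtain ⟨n, hn⟩ := hh
  rcases lt_trichotomy (g t) (h t) with hlt | heq | hlt
  · exact Or.inl ⟨hlt.le, key hm hn hlt⟩
  · rcases le_total m n with hmn | hmn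
    · refine Or.inl ⟨heq.le, ?_⟩
      filter_upwards [hm, hn, self_mem_nhdsWithin] with ε h1 h2 h3
      rw [h1, h2, heq]
      exact add_le_add_right (mul_le_mul_of_nonneg_right hmn (le_of_lt h3)) _
    · refine Or.inr ⟨heq.ge, ?_⟩
      filter_upwards [hm, hn, self_mem_nhdsWithin] with ε h1 h2 h3
      rw [h1, h2, heq]
      exact add_le_add_right (mul_le_mul_of_nonneg_right hmn (le_of_lt h3)) _
  · exact Or.inr ⟨hlt.le, key hn hm hlt⟩

theorem congr (hg : RightAffine g t) (h0 : h t = g t)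
    (hh : ∀ᶠ ε in 𝓝[>] (0 : ℝ), h (t + ε) = g (t + ε)) : RightAffine h t := by
  obtain ⟨m, hm⟩ := hg
  refine ⟨m, ?_⟩
  filter_upwards [hm, hh] with ε h1 h2
  rw [h2, h1, h0]

theorem sup (hg : RightAffine g t) (hh : RightAffine h t) : RightAffine (g ⊔ h) t := by
  rcases eventually_le_or hg hh with ⟨h0, h1⟩ | ⟨h0, h1⟩
  · exact hh.congr (sup_eq_right.2 h0) (h1.mono fun ε h => sup_eq_right.2 h)
  · exact hg.congr (sup_eq_left.2 h0) (h1.mono fun ε h => sup_eq_left.2 h)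

theorem inf (hg : RightAffine g t) (hh : RightAffine h t) : RightAffine (g ⊓ h) t := by
  rcases eventually_le_or hg hh with ⟨h0, h1⟩ | ⟨h0, h1⟩
  · exact hg.congr (inf_eq_left.2 h0) (h1.mono fun ε h => inf_eq_left.2 h)
  · exact hh.congr (inf_eq_right.2 h0) (h1.mono fun ε h => inf_eq_right.2 h)

end RightAffine

/-! ### Piecewise affinity of the invariant and existence of slopes -/

namespace OrientedAnnularDiagram

variable (D : OrientedAnnularDiagram)

theorem rightAffine_jtGrading (S : D.EnhancedState) (t : ℝ) :
    RightAffine (fun t => D.jtGrading t S) t := by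
  refine ⟨-D.kGrading S, Eventually.of_forall fun ε => ?_⟩
  simp only [jtGrading]
  ring

variable {D} in
theorem gr_eq_inf' (t : ℝ) {x : D.LeeChain} {U : Finset D.EnhancedState} (hU : U.Nonempty)
    (hx : ∀ S, S ∈ U ↔ x S ≠ 0) :
    D.gr t x = U.inf' hU (fun S t => D.jtGrading t S) t := by
  rw [Finset.inf'_apply]
  refine le_antisymm (Finset.le_inf' _ _ fun S hS => gr_le ((hx S).1 hS)) ?_
  refine le_gr (fun h => ?_) fun S hS => Finset.inf'_le _ ((hx S).2 hS)
  obtain ⟨S, hS⟩ := hU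
  exact (hx S).1 hS (congrFun h S)

/-- The filtration grading of a chain depends only on its support, and the supports of
representatives form a finite set that does not involve `t`. Each support gives a minimum of
functions affine in `t`. -/
theorem exists_sup'_inf' : ∃ (A : Finset (ℝ → ℝ)) (hA : A.Nonempty),
    (∀ g ∈ A, ∀ t, RightAffine g t) ∧ D.annularRasmussen = A.sup' hA id := by
  classical
  let IsRep : D.LeeChain → Prop := fun x => D.leeDifferential x = 0 ∧
    x - D.canonicalCycle ∈ LinearMap.range D.leeDifferential
  have hne : ∀ x, IsRep x → ∃ S, x S ≠ 0 := by
    rintro x ⟨-, z, hz⟩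
    -- Any parameter would do: the functional only serves to show that representatives are nonzero.
    obtain ⟨-, f, -, hfd, hfs⟩ := D.attainsLevel_canonicalCycle 0
    by_contra! hx
    refine hfs ?_
    have h := hfd z
    simp only [hz, Pi.sub_apply, hx, zero_sub, mul_neg, Finset.sum_neg_distrib, neg_eq_zero] at h
    exact h
  let supp : D.LeeChain → Finset D.EnhancedState := fun x => Finset.univ.filter fun S => x S ≠ 0
  have hsupp : ∀ x S, S ∈ supp x ↔ x S ≠ 0 := fun x S => by simp [supp]
  let G : Finset D.EnhancedState → ℝ → ℝ := fun U =>
    -- The value for the empty support is arbitrary, since no representative has it.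
    if hU : U.Nonempty then U.inf' hU fun S t => D.jtGrading t S else 0
  have hG : ∀ x, IsRep x → ∀ t, D.gr t x = G (supp x) t := by
    intro x hx t
    obtain ⟨S, hS⟩ := hne x hx
    have hU : (supp x).Nonempty := ⟨S, (hsupp x S).2 hS⟩
    rw [show G (supp x) = _ from dif_pos hU]
    exact gr_eq_inf' t hU (hsupp x)
  let A : Finset (ℝ → ℝ) := (Finset.univ.filter fun U => ∃ x, IsRep x ∧ supp x = U).image G
  have hmemA : ∀ x, IsRep x → G (supp x) ∈ A := fun x hx =>
    Finset.mem_image_of_mem _ (Finset.mem_filter.2 ⟨Finset.mem_univ _, x, hx, rfl⟩)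
  have hAmem : ∀ g ∈ A, ∃ x, IsRep x ∧ g = G (supp x) := by
    intro g hg
    obtain ⟨U, hU, rfl⟩ := Finset.mem_image.1 hg
    obtain ⟨-, x, hx, rfl⟩ := Finset.mem_filter.1 hU
    exact ⟨x, hx, rfl⟩
  have hA : A.Nonempty := ⟨_, hmemA D.canonicalCycle
    ⟨leeDifferential_canonicalCycle, by rw [sub_self]; exact zero_mem _⟩⟩
  refine ⟨A, hA, fun g hg t => ?_, funext fun t => ?_⟩
  · obtain ⟨x, hx, rfl⟩ := hAmem g hg
    obtain ⟨S, hS⟩ := hne x hx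
    have hU : (supp x).Nonempty := ⟨S, (hsupp x S).2 hS⟩
    rw [show G (supp x) = _ from dif_pos hU]
    exact Finset.inf'_induction hU _ (p := fun g => RightAffine g t)
      (fun _ h1 _ h2 => h1.inf h2) fun S _ => D.rightAffine_jtGrading S t
  · obtain ⟨⟨x, hx, hx', hxt⟩, hmax⟩ := AttainsLevel.isGreatest_classGradings (D.attainsLevel_canonicalCycle t)
    rw [Finset.sup'_apply]
    refine le_antisymm ?_ (Finset.sup'_le _ _ fun g hg => ?_)
    · rw [hxt, hG x ⟨hx, hx'⟩]
      exact Finset.le_sup' (fun g : ℝ → ℝ => id g t) (hmemA x ⟨hx, hx'⟩)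
    · obtain ⟨y, hy, rfl⟩ := hAmem g hg
      exact hmax ⟨y, hy.1, hy.2, (hG y hy t).symm⟩

theorem exists_hasSlope (t : ℝ) : ∃ m, D.HasSlope t m := by
  obtain ⟨A, hA, hg, h⟩ := D.exists_sup'_inf'
  have hD : RightAffine D.annularRasmussen t := by
    rw [h]
    exact Finset.sup'_induction hA _ (p := fun g => RightAffine g t)
      (fun _ h1 _ h2 => h1.sup h2) fun g hgA => hg g hgA t
  obtain ⟨m, hm⟩ := hD
  refine ⟨m, tendsto_const_nhds.congr' ?_⟩
  filter_upwards [hm, self_mem_nhdsWithin] with ε h1 h2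
  rw [h1, add_sub_cancel_left, mul_div_cancel_right₀ _ (ne_of_gt h2)]

theorem isGreatest_annularRasmussen (t : ℝ) :
    IsGreatest (D.classGradings t) (D.annularRasmussen t) :=
  AttainsLevel.isGreatest_classGradings (D.attainsLevel_canonicalCycle t)

end OrientedAnnularDiagram

theorem proposition5p11 (D D' : OrientedAnnularDiagram) :
    (∀ t ∈ Set.Icc (0 : ℝ) 2,
      IsGreatest (D.classGradings t) (D.annularRasmussen t) ∧
      IsGreatest (D'.classGradings t) (D'.annularRasmussen t) ∧
      IsGreatest ((D.annularComp D').classGradings t) ((D.annularComp D').annularRasmussen t) ∧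
      (D.annularComp D').annularRasmussen t = D.annularRasmussen t + D'.annularRasmussen t) ∧
    (∀ t ∈ Set.Ico (0 : ℝ) 2, ∃ m m' : ℝ,
      D.HasSlope t m ∧ D'.HasSlope t m' ∧ (D.annularComp D').HasSlope t (m + m')) := by
  refine ⟨fun t _ => ⟨D.isGreatest_annularRasmussen t, D'.isGreatest_annularRasmussen t,
    (D.annularComp D').isGreatest_annularRasmussen t, D.annularRasmussen_annularComp D' t⟩,
    fun t _ => ?_⟩
  obtain ⟨m, hm⟩ := D.exists_hasSlope t
  obtain ⟨m', hm'⟩ := D'.exists_hasSlope t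
  -- Additivity holds for every real parameter, so the difference quotients add for every `ε`.
  refine ⟨m, m', hm, hm', (hm.add hm').congr fun ε => ?_⟩
  rw [D.annularRasmussen_annularComp D', D.annularRasmussen_annularComp D']
  ring
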